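/- Let $\Bbbk$ be an algebraically closed field and let $\mathscr{C}$ be a fiat 2-category over $\Bbbk$: a strict 2-category with finitely many objects, whose hom-categories $\mathscr{C}(\mathtt{i},\mathtt{j})$ are additive, idempotent complete, $\Bbbk$-linear with finite-dimensional morphism spaces and finitely many isomorphism classes of indecomposable objects, whose horizontal composition is $\Bbbk$-bilinear, whose identity 1-morphisms $\mathbb{1}_{\mathtt{i}}$ are indecomposable, and which has a weak involution $*$ (fixing objects, reversing 1- and 2-morphisms) such that every 1-morphism $F$ is left adjoint to $F^*$. For indecomposable 1-morphisms write $F\le_R G$ (resp. $F\le_L G$, $F\le_{LR}G$) if $G$ is a direct summand of $H\circ F$ (resp. $F\circ H$, $H_2\circ F\circ H_1$) for some 1-morphisms $H,H_1,H_2$; right, left and two-sided cells are the equivalence classes of these preorders. A two-sided cell $\mathcal{Q}$ is strongly regular if any two different right cells in $\mathcal{Q}$ are $\le_R$-incomparable and every left cell and every right cell in $\mathcal{Q}$ have exactly one element in common, up to isomorphism. For a right cell $\mathcal{R}$ of 1-morphisms with source $\mathtt{i}$, let $\overline{\mathscr{C}}(\mathtt{i},\mathtt{j})$ be the abelianization of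 $\mathscr{C}(\mathtt{i},\mathtt{j})$ (objects: morphisms $X_1\to X_0$; morphisms: commutative squares modulo those whose component $X_0\to Y_0$ factors through $Y_1\to Y_0$), with $\mathscr{C}$ acting by left composition, and let $P_F$ denote the projective object $0\to F$. Let $L_{\mathcal{R}}$ be the simple top of the unique subobject $K\subseteq P_{\mathbb{1}_{\mathtt{i}}}$ such that all $F\in\mathcal{R}$ annihilate every simple subquotient of $P_{\mathbb{1}_{\mathtt{i}}}/K$, and $K$ has simple top not annihilated by any $F\in\mathcal{R}$. The cell 2-representation $\mathbf{C}_{\mathcal{R}}$ sends $\mathtt{j}$ to the full subcategory of $\overline{\mathscr{C}}(\mathtt{i},\mathtt{j})$ of the cokernels of morphisms between objects of the additive closure of $\{F L_{\mathcal{R}} : F\in\mathcal{R}\cap\mathscr{C}(\mathtt{i},\mathtt{j})\}$. Let $\mathcal{Q}$ be a strongly regular two-sided cell of $\mathscr{C}$, let $\mathscr{I}_{\mathcal{Q}}$ be the 2-ideal generated by the identity 2-morphisms of all indecomposable $F$ with $F\not\le_{LR}\mathcal{Q}$, and let $\mathscr{C}_{\mathcal{Q}}$ be the full 2-subcategory of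 $\mathscr{C}/\mathscr{I}_{\mathcal{Q}}$, closed under isomorphisms, finite direct sums and direct summands, generated by the identity 1-morphisms and the elements of $\mathcal{Q}$. Then: 1. $\mathcal{Q}$ remains a two-sided cell of $\mathscr{C}_{\mathcal{Q}}$: the 1-morphisms of $\mathscr{C}_{\mathcal{Q}}$ isomorphic to elements of $\mathcal{Q}$ form a two-sided cell of $\mathscr{C}_{\mathcal{Q}}$, and non-isomorphic elements of $\mathcal{Q}$ remain non-isomorphic. 2. Every right cell $\mathcal{R}\subseteq\mathcal{Q}$ remains a right cell of $\mathscr{C}_{\mathcal{Q}}$. The objects $L_{\mathcal{R}}$ over $\mathscr{C}$ and over $\mathscr{C}_{\mathcal{Q}}$ exist, so that the cell 2-representations of $\mathscr{C}$ and of $\mathscr{C}_{\mathcal{Q}}$ for $\mathcal{R}$ are defined; $\mathscr{I}_{\mathcal{Q}}$ annihilates $\mathbf{C}_{\mathcal{R}}$; and the restriction of $\mathbf{C}_{\mathcal{R}}$ from $\mathscr{C}$ to $\mathscr{C}_{\mathcal{Q}}$ is equivalent, through a pseudonatural transformation whose components are $\Bbbk$-linear equivalences of categories, to the cell 2-representation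 of $\mathscr{C}_{\mathcal{Q}}$ for $\mathcal{R}$. -/

import Mathlib

open CategoryTheory CategoryTheory.Bicategory CategoryTheory.Limits

universe w v u t

noncomputable section

namespace FiatCells

/-- The hom-categories are preadditive and horizontal composition is biadditive. Throughout,
`F ≫ G` denotes the composition of `F : i ⟶ j` and `G : j ⟶ l`, usually written `G ∘ F`. -/
class PreadditiveBicategory (B : Type u) [Bicategory.{w, v} B] where
  homPreadditive (i j : B) : Preadditive (i ⟶ j)
  whiskerLeft_add {i j l : B} (F : i ⟶ j) {G H : j ⟶ l} (α β : G ⟶ H) :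
    F ◁ (α + β) = F ◁ α + F ◁ β
  add_whiskerRight {i j l : B} {F G : i ⟶ j} (α β : F ⟶ G) (H : j ⟶ l) :
    (α + β) ▷ H = α ▷ H + β ▷ H

attribute [reducible, instance] PreadditiveBicategory.homPreadditive

/-- The hom-categories are `k`-linear and horizontal composition is `k`-bilinear. -/
class LinearBicategory (k : Type t) [Field k] (B : Type u) [Bicategory.{w, v} B]
    [PreadditiveBicategory B] where
  homLinear (i j : B) : Linear k (i ⟶ j)
  whiskerLeft_smul {i j l : B} (F : i ⟶ j) {G H : j ⟶ l} (c : k) (α : G ⟶ H) :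
    F ◁ (c • α) = c • (F ◁ α)
  smul_whiskerRight {i j l : B} {F G : i ⟶ j} (c : k) (α : F ⟶ G) (H : j ⟶ l) :
    (c • α) ▷ H = c • (α ▷ H)

attribute [reducible, instance] LinearBicategory.homLinear

/-- The hom-categories are additive. -/
class AdditiveBicategory (B : Type u) [Bicategory.{w, v} B] [PreadditiveBicategory B] : Prop where
  hasZeroObject (i j : B) : HasZeroObject (i ⟶ j)
  hasBinaryBiproducts (i j : B) : HasBinaryBiproducts (i ⟶ j)

attribute [instance] AdditiveBicategory.hasZeroObject AdditiveBicategory.hasBinaryBiproducts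

/-- A `k`-linear 2-ideal: subspaces of the spaces of 2-morphisms which are stable under vertical and
horizontal composition with arbitrary 2-morphisms. -/
structure TwoIdeal (k : Type t) [Field k] (B : Type u) [Bicategory.{w, v} B]
    [PreadditiveBicategory B] [LinearBicategory k B] where
  carrier {i j : B} (F G : i ⟶ j) : Submodule k (F ⟶ G)
  precomp_mem {i j : B} {E F G : i ⟶ j} (η : E ⟶ F) {α : F ⟶ G} :
    α ∈ carrier F G → η ≫ α ∈ carrier E G
  postcomp_mem {i j : B} {F G H : i ⟶ j} {α : F ⟶ G} (η : G ⟶ H) :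
    α ∈ carrier F G → α ≫ η ∈ carrier F H
  whiskerLeft_mem {i j l : B} (H : i ⟶ j) {F G : j ⟶ l} {α : F ⟶ G} :
    α ∈ carrier F G → H ◁ α ∈ carrier (H ≫ F) (H ≫ G)
  whiskerRight_mem {i j l : B} {F G : i ⟶ j} {α : F ⟶ G} (H : j ⟶ l) :
    α ∈ carrier F G → α ▷ H ∈ carrier (F ≫ H) (G ≫ H)

section Quotient

variable {k : Type t} [Field k] {B : Type u} [Bicategory.{w, v} B]
    [PreadditiveBicategory B] [LinearBicategory k B]

namespace TwoIdeal

variable (J : TwoIdeal k B)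

/-- Two parallel 2-morphisms are identified if their difference is in the ideal. -/
def rel (i j : B) : HomRel (i ⟶ j) := fun F G α β => α - β ∈ J.carrier F G

instance (i j : B) : Congruence (J.rel i j) where
  equivalence :=
    { refl := fun α => by simp [rel]
      symm := fun {α β} h => by
        have := (J.carrier _ _).neg_mem h
        simpa [rel] using this
      trans := fun {α β γ} h h' => by
        have := (J.carrier _ _).add_mem h h'
        simpa [rel] using this }
  comp_left η _ _ h := by
    have := J.precomp_mem η h
    simpa [rel, Preadditive.comp_sub] using this
  comp_right η h := by
    have := J.postcomp_mem η h
    simpa [rel, Preadditive.sub_comp] using this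

/-- The objects of the quotient 2-category. -/
structure QuotObj (_J : TwoIdeal k B) where
  as : B

/-- The hom-category of the quotient. -/
def QuotHom (i j : J.QuotObj) := CategoryTheory.Quotient (J.rel i.as j.as)

instance (i j : J.QuotObj) : Category (J.QuotHom i j) :=
  inferInstanceAs (Category (CategoryTheory.Quotient (J.rel i.as j.as)))

instance (i j : J.QuotObj) : Preadditive (J.QuotHom i j) :=
  CategoryTheory.Quotient.preadditive (J.rel i.as j.as) (by
    intro F G α β α' β' h h'
    have := (J.carrier _ _).add_mem h h'
    have e : α + α' - (β + β') = α - β + (α' - β') := by abel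
    simpa [rel, e] using this)

/-- The projection functor from the hom-category to the hom-category of the quotient. -/
def proj (i j : B) : (i ⟶ j) ⥤ J.QuotHom ⟨i⟩ ⟨j⟩ := CategoryTheory.Quotient.functor (J.rel i j)

instance (i j : B) : (J.proj i j).Additive where

instance (i j : J.QuotObj) : Linear k (J.QuotHom i j) :=
  letI : Preadditive (CategoryTheory.Quotient (J.rel i.as j.as)) :=
    inferInstanceAs (Preadditive (J.QuotHom i j))
  haveI : (CategoryTheory.Quotient.functor (J.rel i.as j.as)).Additive :=
    inferInstanceAs (J.proj i.as j.as).Additive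
  CategoryTheory.Quotient.linear k (J.rel i.as j.as) (by
    intro c F G α β h
    have := (J.carrier _ _).smul_mem c h
    simpa [rel, smul_sub] using this)

instance (i j : B) : (J.proj i j).Linear k where

instance (i j : B) : (J.proj i j).Full := CategoryTheory.Quotient.full_functor _

theorem proj_map_eq {i j : B} {F G : i ⟶ j} {α β : F ⟶ G} (h : α - β ∈ J.carrier F G) :
    (J.proj i j).map α = (J.proj i j).map β := CategoryTheory.Quotient.sound _ h

/-- Left whiskering in the quotient. -/
def whiskerLeftFunctor {i j : J.QuotObj} (F : J.QuotHom i j) (l : J.QuotObj) :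
    J.QuotHom j l ⥤ J.QuotHom i l :=
  CategoryTheory.Quotient.lift (J.rel j.as l.as) (precomp l.as F.as ⋙ J.proj i.as l.as) (by
    intro G H α β h
    have h1 : F.as ◁ α - F.as ◁ β ∈ J.carrier _ _ := by
      have := J.whiskerLeft_mem F.as h
      have e : F.as ◁ (α - β) + F.as ◁ β = F.as ◁ α := by
        rw [← PreadditiveBicategory.whiskerLeft_add, sub_add_cancel]
      rwa [← e, add_sub_cancel_right]
    exact J.proj_map_eq h1)

/-- Right whiskering in the quotient. -/
def whiskerRightFunctor (i : J.QuotObj) {j l : J.QuotObj} (H : J.QuotHom j l) :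
    J.QuotHom i j ⥤ J.QuotHom i l :=
  CategoryTheory.Quotient.lift (J.rel i.as j.as) (postcomp i.as H.as ⋙ J.proj i.as l.as) (by
    intro F G α β h
    have h1 : α ▷ H.as - β ▷ H.as ∈ J.carrier _ _ := by
      have := J.whiskerRight_mem H.as h
      have e : (α - β) ▷ H.as + β ▷ H.as = α ▷ H.as := by
        rw [← PreadditiveBicategory.add_whiskerRight, sub_add_cancel]
      rwa [← e, add_sub_cancel_right]
    exact J.proj_map_eq h1)

/-- The quotient of a 2-category by a 2-ideal: the same objects and 1-morphisms, and 2-morphisms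
modulo the ideal. -/
instance : Bicategory.{w, v} J.QuotObj where
  Hom i j := J.QuotHom i j
  id i := ⟨𝟙 i.as⟩
  comp F G := ⟨F.as ≫ G.as⟩
  homCategory i j := inferInstanceAs (Category (J.QuotHom i j))
  whiskerLeft {_ _ l} F _ _ η := (J.whiskerLeftFunctor F l).map η
  whiskerRight {i _ _ _ _} η H := (J.whiskerRightFunctor i H).map η
  associator F G H := (J.proj _ _).mapIso (α_ F.as G.as H.as)
  leftUnitor F := (J.proj _ _).mapIso (λ_ F.as)
  rightUnitor F := (J.proj _ _).mapIso (ρ_ F.as)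
  whiskerLeft_id F G := (J.whiskerLeftFunctor F _).map_id G
  whiskerLeft_comp F _ _ _ η θ := (J.whiskerLeftFunctor F _).map_comp η θ
  id_whiskerLeft := by
    rintro i j F G ⟨η⟩
    exact congrArg (J.proj _ _).map (Bicategory.id_whiskerLeft η)
  comp_whiskerLeft := by
    rintro i j l m F G H H' ⟨η⟩
    exact congrArg (J.proj _ _).map (Bicategory.comp_whiskerLeft F.as G.as η)
  id_whiskerRight F G := (J.whiskerRightFunctor _ G).map_id F
  comp_whiskerRight η θ H := (J.whiskerRightFunctor _ H).map_comp η θ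
  whiskerRight_id := by
    rintro i j F G ⟨η⟩
    exact congrArg (J.proj _ _).map (Bicategory.whiskerRight_id η)
  whiskerRight_comp := by
    rintro i j l m F F' ⟨η⟩ G H
    exact congrArg (J.proj _ _).map (Bicategory.whiskerRight_comp η G.as H.as)
  whisker_assoc := by
    rintro i j l m F ⟨G⟩ ⟨G'⟩ ⟨η⟩ H
    exact congrArg (J.proj _ _).map (Bicategory.whisker_assoc F.as η H.as)
  whisker_exchange := by
    rintro i j l F G H K ⟨η⟩ ⟨θ⟩
    exact congrArg (J.proj _ _).map (Bicategory.whisker_exchange η θ)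
  pentagon F G H K :=
    congrArg (J.proj _ _).map (Bicategory.pentagon F.as G.as H.as K.as)
  triangle F G := congrArg (J.proj _ _).map (Bicategory.triangle F.as G.as)

instance : PreadditiveBicategory J.QuotObj where
  homPreadditive i j := inferInstanceAs (Preadditive (J.QuotHom i j))
  whiskerLeft_add := by
    rintro i j l F G H ⟨α⟩ ⟨β⟩
    exact congrArg (J.proj _ _).map (PreadditiveBicategory.whiskerLeft_add F.as α β)
  add_whiskerRight := by
    rintro i j l F G ⟨α⟩ ⟨β⟩ H
    exact congrArg (J.proj _ _).map (PreadditiveBicategory.add_whiskerRight α β H.as)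

instance : LinearBicategory k J.QuotObj where
  homLinear i j := inferInstanceAs (Linear k (J.QuotHom i j))
  whiskerLeft_smul := by
    rintro i j l F G H c ⟨α⟩
    exact congrArg (J.proj _ _).map (LinearBicategory.whiskerLeft_smul F.as c α)
  smul_whiskerRight := by
    rintro i j l F G c ⟨α⟩ H
    exact congrArg (J.proj _ _).map (LinearBicategory.smul_whiskerRight c α H.as)

open ZeroObject in
instance [AdditiveBicategory B] : AdditiveBicategory J.QuotObj where
  hasZeroObject i j :=
    ⟨(J.proj i.as j.as).obj 0, (J.proj i.as j.as).map_isZero (isZero_zero (i.as ⟶ j.as))⟩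
  hasBinaryBiproducts i j := HasBinaryBiproducts.mk fun F G =>
    hasBinaryBiproduct_of_total
      ((J.proj i.as j.as).mapBinaryBicone (BinaryBiproduct.bicone F.as G.as)) (by
        have := congrArg (J.proj i.as j.as).map (biprod.total (X := F.as) (Y := G.as))
        rw [Functor.map_add, Functor.map_comp, Functor.map_comp] at this
        exact this.trans ((J.proj i.as j.as).map_id _))

/-- A pseudofunctor which identifies 2-morphisms that are congruent modulo the ideal, regarded as a
pseudofunctor on the quotient. -/
def desc {D : Type*} [Bicategory D] (M : B ⥤ᵖ D)
    (h : ∀ {i j : B} {F G : i ⟶ j} (α β : F ⟶ G), α - β ∈ J.carrier F G → M.map₂ α = M.map₂ β) :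
    J.QuotObj ⥤ᵖ D where
  obj i := M.obj i.as
  map F := M.map F.as
  map₂ {i j _ _} η := (CategoryTheory.Quotient.lift (J.rel i.as j.as) (M.mapFunctor i.as j.as)
    (fun _ _ α β hαβ => h α β hαβ)).map η
  map₂_id F := M.map₂_id F.as
  map₂_comp := by
    rintro i j F G H ⟨α⟩ ⟨β⟩
    exact M.map₂_comp α β
  mapId i := M.mapId i.as
  mapComp F G := M.mapComp F.as G.as
  map₂_whisker_left := by
    rintro i j l F G H ⟨α⟩
    exact M.map₂_whisker_left F.as α
  map₂_whisker_right := by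
    rintro i j l F G ⟨α⟩ H
    exact M.map₂_whisker_right α H.as
  map₂_associator F G H := M.map₂_associator F.as G.as H.as
  map₂_left_unitor F := M.map₂_left_unitor F.as
  map₂_right_unitor F := M.map₂_right_unitor F.as

end TwoIdeal
end Quotient

section FullSub

/-- A class of 1-morphisms that contains the identities and is closed under composition. -/
structure OneSubcat (B : Type u) [Bicategory.{w, v} B] where
  prop (i j : B) : ObjectProperty (i ⟶ j)
  id_mem (i : B) : prop i i (𝟙 i)
  comp_mem {i j l : B} {F : i ⟶ j} {G : j ⟶ l} : prop i j F → prop j l G → prop i l (F ≫ G)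

namespace OneSubcat

variable {B : Type u} [Bicategory.{w, v} B] (P : OneSubcat B)

/-- The objects of the full sub-2-category given by a class of 1-morphisms. -/
structure SubObj (_P : OneSubcat B) where
  as : B

instance : CategoryStruct.{v} P.SubObj where
  Hom i j := (P.prop i.as j.as).FullSubcategory
  id i := ⟨𝟙 i.as, P.id_mem i.as⟩
  comp F G := ⟨F.obj ≫ G.obj, P.comp_mem F.property G.property⟩

instance : Bicategory.{w, v} P.SubObj where
  homCategory i j := inferInstanceAs (Category (P.prop i.as j.as).FullSubcategory)
  whiskerLeft F _ _ η := ObjectProperty.homMk (F.obj ◁ η.hom)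
  whiskerRight η H := ObjectProperty.homMk (η.hom ▷ H.obj)
  associator F G H := ObjectProperty.isoMk _ (α_ F.obj G.obj H.obj)
  leftUnitor F := ObjectProperty.isoMk _ (λ_ F.obj)
  rightUnitor F := ObjectProperty.isoMk _ (ρ_ F.obj)
  whiskerLeft_id F G := ObjectProperty.hom_ext _ (Bicategory.whiskerLeft_id F.obj G.obj)
  whiskerLeft_comp F _ _ _ η θ :=
    ObjectProperty.hom_ext _ (Bicategory.whiskerLeft_comp F.obj η.hom θ.hom)
  id_whiskerLeft η := ObjectProperty.hom_ext _ (Bicategory.id_whiskerLeft η.hom)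
  comp_whiskerLeft F G _ _ η :=
    ObjectProperty.hom_ext _ (Bicategory.comp_whiskerLeft F.obj G.obj η.hom)
  id_whiskerRight F G := ObjectProperty.hom_ext _ (Bicategory.id_whiskerRight F.obj G.obj)
  comp_whiskerRight η θ H :=
    ObjectProperty.hom_ext _ (Bicategory.comp_whiskerRight η.hom θ.hom H.obj)
  whiskerRight_id η := ObjectProperty.hom_ext _ (Bicategory.whiskerRight_id η.hom)
  whiskerRight_comp η G H :=
    ObjectProperty.hom_ext _ (Bicategory.whiskerRight_comp η.hom G.obj H.obj)
  whisker_assoc F _ _ η H :=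
    ObjectProperty.hom_ext _ (Bicategory.whisker_assoc F.obj η.hom H.obj)
  whisker_exchange η θ :=
    ObjectProperty.hom_ext _ (Bicategory.whisker_exchange η.hom θ.hom)
  pentagon F G H K :=
    ObjectProperty.hom_ext _ (Bicategory.pentagon F.obj G.obj H.obj K.obj)
  triangle F G := ObjectProperty.hom_ext _ (Bicategory.triangle F.obj G.obj)

instance [PreadditiveBicategory B] : PreadditiveBicategory P.SubObj where
  homPreadditive i j := inferInstanceAs (Preadditive (P.prop i.as j.as).FullSubcategory)
  whiskerLeft_add F _ _ α β :=
    ObjectProperty.hom_ext _ (PreadditiveBicategory.whiskerLeft_add F.obj α.hom β.hom)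
  add_whiskerRight α β H :=
    ObjectProperty.hom_ext _ (PreadditiveBicategory.add_whiskerRight α.hom β.hom H.obj)

instance {k : Type t} [Field k] [PreadditiveBicategory B] [LinearBicategory k B] :
    LinearBicategory k P.SubObj where
  homLinear i j := inferInstanceAs (Linear k (P.prop i.as j.as).FullSubcategory)
  whiskerLeft_smul F _ _ c α :=
    ObjectProperty.hom_ext _ (LinearBicategory.whiskerLeft_smul F.obj c α.hom)
  smul_whiskerRight c α H :=
    ObjectProperty.hom_ext _ (LinearBicategory.smul_whiskerRight c α.hom H.obj)

/-- The inclusion of the full sub-2-category. -/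
def incl : P.SubObj ⥤ᵖ B where
  obj i := i.as
  map F := F.obj
  map₂ η := η.hom
  map₂_id _ := rfl
  map₂_comp _ _ := rfl
  mapId i := Iso.refl (𝟙 i.as)
  mapComp F G := Iso.refl (F.obj ≫ G.obj)
  map₂_whisker_left F _ _ η := by
    change F.obj ◁ η.hom = 𝟙 _ ≫ F.obj ◁ η.hom ≫ 𝟙 _
    rw [Category.id_comp, Category.comp_id]
  map₂_whisker_right η H := by
    change η.hom ▷ H.obj = 𝟙 _ ≫ η.hom ▷ H.obj ≫ 𝟙 _
    rw [Category.id_comp, Category.comp_id]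
  map₂_associator F G H := by
    change (α_ F.obj G.obj H.obj).hom = 𝟙 _ ≫ 𝟙 _ ▷ H.obj ≫ (α_ F.obj G.obj H.obj).hom ≫
      F.obj ◁ 𝟙 _ ≫ 𝟙 _
    simp
  map₂_left_unitor F := by
    change (λ_ F.obj).hom = 𝟙 _ ≫ 𝟙 _ ▷ F.obj ≫ (λ_ F.obj).hom
    simp
  map₂_right_unitor F := by
    change (ρ_ F.obj).hom = 𝟙 _ ≫ F.obj ◁ 𝟙 _ ≫ (ρ_ F.obj).hom
    simp

end OneSubcat

end FullSub

section Freyd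
open Preadditive

variable {V : Type*} [Category V] [Preadditive V] {W : Type*} [Category W] [Preadditive W]

section
variable (k : Type*) [Field k] [Linear k V]

instance arrowModule (X Y : Arrow V) : Module k (X ⟶ Y) where
  smul c f := Arrow.homMk (c • f.left) (c • f.right) (by simp)
  one_smul f := by ext <;> exact one_smul k _
  mul_smul a b f := by ext <;> exact mul_smul a b _
  smul_zero a := by ext <;> exact smul_zero a
  smul_add a f g := by ext <;> exact smul_add a _ _
  add_smul a b f := by ext <;> exact add_smul a b _
  zero_smul f := by ext <;> exact zero_smul k _

instance arrowLinear : Linear k (Arrow V) where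
  smul_comp X Y Z c f g := by ext <;> exact Linear.smul_comp _ _ _ _ _ _
  comp_smul X Y Z f c g := by ext <;> exact Linear.comp_smul _ _ _ _ _ _

instance freydLinear : Linear k (RightFreyd V) :=
  letI : Preadditive (CategoryTheory.Quotient (Arrow.rightHomotopic V)) :=
    inferInstanceAs (Preadditive (RightFreyd V))
  haveI : (CategoryTheory.Quotient.functor (Arrow.rightHomotopic V)).Additive :=
    inferInstanceAs (RightFreyd.quotient V).Additive
  CategoryTheory.Quotient.linear k (Arrow.rightHomotopic V) (by
    rintro c X Y f g ⟨h⟩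
    refine ⟨⟨c • h.hom, ?_⟩⟩
    change c • f.right - c • g.right = _
    rw [← smul_sub, h.comm, Linear.smul_comp])

end

/-- The functor between abelianizations induced by an additive functor. Here `RightFreyd V` has as
objects the morphisms `X₁ ⟶ X₀` of `V`, and as morphisms the commutative squares, modulo those squares
whose second component `X₀ ⟶ Y₀` factors through `Y₁ ⟶ Y₀`. -/
def freydMap (T : V ⥤ W) [T.Additive] : RightFreyd V ⥤ RightFreyd W :=
  CategoryTheory.Quotient.lift (Arrow.rightHomotopic V) (T.mapArrow ⋙ RightFreyd.quotient W) (by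
    rintro X Y f g ⟨h⟩
    refine RightFreyd.eq_of_rightHomotopy _ _ ⟨T.map h.hom, ?_⟩
    change T.map f.right - T.map g.right = T.map h.hom ≫ T.map Y.hom
    rw [← T.map_sub, h.comm, T.map_comp])

/-- The natural transformation between induced functors. -/
def freydHom {T S : V ⥤ W} [T.Additive] [S.Additive] (τ : T ⟶ S) : freydMap T ⟶ freydMap S where
  app X := (RightFreyd.quotient W).map
    (Arrow.homMk (τ.app X.as.left) (τ.app X.as.right) (τ.naturality X.as.hom).symm :
      T.mapArrow.obj X.as ⟶ S.mapArrow.obj X.as)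
  naturality := by
    rintro ⟨X⟩ ⟨Y⟩ ⟨f⟩
    change (RightFreyd.quotient W).map _ ≫ (RightFreyd.quotient W).map _ =
      (RightFreyd.quotient W).map _ ≫ (RightFreyd.quotient W).map _
    rw [← Functor.map_comp, ← Functor.map_comp]
    congr 1
    ext
    · exact τ.naturality _
    · exact τ.naturality _

end Freyd

section Principal
open Preadditive

variable {B : Type u} [Bicategory.{w, v} B] [PreadditiveBicategory B]

instance (i : B) {j l : B} (F : j ⟶ l) : (postcomp i F).Additive where
  map_add := PreadditiveBicategory.add_whiskerRight _ _ F

/-- The action of a 1-morphism `F : j ⟶ l` on the abelianized hom-categories out of `i`, by composition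
with `F`. -/
def act (i : B) {j l : B} (F : j ⟶ l) : RightFreyd (i ⟶ j) ⥤ RightFreyd (i ⟶ l) :=
  freydMap (postcomp i F)

/-- The action of a 2-morphism. -/
def actHom (i : B) {j l : B} {F G : j ⟶ l} (η : F ⟶ G) : act i F ⟶ act i G :=
  freydHom ((postcomposing i j l).map η)

/-- The identity 1-morphism acts as the identity. -/
def actId (i j : B) : act i (𝟙 j) ≅ 𝟭 (RightFreyd (i ⟶ j)) :=
  NatIso.ofComponents
    (fun X => (RightFreyd.quotient (i ⟶ j)).mapIso
      (Arrow.isoMk (ρ_ X.as.left) (ρ_ X.as.right) (Bicategory.rightUnitor_naturality X.as.hom).symm :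
        (postcomp i (𝟙 j)).mapArrow.obj X.as ≅ X.as)) (by
    rintro ⟨X⟩ ⟨Y⟩ ⟨f⟩
    change (RightFreyd.quotient _).map _ ≫ (RightFreyd.quotient _).map _ =
      (RightFreyd.quotient _).map _ ≫ (RightFreyd.quotient _).map _
    rw [← Functor.map_comp, ← Functor.map_comp]
    congr 1
    ext
    · exact Bicategory.rightUnitor_naturality _
    · exact Bicategory.rightUnitor_naturality _)

/-- The action is compatible with composition. -/
def actComp (i : B) {j l m : B} (F : j ⟶ l) (G : l ⟶ m) :
    act i (F ≫ G) ≅ act i F ⋙ act i G :=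
  NatIso.ofComponents
    (fun X => (RightFreyd.quotient (i ⟶ m)).mapIso
      (Arrow.isoMk (α_ X.as.left F G).symm (α_ X.as.right F G).symm
        (Bicategory.associator_inv_naturality_left X.as.hom F G).symm :
        (postcomp i (F ≫ G)).mapArrow.obj X.as ≅
          (postcomp i G).mapArrow.obj ((postcomp i F).mapArrow.obj X.as))) (by
    rintro ⟨X⟩ ⟨Y⟩ ⟨f⟩
    change (RightFreyd.quotient _).map _ ≫ (RightFreyd.quotient _).map _ =
      (RightFreyd.quotient _).map _ ≫ (RightFreyd.quotient _).map _
    rw [← Functor.map_comp, ← Functor.map_comp]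
    congr 1
    ext
    · exact Bicategory.associator_inv_naturality_left _ _ _
    · exact Bicategory.associator_inv_naturality_left _ _ _)

theorem quotient_map_congr {V : Type*} [Category V] [Preadditive V] {X Y : Arrow V} {f g : X ⟶ Y}
    (h₁ : f.left = g.left) (h₂ : f.right = g.right) :
    (RightFreyd.quotient V).map f = (RightFreyd.quotient V).map g := by
  congr 1
  ext
  · exact h₁
  · exact h₂

/-- The principal 2-representation `P_i`: it sends `j` to the abelianization of the category of
1-morphisms from `i` to `j`. -/
def principal (i : B) : B ⥤ᵖ Cat.{w, max v w} where
  obj j := Cat.of (RightFreyd (i ⟶ j))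
  map F := (act i F).toCatHom
  map₂ η := (actHom i η).toCatHom₂
  map₂_id F := by
    apply Cat.Hom₂.ext; apply NatTrans.ext; funext ⟨X⟩
    exact (quotient_map_congr (g := 𝟙 ((postcomp i F).mapArrow.obj X))
      (Bicategory.whiskerLeft_id _ _) (Bicategory.whiskerLeft_id _ _)).trans
      ((RightFreyd.quotient _).map_id _)
  map₂_comp η θ := by
    apply Cat.Hom₂.ext; apply NatTrans.ext; funext ⟨X⟩
    refine Eq.trans ?_ ((RightFreyd.quotient _).map_comp _ _)
    exact quotient_map_congr (Bicategory.whiskerLeft_comp _ _ _) (Bicategory.whiskerLeft_comp _ _ _)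
  mapId j := Cat.Hom.isoMk (actId i j)
  mapComp F G := Cat.Hom.isoMk (actComp i F G)
  map₂_whisker_left F _ _ η := by
    apply Cat.Hom₂.ext; apply NatTrans.ext; funext ⟨X⟩
    change (RightFreyd.quotient _).map _ =
      (RightFreyd.quotient _).map _ ≫ (RightFreyd.quotient _).map _ ≫ (RightFreyd.quotient _).map _
    rw [← Functor.map_comp, ← Functor.map_comp]
    apply quotient_map_congr
    · change _ ◁ F ◁ η = (α_ _ _ _).inv ≫ _ ◁ η ≫ (α_ _ _ _).hom
      simp
    · change _ ◁ F ◁ η = (α_ _ _ _).inv ≫ _ ◁ η ≫ (α_ _ _ _).hom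
      simp
  map₂_whisker_right η H := by
    apply Cat.Hom₂.ext; apply NatTrans.ext; funext ⟨X⟩
    change (RightFreyd.quotient _).map _ =
      (RightFreyd.quotient _).map _ ≫ (RightFreyd.quotient _).map _ ≫ (RightFreyd.quotient _).map _
    rw [← Functor.map_comp, ← Functor.map_comp]
    apply quotient_map_congr
    · change _ ◁ (η ▷ H) = (α_ _ _ _).inv ≫ (_ ◁ η) ▷ H ≫ (α_ _ _ _).hom
      simp
    · change _ ◁ (η ▷ H) = (α_ _ _ _).inv ≫ (_ ◁ η) ▷ H ≫ (α_ _ _ _).hom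
      simp
  map₂_associator F G H := by
    apply Cat.Hom₂.ext; apply NatTrans.ext; funext ⟨X⟩
    change (RightFreyd.quotient _).map _ =
      (RightFreyd.quotient _).map _ ≫ (RightFreyd.quotient _).map _ ≫
        𝟙 ((RightFreyd.quotient _).obj _) ≫
        (RightFreyd.quotient _).map _ ≫ (RightFreyd.quotient _).map _
    rw [Category.id_comp, ← Functor.map_comp, ← Functor.map_comp, ← Functor.map_comp]
    apply quotient_map_congr
    · change _ ◁ (α_ F G H).hom = (α_ _ _ _).inv ≫ (α_ _ _ _).inv ▷ H ≫ (α_ _ _ _).hom ≫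
        (α_ _ _ _).hom
      simp
    · change _ ◁ (α_ F G H).hom = (α_ _ _ _).inv ≫ (α_ _ _ _).inv ▷ H ≫ (α_ _ _ _).hom ≫
        (α_ _ _ _).hom
      simp
  map₂_left_unitor F := by
    apply Cat.Hom₂.ext; apply NatTrans.ext; funext ⟨X⟩
    change (RightFreyd.quotient _).map _ =
      (RightFreyd.quotient _).map _ ≫ (RightFreyd.quotient _).map _ ≫
        𝟙 ((RightFreyd.quotient _).obj _)
    rw [Category.comp_id, ← Functor.map_comp]
    apply quotient_map_congr
    · change _ ◁ (λ_ F).hom = (α_ _ _ _).inv ≫ (ρ_ _).hom ▷ F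
      simp
    · change _ ◁ (λ_ F).hom = (α_ _ _ _).inv ≫ (ρ_ _).hom ▷ F
      simp
  map₂_right_unitor F := by
    apply Cat.Hom₂.ext; apply NatTrans.ext; funext ⟨X⟩
    change (RightFreyd.quotient _).map _ =
      (RightFreyd.quotient _).map _ ≫ (RightFreyd.quotient _).map _ ≫
        𝟙 ((RightFreyd.quotient _).obj _)
    rw [Category.comp_id]
    refine Eq.trans ?_ ((RightFreyd.quotient _).map_comp _ _)
    apply quotient_map_congr
    · change _ ◁ (ρ_ F).hom = (α_ _ _ _).inv ≫ (ρ_ _).hom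
      simp
    · change _ ◁ (ρ_ F).hom = (α_ _ _ _).inv ≫ (ρ_ _).hom
      simp

end Principal

section Sub

variable {B : Type u} [Bicategory.{w, v} B]

/-- The full sub-2-representation of `M` on classes of objects that are stable under the action. -/
def subRep (M : B ⥤ᵖ Cat) (S : ∀ j : B, ObjectProperty (M.obj j))
    (hS : ∀ {j l : B} (F : j ⟶ l) (X : M.obj j), S j X → S l ((M.map F).toFunctor.obj X)) :
    B ⥤ᵖ Cat where
  obj j := Cat.of (S j).FullSubcategory
  map {j l} F := ((S l).lift ((S j).ι ⋙ (M.map F).toFunctor)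
    (fun X => hS F X.obj X.property)).toCatHom
  map₂ η := NatTrans.toCatHom₂
    { app := fun X => ObjectProperty.homMk ((M.map₂ η).toNatTrans.app X.obj)
      naturality := fun X Y f => ObjectProperty.hom_ext _ ((M.map₂ η).toNatTrans.naturality f.hom) }
  map₂_id F := by
    apply Cat.Hom₂.ext; apply NatTrans.ext; funext X; apply ObjectProperty.hom_ext
    exact congrArg (fun τ : M.map F ⟶ M.map F => τ.toNatTrans.app X.obj) (M.map₂_id F)
  map₂_comp η θ := by
    apply Cat.Hom₂.ext; apply NatTrans.ext; funext X; apply ObjectProperty.hom_ext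
    exact congrArg (fun τ : M.map _ ⟶ M.map _ => τ.toNatTrans.app X.obj) (M.map₂_comp η θ)
  mapId j := Cat.Hom.isoMk (NatIso.ofComponents
    (fun X => (S j).isoMk ((Cat.Hom.toNatIso (M.mapId j)).app X.obj))
    (fun f => ObjectProperty.hom_ext _ ((M.mapId j).hom.toNatTrans.naturality f.hom)))
  mapComp {j l m} F G := Cat.Hom.isoMk (NatIso.ofComponents
    (fun X => (S m).isoMk ((Cat.Hom.toNatIso (M.mapComp F G)).app X.obj))
    (fun f => ObjectProperty.hom_ext _ ((M.mapComp F G).hom.toNatTrans.naturality f.hom)))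
  map₂_whisker_left F _ _ η := by
    apply Cat.Hom₂.ext; apply NatTrans.ext; funext X; apply ObjectProperty.hom_ext
    exact congrArg (fun τ : M.map _ ⟶ M.map _ => τ.toNatTrans.app X.obj) (M.map₂_whisker_left F η)
  map₂_whisker_right η H := by
    apply Cat.Hom₂.ext; apply NatTrans.ext; funext X; apply ObjectProperty.hom_ext
    exact congrArg (fun τ : M.map _ ⟶ M.map _ => τ.toNatTrans.app X.obj) (M.map₂_whisker_right η H)
  map₂_associator F G H := by
    apply Cat.Hom₂.ext; apply NatTrans.ext; funext X; apply ObjectProperty.hom_ext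
    exact congrArg (fun τ : M.map _ ⟶ M.map _ => τ.toNatTrans.app X.obj) (M.map₂_associator F G H)
  map₂_left_unitor F := by
    apply Cat.Hom₂.ext; apply NatTrans.ext; funext X; apply ObjectProperty.hom_ext
    exact congrArg (fun τ : M.map _ ⟶ M.map _ => τ.toNatTrans.app X.obj) (M.map₂_left_unitor F)
  map₂_right_unitor F := by
    apply Cat.Hom₂.ext; apply NatTrans.ext; funext X; apply ObjectProperty.hom_ext
    exact congrArg (fun τ : M.map _ ⟶ M.map _ => τ.toNatTrans.app X.obj) (M.map₂_right_unitor F)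

end Sub

section OneMorphisms

/-- A 1-morphism together with its source and target. -/
structure OneMor (B : Type u) [Bicategory.{w, v} B] where
  dom : B
  cod : B
  mor : dom ⟶ cod

variable {B : Type u} [Bicategory.{w, v} B]

/-- Isomorphism of 1-morphisms (with the same source and target). -/
inductive Iso₁ : OneMor B → OneMor B → Prop
  | mk {i j : B} {F G : i ⟶ j} (e : F ≅ G) : Iso₁ ⟨i, j, F⟩ ⟨i, j, G⟩

/-- `F ≤_R G`: there is a 1-morphism `H` such that `G` is a direct summand of the composition
"first `F`, then `H`". In an idempotent complete additive category a direct summand is the same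
as a retract. -/
inductive LeR : OneMor B → OneMor B → Prop
  | mk {i j l : B} {F : i ⟶ j} {G : i ⟶ l} (H : j ⟶ l) (r : Retract G (F ≫ H)) :
      LeR ⟨i, j, F⟩ ⟨i, l, G⟩

/-- `F ≤_L G`: there is a 1-morphism `H` such that `G` is a direct summand of the composition
"first `H`, then `F`". -/
inductive LeL : OneMor B → OneMor B → Prop
  | mk {i j l : B} {F : i ⟶ j} {G : l ⟶ j} (H : l ⟶ i) (r : Retract G (H ≫ F)) :
      LeL ⟨i, j, F⟩ ⟨l, j, G⟩

/-- `F ≤_LR G`: there are 1-morphisms `H₁`, `H₂` such that `G` is a direct summand of the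
composition "first `H₁`, then `F`, then `H₂`". -/
inductive LeLR : OneMor B → OneMor B → Prop
  | mk {i j l m : B} {F : i ⟶ j} {G : l ⟶ m} (H₁ : l ⟶ i) (H₂ : j ⟶ m)
      (r : Retract G (H₁ ≫ F ≫ H₂)) : LeLR ⟨i, j, F⟩ ⟨l, m, G⟩

variable [PreadditiveBicategory B] [AdditiveBicategory B]

/-- Indecomposable 1-morphisms. -/
def OneMor.Indec (F : OneMor B) : Prop := Indecomposable F.mor

/-- The right cell of an indecomposable 1-morphism. -/
def rightCell (F : OneMor B) : Set (OneMor B) := {G | G.Indec ∧ LeR F G ∧ LeR G F}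

/-- The left cell of an indecomposable 1-morphism. -/
def leftCell (F : OneMor B) : Set (OneMor B) := {G | G.Indec ∧ LeL F G ∧ LeL G F}

/-- The two-sided cell of an indecomposable 1-morphism. -/
def twoSidedCell (F : OneMor B) : Set (OneMor B) := {G | G.Indec ∧ LeLR F G ∧ LeLR G F}

/-- `R` is a right cell. -/
def IsRightCell (R : Set (OneMor B)) : Prop := ∃ F : OneMor B, F.Indec ∧ R = rightCell F

/-- `L` is a left cell. -/
def IsLeftCell (L : Set (OneMor B)) : Prop := ∃ F : OneMor B, F.Indec ∧ L = leftCell F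

/-- `Q` is a two-sided cell. -/
def IsTwoSidedCell (Q : Set (OneMor B)) : Prop := ∃ F : OneMor B, F.Indec ∧ Q = twoSidedCell F

/-- Any two different right cells inside `Q` are incomparable with respect to `≤_R`. -/
def IsRegular (Q : Set (OneMor B)) : Prop :=
  ∀ R R' : Set (OneMor B), IsRightCell R → IsRightCell R' → R ⊆ Q → R' ⊆ Q → R ≠ R' →
    ∀ F ∈ R, ∀ G ∈ R', ¬ LeR F G

/-- `Q` is regular, and every left cell in `Q` and every right cell in `Q` have exactly one
1-morphism (up to isomorphism) in common. -/
def IsStronglyRegular (Q : Set (OneMor B)) : Prop :=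
  IsRegular Q ∧ ∀ L R : Set (OneMor B), IsLeftCell L → IsRightCell R → L ⊆ Q → R ⊆ Q →
    ∃ F ∈ L ∩ R, ∀ G ∈ L ∩ R, Iso₁ G F

end OneMorphisms

section Fiat

/-- A `k`-finitary 2-category. -/
structure IsFinitary (k : Type t) [Field k] (B : Type u) [Bicategory.{w, v} B]
    [PreadditiveBicategory B] [LinearBicategory k B] [AdditiveBicategory B] : Prop where
  /-- the 2-category is strict -/
  strict : Bicategory.Strict B
  /-- there are finitely many objects -/
  finite_obj : Finite B
  idempotentComplete (i j : B) : IsIdempotentComplete (i ⟶ j)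
  finiteDimensional {i j : B} (F G : i ⟶ j) : Module.Finite k (F ⟶ G)
  /-- there are finitely many isomorphism classes of indecomposable 1-morphisms -/
  finite_indec (i j : B) :
    ∃ s : Set (i ⟶ j), s.Finite ∧ ∀ F : i ⟶ j, Indecomposable F → ∃ G ∈ s, Nonempty (F ≅ G)
  /-- the identity 1-morphisms are indecomposable -/
  indec_id (i : B) : Indecomposable (𝟙 i)

/-- A weak involution: an object-preserving pseudofunctor which reverses the direction of both
1-morphisms and 2-morphisms, and whose square is naturally isomorphic to the identity. -/
structure Involution (B : Type u) [Bicategory.{w, v} B] where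
  star {i j : B} : (i ⟶ j) → (j ⟶ i)
  starHom {i j : B} {F G : i ⟶ j} : (F ⟶ G) → (star G ⟶ star F)
  starHom_id {i j : B} (F : i ⟶ j) : starHom (𝟙 F) = 𝟙 (star F)
  starHom_comp {i j : B} {F G H : i ⟶ j} (η : F ⟶ G) (θ : G ⟶ H) :
    starHom (η ≫ θ) = starHom θ ≫ starHom η
  starId (i : B) : star (𝟙 i) ≅ 𝟙 i
  starComp {i j l : B} (F : i ⟶ j) (G : j ⟶ l) : star (F ≫ G) ≅ star G ≫ star F
  starHom_whiskerLeft {i j l : B} (F : i ⟶ j) {G H : j ⟶ l} (η : G ⟶ H) :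
    starHom (F ◁ η) ≫ (starComp F G).hom = (starComp F H).hom ≫ starHom η ▷ star F
  starHom_whiskerRight {i j l : B} {F G : i ⟶ j} (η : F ⟶ G) (H : j ⟶ l) :
    starHom (η ▷ H) ≫ (starComp F H).hom = (starComp G H).hom ≫ star H ◁ starHom η
  starHom_associator {i j l m : B} (F : i ⟶ j) (G : j ⟶ l) (H : l ⟶ m) :
    starHom (α_ F G H).hom ≫ (starComp (F ≫ G) H).hom ≫ star H ◁ (starComp F G).hom =
      (starComp F (G ≫ H)).hom ≫ (starComp G H).hom ▷ star F ≫
        (α_ (star H) (star G) (star F)).hom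
  starHom_leftUnitor {i j : B} (F : i ⟶ j) :
    starHom (λ_ F).hom ≫ (starComp (𝟙 i) F).hom ≫ star F ◁ (starId i).hom = (ρ_ (star F)).inv
  starHom_rightUnitor {i j : B} (F : i ⟶ j) :
    starHom (ρ_ F).hom ≫ (starComp F (𝟙 j)).hom ≫ (starId j).hom ▷ star F = (λ_ (star F)).inv
  invol {i j : B} (F : i ⟶ j) : star (star F) ≅ F
  invol_naturality {i j : B} {F G : i ⟶ j} (η : F ⟶ G) :
    starHom (starHom η) ≫ (invol G).hom = (invol F).hom ≫ η

/-- A fiat 2-category: a `k`-finitary 2-category with a weak involution `*` such that every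
1-morphism `F` has `F*` as an adjoint. -/
def IsFiat (k : Type t) [Field k] (B : Type u) [Bicategory.{w, v} B]
    [PreadditiveBicategory B] [LinearBicategory k B] [AdditiveBicategory B] : Prop :=
  IsFinitary k B ∧ ∃ S : Involution B, ∀ {i j : B} (F : i ⟶ j), Nonempty (F ⊣ S.star F)

end Fiat

section CellTwoCategory

variable (k : Type t) [Field k] {B : Type u} [Bicategory.{w, v} B]
  [PreadditiveBicategory B] [LinearBicategory k B]

/-- The 2-ideal generated by the 1-morphisms in `S` (that is, by their identity 2-morphisms): the
intersection of all 2-ideals which contain the identity 2-morphisms of all elements of `S`. -/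
def TwoIdeal.generatedBy (S : Set (OneMor B)) : TwoIdeal k B where
  carrier F G := sInf {N | ∃ J : TwoIdeal k B,
    (∀ X ∈ S, 𝟙 X.mor ∈ J.carrier X.mor X.mor) ∧ N = J.carrier F G}
  precomp_mem := by
    intro _ _ _ _ _ η _ h
    rw [Submodule.mem_sInf] at h ⊢
    rintro _ ⟨J, hJ, rfl⟩
    exact J.precomp_mem η (h _ ⟨J, hJ, rfl⟩)
  postcomp_mem := by
    intro _ _ _ _ _ _ η h
    rw [Submodule.mem_sInf] at h ⊢
    rintro _ ⟨J, hJ, rfl⟩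
    exact J.postcomp_mem η (h _ ⟨J, hJ, rfl⟩)
  whiskerLeft_mem := by
    intro _ _ _ H _ _ _ h
    rw [Submodule.mem_sInf] at h ⊢
    rintro _ ⟨J, hJ, rfl⟩
    exact J.whiskerLeft_mem H (h _ ⟨J, hJ, rfl⟩)
  whiskerRight_mem := by
    intro _ _ _ _ _ _ H h
    rw [Submodule.mem_sInf] at h ⊢
    rintro _ ⟨J, hJ, rfl⟩
    exact J.whiskerRight_mem H (h _ ⟨J, hJ, rfl⟩)

variable [AdditiveBicategory B]

/-- The 2-ideal generated by all indecomposable 1-morphisms `F` with `F ≰_LR Q`. -/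
def cellIdeal (Q : Set (OneMor B)) : TwoIdeal k B :=
  TwoIdeal.generatedBy k {F | F.Indec ∧ ∀ G ∈ Q, ¬ LeLR F G}

variable {k}

/-- The 1-morphisms obtained from identities and from elements of `S` by composition, finite direct
sums, direct summands and isomorphisms. -/
inductive Gen (S : Set (OneMor B)) : ∀ {_i _j : B}, (_i ⟶ _j) → Prop
  | id (i : B) : Gen S (𝟙 i)
  | mem {i j : B} {F : i ⟶ j} : (⟨i, j, F⟩ : OneMor B) ∈ S → Gen S F
  | comp {i j l : B} {F : i ⟶ j} {G : j ⟶ l} : Gen S F → Gen S G → Gen S (F ≫ G)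
  | zero {i j : B} {F : i ⟶ j} : IsZero F → Gen S F
  | sum {i j : B} {F G : i ⟶ j} : Gen S F → Gen S G → Gen S (F ⊞ G)
  | retract {i j : B} {F G : i ⟶ j} : Retract F G → Gen S G → Gen S F

/-- The full sub-2-category generated by `S`. -/
def generated (S : Set (OneMor B)) : OneSubcat B where
  prop _ _ F := Gen S F
  id_mem i := Gen.id i
  comp_mem hF hG := Gen.comp hF hG

open ZeroObject in
instance (S : Set (OneMor B)) : AdditiveBicategory (generated S).SubObj where
  hasZeroObject i j := ⟨⟨0, Gen.zero (isZero_zero (i.as ⟶ j.as))⟩,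
    IsZero.of_full_of_faithful_of_isZero ((generated S).prop i.as j.as).ι _ (isZero_zero _)⟩
  hasBinaryBiproducts i j := HasBinaryBiproducts.mk fun F G =>
    hasBinaryBiproduct_of_total
      { pt := ⟨F.obj ⊞ G.obj, Gen.sum F.property G.property⟩
        fst := ObjectProperty.homMk biprod.fst
        snd := ObjectProperty.homMk biprod.snd
        inl := ObjectProperty.homMk biprod.inl
        inr := ObjectProperty.homMk biprod.inr
        inl_fst := ObjectProperty.hom_ext _ biprod.inl_fst
        inl_snd := ObjectProperty.hom_ext _ biprod.inl_snd
        inr_fst := ObjectProperty.hom_ext _ biprod.inr_fst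
        inr_snd := ObjectProperty.hom_ext _ biprod.inr_snd }
      (ObjectProperty.hom_ext _ biprod.total)

/-- The image of a 1-morphism in a quotient 2-category. -/
def TwoIdeal.toQuot (J : TwoIdeal k B) (F : OneMor B) : OneMor J.QuotObj :=
  ⟨⟨F.dom⟩, ⟨F.cod⟩, (J.proj _ _).obj F.mor⟩

variable (k)

/-- The 2-category associated with `Q`: the full sub-2-category (closed under isomorphisms, finite
direct sums and direct summands) of the quotient by `cellIdeal k Q` generated by the identities and the images of the elements of `Q`. -/
abbrev CellTwoCat (Q : Set (OneMor B)) : Type u :=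
  (generated ((cellIdeal k Q).toQuot '' Q)).SubObj

/-- An object of `B`, regarded as an object of the 2-category associated with `Q`. -/
abbrev cellObj (Q : Set (OneMor B)) (i : B) : CellTwoCat k Q := ⟨⟨i⟩⟩

/-- The 1-morphisms of the 2-category associated with `Q` which are isomorphic to the image of an
element of `S` (to be used for subsets `S` of `Q`). -/
def imageCell (Q S : Set (OneMor B)) : Set (OneMor (CellTwoCat k Q)) :=
  {X | ∃ F ∈ S, Iso₁ (⟨X.dom.as, X.cod.as, X.mor.obj⟩ : OneMor (cellIdeal k Q).QuotObj)
    ((cellIdeal k Q).toQuot F)}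

end CellTwoCategory

section CellRepresentations
open Preadditive

/-- The objects obtained from `S` by finite direct sums, direct summands and isomorphisms. -/
inductive AddClosure {A : Type*} [Category A] [Preadditive A] (S : Set A) : A → Prop
  | of {X : A} : X ∈ S → AddClosure S X
  | zero {X : A} : IsZero X → AddClosure S X
  | sum {X Y : A} (b : BinaryBicone X Y) (hb : b.IsBilimit) :
      AddClosure S X → AddClosure S Y → AddClosure S b.pt
  | retract {X Y : A} : Retract X Y → AddClosure S Y → AddClosure S X

/-- `L` is the simple top of `K`: `L` is a simple quotient of `K` and no proper subobject of `K`
maps onto `L` (that is, the kernel of `K ⟶ L` contains every proper subobject of `K`). -/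
def HasSimpleTop {A : Type*} [Category A] [HasZeroMorphisms A] (K L : A) : Prop :=
  Simple L ∧ ∃ p : K ⟶ L, Epi p ∧ ∀ (M : A) (m : M ⟶ K) [Mono m], m ≫ p ≠ 0 → IsIso m

/-- `S` is a simple subquotient of `M`. -/
def IsSimpleSubquotient {A : Type*} [Category A] [HasZeroMorphisms A] (S M : A) : Prop :=
  Simple S ∧ ∃ (N : A) (m : N ⟶ M) (p : N ⟶ S), Mono m ∧ Epi p

variable {B : Type u} [Bicategory.{w, v} B] [PreadditiveBicategory B] [AdditiveBicategory B]

/-- The projective object `P_F`, that is `0 ⟶ F`, of the abelianization of a hom-category. -/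
def projObj {i j : B} (F : i ⟶ j) : RightFreyd (i ⟶ j) := (RightFreyd.functor (i ⟶ j)).obj F

/-- `L` is the object `L_{G_R}` for the right cell `R` of 1-morphisms with source `i`: there is a
subobject `K` of `P_{𝟙 i}` such that every simple subquotient of `P_{𝟙 i} / K` is annihilated by
every `F ∈ R`, and such that `K` has simple top `L = L_G`, the simple top of `P_G`, for some
indecomposable `G`, with `F L ≠ 0` for every `F ∈ R`. -/
def IsCellSimple (i : B) (R : Set (OneMor B)) (L : RightFreyd (i ⟶ i)) : Prop :=
  ∃ (K : RightFreyd (i ⟶ i)) (m : K ⟶ projObj (𝟙 i)), Mono m ∧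
    (∀ S : RightFreyd (i ⟶ i), IsSimpleSubquotient S (cokernel m) →
      ∀ {j : B} (F : i ⟶ j), (⟨i, j, F⟩ : OneMor B) ∈ R → IsZero ((act i F).obj S)) ∧
    HasSimpleTop K L ∧
    (∃ G : i ⟶ i, Indecomposable G ∧ HasSimpleTop (projObj G) L) ∧
    ∀ {j : B} (F : i ⟶ j), (⟨i, j, F⟩ : OneMor B) ∈ R → ¬ IsZero ((act i F).obj L)

/-- The objects of the cell 2-representation at `j`: those `M` with a presentation
`X₁ ⟶ X₀ ⟶ M ⟶ 0` where `X₁` and `X₀` belong to the additive closure of the `F L`, `F ∈ R`. -/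
def cellProp (i : B) (R : Set (OneMor B)) (L : RightFreyd (i ⟶ i)) (j : B) :
    ObjectProperty (RightFreyd (i ⟶ j)) := fun M =>
  ∃ (X₁ X₀ : RightFreyd (i ⟶ j)) (f : X₁ ⟶ X₀),
    AddClosure {X | ∃ F : i ⟶ j, (⟨i, j, F⟩ : OneMor B) ∈ R ∧ X = (act i F).obj L} X₁ ∧
    AddClosure {X | ∃ F : i ⟶ j, (⟨i, j, F⟩ : OneMor B) ∈ R ∧ X = (act i F).obj L} X₀ ∧
    Nonempty (cokernel f ≅ M)

/-- The objects of the cell 2-representation are preserved by the action of all 1-morphisms. -/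
def CellStable (i : B) (R : Set (OneMor B)) (L : RightFreyd (i ⟶ i)) : Prop :=
  ∀ {j l : B} (H : j ⟶ l) (X : RightFreyd (i ⟶ j)),
    cellProp i R L j X → cellProp i R L l ((act i H).obj X)

/-- The cell 2-representation of `R`, constructed from `L`, as a full sub-2-representation of the
principal 2-representation. -/
def cellRep (i : B) (R : Set (OneMor B)) (L : RightFreyd (i ⟶ i)) (h : CellStable i R L) :
    B ⥤ᵖ Cat.{w, max v w} :=
  subRep (principal i) (cellProp i R L) (fun H X hX => h H X hX)

instance (i : B) (R : Set (OneMor B)) (L : RightFreyd (i ⟶ i)) (h : CellStable i R L) (j : B) :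
    Preadditive ((cellRep i R L h).obj j) :=
  inferInstanceAs (Preadditive (cellProp i R L j).FullSubcategory)

variable (k : Type t) [Field k] [LinearBicategory k B]

instance (i : B) (R : Set (OneMor B)) (L : RightFreyd (i ⟶ i)) (h : CellStable i R L) (j : B) :
    Linear k ((cellRep i R L h).obj j) :=
  inferInstanceAs (Linear k (cellProp i R L j).FullSubcategory)

/-- The ideal `cellIdeal k Q` annihilates the cell 2-representation of `R`: 2-morphisms which are
congruent modulo the ideal act in the same way. -/
def CellAnnihilated (Q : Set (OneMor B)) (i : B) (R : Set (OneMor B)) (L : RightFreyd (i ⟶ i))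
    (h : CellStable i R L) : Prop :=
  ∀ {j l : B} {F G : j ⟶ l} (α β : F ⟶ G), α - β ∈ (cellIdeal k Q).carrier F G →
    (cellRep i R L h).map₂ α = (cellRep i R L h).map₂ β

/-- The restriction of the cell 2-representation of `R` to the 2-category associated with `Q`. -/
def restrictedCellRep (Q : Set (OneMor B)) (i : B) (R : Set (OneMor B)) (L : RightFreyd (i ⟶ i))
    (h : CellStable i R L) (ha : CellAnnihilated k Q i R L h) :
    CellTwoCat k Q ⥤ᵖ Cat.{w, max v w} :=
  (OneSubcat.incl _).comp ((cellIdeal k Q).desc (cellRep i R L h) (fun α β hα => ha α β hα))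

instance (Q : Set (OneMor B)) (i : B) (R : Set (OneMor B)) (L : RightFreyd (i ⟶ i))
    (h : CellStable i R L) (ha : CellAnnihilated k Q i R L h) (j : CellTwoCat k Q) :
    Preadditive ((restrictedCellRep k Q i R L h ha).obj j) :=
  inferInstanceAs (Preadditive ((cellRep i R L h).obj j.as.as))

instance (Q : Set (OneMor B)) (i : B) (R : Set (OneMor B)) (L : RightFreyd (i ⟶ i))
    (h : CellStable i R L) (ha : CellAnnihilated k Q i R L h) (j : CellTwoCat k Q) :
    Linear k ((restrictedCellRep k Q i R L h ha).obj j) :=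
  inferInstanceAs (Linear k ((cellRep i R L h).obj j.as.as))

/-- Equivalence of 2-representations: a pseudonatural transformation whose components are
`k`-linear equivalences of categories. -/
def LinEquiv {D : Type*} [Bicategory D] (M N : D ⥤ᵖ Cat)
    [∀ j, Preadditive (M.obj j)] [∀ j, Preadditive (N.obj j)]
    [∀ j, Linear k (M.obj j)] [∀ j, Linear k (N.obj j)] : Prop :=
  ∃ η : Pseudofunctor.StrongTrans M N, ∀ j : D,
    (η.app j).toFunctor.IsEquivalence ∧ (η.app j).toFunctor.Additive ∧
      (η.app j).toFunctor.Linear k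

end CellRepresentations

end FiatCells

end

open FiatCells CategoryTheory.Preadditive

noncomputable section

namespace FiatCells
open Preadditive

/-! ### The abelianization of an additive category with weak kernels is abelian. -/

section FreydAbelian

variable {V : Type*} [Category V] [Preadditive V]

/-! Write C_Q for `CellTwoCat k Q`, P_F for the projective attached to a 1-morphism F, F L for the
action of F on L, and F* for the involution. In `F ≫ G` the 1-morphism F is applied first.

Everything rests on a Duflo 1-morphism in each right cell R. A minimal subobject K of P_𝟙 with F K =
F P_𝟙 for all F in R has a simple top L, and this is an L_R (`exists_isCellSimple`). The projective
cover of L is P_G with G in R. Projectivity makes F a summand of G ≫ F, and adjunction makes G a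
summand of F ≫ F*, for every F in R (`CellTop`, `exists_duflo`). Hence Q is stable under *
(`starMor_mem`), and if F, H lie in one right cell then H is a summand of F ≫ F* ≫ H. The multiplier
F* ≫ H is a composite of elements of Q, so the relations inside right and left cells survive in C_Q
(`genMor_leR`, `genMor_leL`). Strong regularity joins any two elements of Q by one right and one
left step, so the two-sided cell does not split.

Conversely, relations lift from C_Q to C. A nonzero L-value forces F ≤_LR Q, so the ideal acts by
zero on all F L (`mem_annIdeal`), while elements of R do not kill L_R. Identities of elements of Q
therefore stay outside the ideal (`id_notMem_cellIdeal`), and since endomorphism rings of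
indecomposables are local, retracts and isomorphisms lift modulo the ideal.

For the 2-representations, let L and L' be the objects over C and over C_Q. Their Duflo 1-morphisms
correspond (`exists_isoCellTop`): both are summands of the same D ≫ D*, hence lie in one left cell,
and strong regularity identifies them. Whether a 2-morphism A ⟶ F kills L depends only on whether
its mate can be split over G (`actHom_app_eq_zero_iff`), a condition that is insensitive to the
ideal. So a 2-morphism kills L exactly when its image kills L'. The right exact functor P_X ↦ X L on
the abelianization of C_Q thus sends F L' to F L and is fully faithful on these objects. They are
projective relative to the presentations that define the cell 2-representations, so the functor is
an equivalence there (`isEquivalence_of_presented`). Being determined on projectives, it commutes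
coherently with the action (`compareComp`), which gives the pseudonatural transformation. -/

theorem freyd_map_eq_iff {X Y : Arrow V} (f g : X ⟶ Y) :
    (RightFreyd.quotient V).map f = (RightFreyd.quotient V).map g ↔
      ∃ h : X.right ⟶ Y.left, f.right - g.right = h ≫ Y.hom :=
  (RightFreyd.quotient_map_eq_iff f g).trans ⟨fun ⟨h⟩ => ⟨h.hom, h.comm⟩, fun ⟨h, e⟩ => ⟨⟨h, e⟩⟩⟩

theorem freyd_map_eq_zero_iff {X Y : Arrow V} (f : X ⟶ Y) :
    (RightFreyd.quotient V).map f = 0 ↔ ∃ h : X.right ⟶ Y.left, f.right = h ≫ Y.hom := by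
  rw [← (RightFreyd.quotient V).map_zero X Y, freyd_map_eq_iff]
  simp

theorem freyd_exists_rep (X : RightFreyd V) : ∃ A : Arrow V, X = (RightFreyd.quotient V).obj A :=
  ⟨X.as, rfl⟩

theorem arrow_w {V : Type*} [Category V] {X Y : Arrow V} (f : X ⟶ Y) :
    f.left ≫ Y.hom = X.hom ≫ f.right := f.w

variable [HasBinaryBiproducts V]

instance freydHasBinaryBiproducts : HasBinaryBiproducts (RightFreyd V) :=
  HasBinaryBiproducts.mk fun X Y => by
    obtain ⟨X, rfl⟩ := freyd_exists_rep X
    obtain ⟨Y, rfl⟩ := freyd_exists_rep Y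
    let Z : Arrow V := Arrow.mk (biprod.map X.hom Y.hom)
    let p : Z ⟶ X := Arrow.homMk biprod.fst biprod.fst (by simp [Z])
    let q : Z ⟶ Y := Arrow.homMk biprod.snd biprod.snd (by simp [Z])
    let a : X ⟶ Z := Arrow.homMk biprod.inl biprod.inl (by simp [Z])
    let b : Y ⟶ Z := Arrow.homMk biprod.inr biprod.inr (by simp [Z])
    let c : BinaryBicone X Y :=
      { pt := Z, fst := p, snd := q, inl := a, inr := b
        inl_fst := Arrow.hom_ext _ _ biprod.inl_fst biprod.inl_fst
        inl_snd := Arrow.hom_ext _ _ biprod.inl_snd biprod.inl_snd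
        inr_fst := Arrow.hom_ext _ _ biprod.inr_fst biprod.inr_fst
        inr_snd := Arrow.hom_ext _ _ biprod.inr_snd biprod.inr_snd }
    refine hasBinaryBiproduct_of_total ((RightFreyd.quotient V).mapBinaryBicone c) ?_
    have e : p ≫ a + q ≫ b = 𝟙 Z := Arrow.hom_ext _ _ biprod.total biprod.total
    have := congrArg (RightFreyd.quotient V).map e
    rw [Functor.map_add, Functor.map_comp, Functor.map_comp] at this
    exact this.trans ((RightFreyd.quotient V).map_id Z)

variable [HasZeroObject V]

open ZeroObject in
instance freydHasZeroObject : HasZeroObject (RightFreyd V) :=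
  ⟨(RightFreyd.functor V).obj 0, (RightFreyd.functor V).map_isZero (isZero_zero V)⟩

section WeakKernels

variable [HasWeakKernels V]

omit [HasZeroObject V] in
-- A weak kernel of the difference map on `X ⊞ Y` does the job. Lifts need not be unique: the
-- kernels below are built from classes of squares, where homotopy absorbs the choice.
theorem exists_weak_pullback {X Y Z : V} (f : X ⟶ Z) (g : Y ⟶ Z) :
    ∃ (W : V) (a : W ⟶ X) (b : W ⟶ Y), a ≫ f = b ≫ g ∧
      ∀ {T : V} (x : T ⟶ X) (y : T ⟶ Y), x ≫ f = y ≫ g → ∃ l : T ⟶ W, l ≫ a = x ∧ l ≫ b = y := by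
  refine ⟨weakKernel (biprod.desc f (-g)), weakKernel.ι _ ≫ biprod.fst, weakKernel.ι _ ≫ biprod.snd,
    ?_, fun {T} x y h => ⟨weakKernel.lift _ (biprod.lift x y) (by simp [h]), ?_, ?_⟩⟩
  · have := weakKernel.condition (biprod.desc f (-g))
    generalize weakKernel.ι (biprod.desc f (-g)) = m at this ⊢
    rw [Category.assoc, Category.assoc, ← add_neg_eq_zero, ← comp_neg, ← comp_neg, ← comp_add,
      ← biprod.desc_eq, this]
  · rw [weakKernel.lift_ι_assoc]; simp
  · rw [weakKernel.lift_ι_assoc]; simp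

omit [HasZeroObject V] in
-- The weak pullback `K₀` collects what becomes zero in Y; the weak pullback `K₁` collects the
-- relations already valid in X. The choice of `K₁` is what makes the map to X a monomorphism, hence
-- lifts unique.
theorem freyd_exists_kernel {X Y : RightFreyd V} (f : X ⟶ Y) :
    ∃ (K : RightFreyd V) (k : K ⟶ X) (w : k ≫ f = 0), Nonempty (IsLimit (KernelFork.ofι k w)) := by
  obtain ⟨X, rfl⟩ := freyd_exists_rep X
  obtain ⟨Y, rfl⟩ := freyd_exists_rep Y
  obtain ⟨f, rfl⟩ := (RightFreyd.quotient V).map_surjective (X := X) (Y := Y) f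
  obtain ⟨K₀, a, b, hab, hK₀⟩ := exists_weak_pullback f.right Y.hom
  obtain ⟨K₁, c, d, hcd, hK₁⟩ := exists_weak_pullback a X.hom
  have w : (RightFreyd.quotient V).map (X := Arrow.mk c) (Y := X) (Arrow.homMk d a hcd.symm) ≫
      (RightFreyd.quotient V).map f = 0 := by
    rw [← Functor.map_comp, freyd_map_eq_zero_iff]
    exact ⟨b, hab⟩
  have hm : Mono ((RightFreyd.quotient V).map (X := Arrow.mk c) (Y := X)
      (Arrow.homMk d a hcd.symm)) := by
    rw [Preadditive.mono_iff_cancel_zero]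
    intro T g hg
    obtain ⟨T, rfl⟩ := freyd_exists_rep T
    obtain ⟨g, rfl⟩ := (RightFreyd.quotient V).map_surjective (X := T) (Y := Arrow.mk c) g
    rw [← Functor.map_comp, freyd_map_eq_zero_iff] at hg
    obtain ⟨h, hh⟩ := hg
    obtain ⟨l, hl, -⟩ := hK₁ g.right h hh
    exact (freyd_map_eq_zero_iff _).mpr ⟨l, hl.symm⟩
  refine ⟨_, _, w, ⟨KernelFork.IsLimit.ofι' _ _ fun {T} t ht => Nonempty.some ?_⟩⟩
  obtain ⟨T, rfl⟩ := freyd_exists_rep T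
  obtain ⟨t, rfl⟩ := (RightFreyd.quotient V).map_surjective (X := T) (Y := X) t
  rw [← Functor.map_comp, freyd_map_eq_zero_iff] at ht
  obtain ⟨s, hs⟩ := ht
  obtain ⟨l, hl, -⟩ := hK₀ t.right s hs
  obtain ⟨m, hm, hm'⟩ := hK₁ (T.hom ≫ l) t.left (by
    rw [Category.assoc, hl]; exact (arrow_w t).symm)
  refine ⟨⟨(RightFreyd.quotient V).map (X := T) (Y := Arrow.mk c) (Arrow.homMk m l hm), ?_⟩⟩
  rw [← Functor.map_comp]
  exact quotient_map_congr hm' hl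

omit [HasZeroObject V] [HasWeakKernels V] in
-- Vanishing of t in the explicit cokernel means that `t.right` is `a ≫ Y.hom + b ≫ f.right`; then b
-- is the lift to X, and a is the homotopy that corrects it.
theorem freyd_normal_mono {X Y : RightFreyd V} (f : X ⟶ Y) [Mono f] :
    Nonempty (IsLimit (KernelFork.ofι f (cokernel.condition f))) := by
  obtain ⟨X, rfl⟩ := freyd_exists_rep X
  obtain ⟨Y, rfl⟩ := freyd_exists_rep Y
  obtain ⟨f, rfl⟩ := (RightFreyd.quotient V).map_surjective (X := X) (Y := Y) f
  refine ⟨KernelFork.IsLimit.ofι' _ _ fun {T} t ht => Nonempty.some ?_⟩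
  obtain ⟨T, rfl⟩ := freyd_exists_rep T
  obtain ⟨t, rfl⟩ := (RightFreyd.quotient V).map_surjective (X := T) (Y := Y) t
  have ht' : (RightFreyd.quotient V).map t ≫
      (RightFreyd.quotient V).map (RightFreyd.Candidate.π f) = 0 := by
    have := cokernel.π_desc ((RightFreyd.quotient V).map f)
      ((RightFreyd.quotient V).map (RightFreyd.Candidate.π f))
      (RightFreyd.Candidate.cokernelCofork f).condition
    exact (congrArg (fun m => (RightFreyd.quotient V).map t ≫ m) this.symm).trans
      ((Category.assoc _ _ _).symm.trans ((congrArg (fun m => m ≫ _) ht).trans zero_comp))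
  rw [← Functor.map_comp, freyd_map_eq_zero_iff] at ht'
  obtain ⟨h, hh⟩ := ht'
  have hh : t.right = (h ≫ biprod.fst) ≫ Y.hom + (h ≫ biprod.snd) ≫ f.right := by
    have e : t.right ≫ 𝟙 _ = h ≫ biprod.desc Y.hom f.right := hh
    rw [Category.comp_id, biprod.desc_eq] at e
    simpa using e
  generalize h ≫ biprod.fst = a at hh
  generalize h ≫ biprod.snd = b at hh
  -- The source is the projective on `T.left`, written as a zero arrow. Cancelling the monomorphism
  -- f gives a factorization of `T.hom ≫ b` through `X.hom`, which is the missing left component of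
  -- the lift.
  have key : (RightFreyd.quotient V).map (X := (Arrow.mk (0 : T.left ⟶ T.left)))
      (Y := X) (Arrow.homMk 0 (T.hom ≫ b) (by simp)) = 0 := by
    refine zero_of_comp_mono ((RightFreyd.quotient V).map f) ?_
    rw [← Functor.map_comp, freyd_map_eq_zero_iff]
    refine ⟨t.left - T.hom ≫ a, ?_⟩
    change (T.hom ≫ b) ≫ f.right = _
    rw [sub_comp, arrow_w, hh]
    simp
  obtain ⟨s, hs⟩ := (freyd_map_eq_zero_iff _).mp key
  refine ⟨⟨(RightFreyd.quotient V).map (X := T) (Y := X) (Arrow.homMk s b hs.symm), ?_⟩⟩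
  rw [← Functor.map_comp, freyd_map_eq_iff]
  refine ⟨-a, ?_⟩
  change b ≫ f.right - t.right = _
  rw [hh]; simp

omit [HasZeroObject V] in
-- An epimorphism f has zero cokernel, so `𝟙 Y.right` equals `a ≫ Y.hom + b ≫ f.right`: up to
-- relations of Y, b is a section of `f.right`. A morphism t that kills the kernel of f descends
-- along f as `b ≫ t.right`.
theorem freyd_normal_epi {X Y : RightFreyd V} (f : X ⟶ Y) [Epi f] :
    ∃ (K : RightFreyd V) (k : K ⟶ X) (w : k ≫ f = 0),
      Nonempty (IsColimit (CokernelCofork.ofπ f w)) := by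
  obtain ⟨K, k, w, ⟨hk⟩⟩ := freyd_exists_kernel f
  refine ⟨K, k, w, ⟨CokernelCofork.IsColimit.ofπ' _ _ fun {T} t ht => Nonempty.some ?_⟩⟩
  obtain ⟨X, rfl⟩ := freyd_exists_rep X
  obtain ⟨Y, rfl⟩ := freyd_exists_rep Y
  obtain ⟨T, rfl⟩ := freyd_exists_rep T
  obtain ⟨f, rfl⟩ := (RightFreyd.quotient V).map_surjective (X := X) (Y := Y) f
  obtain ⟨t, rfl⟩ := (RightFreyd.quotient V).map_surjective (X := X) (Y := T) t
  -- A generalized element of `X.right` that dies in Y factors through the kernel of f, so t kills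
  -- it. It is used twice: for the compatibility of b with the relations of Y, and for the
  -- independence of the section b.
  have lift : ∀ {Z : V} (x : Z ⟶ X.right) (s : Z ⟶ Y.left), x ≫ f.right = s ≫ Y.hom →
      ∃ z : Z ⟶ T.left, x ≫ t.right = z ≫ T.hom := by
    intro Z x s hs
    have h0 : (RightFreyd.quotient V).map (X := Arrow.mk (0 : Z ⟶ Z)) (Y := X)
        (Arrow.homMk 0 x (by simp)) ≫ (RightFreyd.quotient V).map f = 0 := by
      rw [← Functor.map_comp, freyd_map_eq_zero_iff]
      exact ⟨s, hs⟩
    obtain ⟨l, hl⟩ := KernelFork.IsLimit.lift' hk _ h0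
    have h1 : (RightFreyd.quotient V).map (X := Arrow.mk (0 : Z ⟶ Z)) (Y := X)
        (Arrow.homMk 0 x (by simp)) ≫ (RightFreyd.quotient V).map t = 0 := by
      rw [← hl]
      change (l ≫ k) ≫ _ = 0
      rw [Category.assoc, ht, comp_zero]
    rw [← Functor.map_comp, freyd_map_eq_zero_iff] at h1
    exact h1
  have hπ : (RightFreyd.quotient V).map (RightFreyd.Candidate.π f) = 0 := by
    rw [← cancel_epi ((RightFreyd.quotient V).map f), comp_zero]
    exact (RightFreyd.Candidate.cokernelCofork f).condition
  obtain ⟨h, hh⟩ := (freyd_map_eq_zero_iff _).mp hπ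
  have hh : 𝟙 Y.right = (h ≫ biprod.fst) ≫ Y.hom + (h ≫ biprod.snd) ≫ f.right := by
    have e : 𝟙 _ = h ≫ biprod.desc Y.hom f.right := hh
    rw [biprod.desc_eq] at e
    simpa using e
  generalize h ≫ biprod.fst = a at hh
  generalize h ≫ biprod.snd = b at hh
  obtain ⟨z, hz⟩ := lift (Y.hom ≫ b) (𝟙 _ - Y.hom ≫ a) (by
    have := congrArg (fun m => Y.hom ≫ m) hh
    simp only [Category.comp_id, comp_add] at this
    rw [sub_comp, Category.id_comp, Category.assoc, Category.assoc, eq_sub_iff_add_eq']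
    exact this.symm)
  obtain ⟨y, hy⟩ := lift (f.right ≫ b - 𝟙 _) (-(f.right ≫ a)) (by
    have := congrArg (fun m => f.right ≫ m) hh
    simp only [Category.comp_id, comp_add] at this
    rw [sub_comp, neg_comp, Category.id_comp, Category.assoc, Category.assoc, sub_eq_iff_eq_add,
      neg_add_eq_sub, eq_sub_iff_add_eq']
    exact this.symm)
  refine ⟨⟨(RightFreyd.quotient V).map (X := Y) (Y := T)
    (Arrow.homMk z (b ≫ t.right) (by rw [← hz, Category.assoc])), ?_⟩⟩
  rw [← Functor.map_comp, freyd_map_eq_iff]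
  refine ⟨y, ?_⟩
  change f.right ≫ b ≫ t.right - t.right = _
  rw [← hy, sub_comp, Category.id_comp, Category.assoc]

/-- The right Freyd category of an additive category with weak kernels is abelian. -/
instance freydAbelian : Abelian (RightFreyd V) where
  toPreadditive := inferInstance
  normalMonoOfMono f _ := ⟨{
    Z := _
    g := cokernel.π f
    w := cokernel.condition f
    isLimit := (freyd_normal_mono f).some }⟩
  normalEpiOfEpi f _ := by
    obtain ⟨K, k, w, ⟨h⟩⟩ := freyd_normal_epi f
    exact ⟨{ W := K, g := k, w := w, isColimit := h }⟩
  has_kernels := ⟨fun f => by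
    obtain ⟨K, k, w, ⟨h⟩⟩ := freyd_exists_kernel f
    exact ⟨⟨⟨_, h⟩⟩⟩⟩
  has_finite_products := by
    have : HasFiniteProducts (RightFreyd V) := hasFiniteProducts_of_has_binary_and_terminal
    infer_instance
  has_cokernels := inferInstance

end WeakKernels

end FreydAbelian

end FiatCells

namespace FiatCells
open Preadditive

/-! ### Krull–Schmidt categories: local endomorphism rings, decompositions, weak kernels. -/

section Fitting

/-- Fitting's lemma through the minimal polynomial `X ^ n * q` with q prime to X. A Bézout relation
gives an idempotent polynomial in a; if it is 0 then a is nilpotent, if it is 1 then a is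
invertible. -/
theorem isUnit_or_isUnit_one_sub {k A : Type*} [Field k] [Ring A] [Algebra k A] [Module.Finite k A]
    (h : ∀ e : A, e * e = e → e = 0 ∨ e = 1) (a : A) : IsUnit a ∨ IsUnit (1 - a) := by
  have ha : IsIntegral k a := Algebra.IsIntegral.isIntegral a
  obtain ⟨q, hq, hdvd⟩ := Polynomial.exists_eq_pow_rootMultiplicity_mul_and_not_dvd
    (minpoly k a) (minpoly.ne_zero ha) 0
  rw [Polynomial.C_0, sub_zero] at hq hdvd
  generalize Polynomial.rootMultiplicity 0 (minpoly k a) = n at hq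
  -- The exponent is `n + 1` and not `n`, so that a factor a can be split off to form the inverse
  -- even when `n = 0`. The product with q is still a multiple of the minimal polynomial.
  have hcop : IsCoprime ((Polynomial.X : Polynomial k) ^ (n + 1)) q :=
    IsCoprime.pow_left ((Polynomial.irreducible_X.coprime_iff_not_dvd).mpr hdvd)
  obtain ⟨u, v, huv⟩ := hcop
  have hpa : Polynomial.aeval a (Polynomial.X ^ (n + 1) * q) = 0 := by
    rw [pow_succ', mul_assoc, ← hq, map_mul, minpoly.aeval, mul_zero]
  have hsum : Polynomial.aeval a (u * Polynomial.X ^ (n + 1)) + Polynomial.aeval a (v * q) = 1 := by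
    rw [← map_add, huv, map_one]
  have hprod : Polynomial.aeval a (u * Polynomial.X ^ (n + 1)) * Polynomial.aeval a (v * q) = 0 := by
    rw [← map_mul, mul_mul_mul_comm, map_mul, hpa, mul_zero]
  have hidem : Polynomial.aeval a (u * Polynomial.X ^ (n + 1)) *
      Polynomial.aeval a (u * Polynomial.X ^ (n + 1)) =
      Polynomial.aeval a (u * Polynomial.X ^ (n + 1)) := by
    have := congrArg (fun x => Polynomial.aeval a (u * Polynomial.X ^ (n + 1)) * x) hsum
    simp only [mul_add, mul_one, hprod, add_zero] at this
    exact this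
  rcases h _ hidem with h0 | h1
  · right
    rw [h0, zero_add] at hsum
    have hnil : a ^ (n + 1) = 0 := by
      have e : Polynomial.aeval a (Polynomial.X ^ (n + 1) * (v * q)) = 0 := by
        rw [mul_left_comm, map_mul, hpa, mul_zero]
      rw [map_mul, hsum, mul_one, map_pow, Polynomial.aeval_X] at e
      exact e
    exact IsNilpotent.isUnit_one_sub ⟨_, hnil⟩
  · left
    have e : a * Polynomial.aeval a (u * Polynomial.X ^ n) = 1 := by
      have := map_mul (Polynomial.aeval (R := k) a) Polynomial.X (u * Polynomial.X ^ n)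
      rw [Polynomial.aeval_X] at this
      rw [← this, ← h1]
      congr 1
      ring
    have e' : Polynomial.aeval a (u * Polynomial.X ^ n) * a = 1 := by
      have := map_mul (Polynomial.aeval (R := k) a) (u * Polynomial.X ^ n) Polynomial.X
      rw [Polynomial.aeval_X] at this
      rw [← this, ← h1]
      congr 1
      ring
    exact ⟨⟨a, _, e, e'⟩, rfl⟩

variable {V : Type*} [Category V] [Preadditive V]

theorem idempotent_trivial_of_indecomposable [HasBinaryBiproducts V] [IsIdempotentComplete V]
    {X : V} (hX : Indecomposable X) (e : X ⟶ X) (he : e ≫ e = e) : e = 0 ∨ e = 𝟙 X := by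
  obtain ⟨Y, i, p, hip, hpi⟩ := IsIdempotentComplete.idempotents_split X e he
  obtain ⟨Z, j, q, hjq, hqj⟩ := IsIdempotentComplete.idempotents_split X (𝟙 X - e) (by
    simp [sub_comp, comp_sub, he])
  have hi : i = i ≫ e := by rw [← hpi, ← Category.assoc, hip, Category.id_comp]
  have hp : p = e ≫ p := by rw [← hpi, Category.assoc, hip, Category.comp_id]
  have hj : j = j ≫ (𝟙 X - e) := by rw [← hqj, ← Category.assoc, hjq, Category.id_comp]
  have hq : q = (𝟙 X - e) ≫ q := by rw [← hqj, Category.assoc, hjq, Category.comp_id]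
  have hiq : i ≫ q = 0 := by
    rw [hi, hq, Category.assoc, ← Category.assoc e, comp_sub, he]
    simp
  have hjp : j ≫ p = 0 := by
    rw [hj, hp, Category.assoc, ← Category.assoc (𝟙 X - e), sub_comp, he]
    simp
  let φ : X ≅ Y ⊞ Z :=
    { hom := biprod.lift p q
      inv := biprod.desc i j
      hom_inv_id := by rw [biprod.lift_desc, hpi, hqj]; simp
      inv_hom_id := by
        ext <;> simp [hip, hiq, hjp, hjq] }
  rcases hX.2 Y Z φ with h | h
  · left; rw [← hpi, h.eq_of_src i 0, comp_zero]
  · right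
    have : 𝟙 X - e = 0 := by rw [← hqj, h.eq_of_src j 0, comp_zero]
    exact (sub_eq_zero.mp this).symm

end Fitting

/-- A `k`-linear category with finite-dimensional spaces of morphisms, in which the endomorphism
rings of indecomposable objects are local, and with finitely many indecomposable objects up to
isomorphism. -/
structure IsKrullSchmidt (k : Type*) [Field k] (V : Type*) [Category V] [Preadditive V]
    [HasZeroObject V] [HasBinaryBiproducts V] [Linear k V] : Prop where
  finite (X Y : V) : Module.Finite k (X ⟶ Y)
  local_end {X : V} (hX : Indecomposable X) (f : X ⟶ X) : IsIso f ∨ IsIso (𝟙 X - f)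
  finite_indec : ∃ s : Set V, s.Finite ∧ ∀ X : V, Indecomposable X → ∃ Y ∈ s, Nonempty (X ≅ Y)

section KrullSchmidt

variable {k : Type*} [Field k] {V : Type*} [Category V] [Preadditive V] [HasZeroObject V]
  [HasBinaryBiproducts V] [Linear k V]

theorem IsKrullSchmidt.of_idempotentComplete [IsIdempotentComplete V]
    (h₁ : ∀ X Y : V, Module.Finite k (X ⟶ Y))
    (h₂ : ∃ s : Set V, s.Finite ∧ ∀ X : V, Indecomposable X → ∃ Y ∈ s, Nonempty (X ≅ Y)) :
    IsKrullSchmidt k V where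
  finite := h₁
  local_end {X} hX f := by
    have : Module.Finite k (End X) := h₁ X X
    have := isUnit_or_isUnit_one_sub (k := k) (A := End X)
      (fun e he => idempotent_trivial_of_indecomposable hX e he) f
    rw [isUnit_iff_isIso, isUnit_iff_isIso] at this
    exact this
  finite_indec := h₂

omit [Preadditive V] [HasZeroObject V] [HasBinaryBiproducts V] in
theorem retract_of_isIso {X Y : V} (a : X ⟶ Y) (b : Y ⟶ X) (h : IsIso (a ≫ b)) :
    Nonempty (Retract X Y) :=
  ⟨⟨a, b ≫ inv (a ≫ b), by rw [← Category.assoc, IsIso.hom_inv_id]⟩⟩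

/-- Induction on the dimension of the endomorphism algebra: the endomorphisms of Y and Z embed
blockwise in those of `Y ⊞ Z`, and a nonzero object contributes at least one dimension, so both
summands are strictly smaller. -/
theorem IsKrullSchmidt.induction (hV : IsKrullSchmidt k V) {p : V → Prop}
    (iso : ∀ {X Y : V}, (X ≅ Y) → p X → p Y) (zero : ∀ X : V, IsZero X → p X)
    (indec : ∀ X : V, Indecomposable X → p X) (sum : ∀ X Y : V, p X → p Y → p (X ⊞ Y)) (X : V) :
    p X := by
  have fin := hV.finite
  have key : ∀ Y Z : V, Module.finrank k (Y ⟶ Y) + Module.finrank k (Z ⟶ Z) ≤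
      Module.finrank k (Y ⊞ Z ⟶ Y ⊞ Z) := by
    intro Y Z
    rw [← Module.finrank_prod]
    let φ : ((Y ⟶ Y) × (Z ⟶ Z)) →ₗ[k] (Y ⊞ Z ⟶ Y ⊞ Z) :=
      { toFun := fun x => biprod.map x.1 x.2
        map_add' := fun x y => by ext <;> simp
        map_smul' := fun c x => by ext <;> simp }
    refine LinearMap.finrank_le_finrank_of_injective (f := φ) fun x y h => ?_
    have h : biprod.map x.1 x.2 = biprod.map y.1 y.2 := h
    have h1 := congrArg (fun m => biprod.inl ≫ m ≫ biprod.fst) h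
    have h2 := congrArg (fun m => biprod.inr ≫ m ≫ biprod.snd) h
    exact Prod.ext (by simpa using h1) (by simpa using h2)
  have pos : ∀ Y : V, ¬ IsZero Y → 0 < Module.finrank k (Y ⟶ Y) := by
    intro Y hY
    have : Nontrivial (Y ⟶ Y) := ⟨⟨𝟙 Y, 0, fun h => hY ((IsZero.iff_id_eq_zero Y).mpr h)⟩⟩
    exact Module.finrank_pos
  generalize hn : Module.finrank k (X ⟶ X) = n
  induction n using Nat.strong_induction_on generalizing X with
  | _ n ih =>
    by_cases hz : IsZero X
    · exact zero X hz
    by_cases hi : Indecomposable X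
    · exact indec X hi
    obtain ⟨Y, Z, ⟨e⟩, hY, hZ⟩ : ∃ Y Z : V, Nonempty (X ≅ Y ⊞ Z) ∧ ¬ IsZero Y ∧ ¬ IsZero Z := by
      by_contra hcon
      push Not at hcon
      exact hi ⟨hz, fun Y Z e => or_iff_not_imp_left.mpr fun h => hcon Y Z ⟨e⟩ h⟩
    have hX : Module.finrank k (Y ⊞ Z ⟶ Y ⊞ Z) = n := by
      rw [← hn]
      exact (LinearEquiv.finrank_eq (Linear.homCongr k e e)).symm
    have h1 := key Y Z
    have h2 := pos Y hY
    have h3 := pos Z hZ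
    exact iso e.symm (sum Y Z (ih _ (by omega) Y rfl) (ih _ (by omega) Z rfl))

theorem exists_factor_of_finite {X Y : V} (f : X ⟶ Y) (M : Set (Σ G : V, G ⟶ X)) (hM : M.Finite)
    (hf : ∀ m ∈ M, m.2 ≫ f = 0) :
    ∃ (K : V) (κ : K ⟶ X), κ ≫ f = 0 ∧ ∀ m ∈ M, ∃ l : m.1 ⟶ K, l ≫ κ = m.2 := by
  induction M, hM using Set.Finite.induction_on with
  | empty =>
    obtain ⟨Z, hZ⟩ := HasZeroObject.zero (C := V)
    exact ⟨Z, 0, zero_comp, by simp⟩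
  | @insert m M _ _ ih =>
    obtain ⟨K, κ, hκ, hl⟩ := ih fun n hn => hf n (Set.mem_insert_of_mem _ hn)
    refine ⟨K ⊞ m.1, biprod.desc κ m.2, ?_, ?_⟩
    · ext
      · simp [hκ]
      · simp [hf m (Set.mem_insert _ _)]
    · rintro n (rfl | hn)
      · exact ⟨biprod.inr, by simp⟩
      · obtain ⟨l, h⟩ := hl n hn
        exact ⟨l ≫ biprod.inl, by simp [h]⟩

/-- For each of the finitely many indecomposables G, the morphisms `G ⟶ X` killed by f form a
finite-dimensional space. One copy of G for each element of a finite spanning set, summed over all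
G, maps onto everything that f kills; arbitrary test objects are reduced to indecomposable ones. -/
theorem IsKrullSchmidt.hasWeakKernels (hV : IsKrullSchmidt k V) : HasWeakKernels V where
  hasWeakLimit {X Y} f := by
    obtain ⟨s, hs, hsi⟩ := hV.finite_indec
    have fin := hV.finite
    have hspan : ∀ G : V, ∃ t : Set (G ⟶ X), t.Finite ∧
        Submodule.span k t = LinearMap.ker (Linear.rightComp k G f) := fun G =>
      Submodule.fg_def.mp (IsNoetherian.noetherian _)
    choose t ht hspan using hspan
    obtain ⟨K, κ, hκ, hl⟩ := exists_factor_of_finite f (⋃ G ∈ s, Sigma.mk G '' t G)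
      (hs.biUnion fun G _ => (ht G).image _) (by
        intro m hm
        simp only [Set.mem_iUnion, Set.mem_image] at hm
        obtain ⟨G, hG, g, hg, rfl⟩ := hm
        have : g ∈ LinearMap.ker (Linear.rightComp k G f) := hspan G ▸ Submodule.subset_span hg
        exact this)
    have hfac : ∀ T : V, ∀ x : T ⟶ X, x ≫ f = 0 → ∃ l : T ⟶ K, l ≫ κ = x := by
      intro T
      induction T using hV.induction with
      | iso e h =>
        intro x hx
        obtain ⟨l, hl⟩ := h (e.hom ≫ x) (by rw [Category.assoc, hx, comp_zero])
        exact ⟨e.inv ≫ l, by rw [Category.assoc, hl, Iso.inv_hom_id_assoc]⟩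
      | zero Z hZ => exact fun x _ => ⟨0, hZ.eq_of_src _ _⟩
      | indec Z hZ =>
        intro x hx
        obtain ⟨G, hG, ⟨e⟩⟩ := hsi Z hZ
        have hle : Submodule.span k (t G) ≤ LinearMap.range (Linear.rightComp k G κ) := by
          rw [Submodule.span_le]
          intro g hg
          obtain ⟨l, hl⟩ := hl ⟨G, g⟩ (Set.mem_biUnion hG ⟨g, hg, rfl⟩)
          exact ⟨l, hl⟩
        rw [hspan G] at hle
        obtain ⟨l, hl⟩ := hle (x := e.inv ≫ x) (by
          change (e.inv ≫ x) ≫ f = 0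
          rw [Category.assoc, hx, comp_zero])
        have hl : l ≫ κ = e.inv ≫ x := hl
        exact ⟨e.hom ≫ l, by rw [Category.assoc, hl, Iso.hom_inv_id_assoc]⟩
      | sum A B hA hB =>
        intro x hx
        obtain ⟨a, ha⟩ := hA (biprod.inl ≫ x) (by rw [Category.assoc, hx, comp_zero])
        obtain ⟨b, hb⟩ := hB (biprod.inr ≫ x) (by rw [Category.assoc, hx, comp_zero])
        exact ⟨biprod.desc a b, by ext <;> simp [ha, hb]⟩
    exact HasWeakLimit.mk
      { cone := KernelFork.ofι κ hκ
        isWeakLimit := Fork.IsWeakLimit.mk' _ fun c =>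
          ⟨(hfac _ c.ι (by rw [c.condition, comp_zero])).choose,
            (hfac _ c.ι (by rw [c.condition, comp_zero])).choose_spec⟩ }

end KrullSchmidt

end FiatCells

namespace FiatCells
open Preadditive

/-! ### Projectives, projective covers and a length function in the abelianization. -/

section FreydProjectives

variable {V : Type*} [Category V] [Preadditive V] [HasZeroObject V] [HasBinaryBiproducts V]

instance freyd_projective (X : V) : Projective ((RightFreyd.functor V).obj X) where
  factors {Z W} f e he := by
    obtain ⟨Z, rfl⟩ := freyd_exists_rep Z
    obtain ⟨W, rfl⟩ := freyd_exists_rep W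
    obtain ⟨e, rfl⟩ := (RightFreyd.quotient V).map_surjective e
    obtain ⟨f, rfl⟩ := (RightFreyd.quotient V).map_surjective
      (X := (RightFreyd.rightFunctor V).obj X) (Y := W) f
    have hπ : (RightFreyd.quotient V).map (RightFreyd.Candidate.π e) = 0 := by
      rw [← cancel_epi ((RightFreyd.quotient V).map e), comp_zero]
      exact (RightFreyd.Candidate.cokernelCofork e).condition
    obtain ⟨h, hh⟩ := (freyd_map_eq_zero_iff _).mp hπ
    have hh : 𝟙 W.right = (h ≫ biprod.fst) ≫ W.hom + (h ≫ biprod.snd) ≫ e.right := by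
      have e : 𝟙 _ = h ≫ biprod.desc W.hom e.right := hh
      rw [biprod.desc_eq] at e
      simpa using e
    generalize h ≫ biprod.fst = a at hh
    generalize h ≫ biprod.snd = b at hh
    refine ⟨(RightFreyd.quotient V).map (X := (RightFreyd.rightFunctor V).obj X) (Y := Z)
      (Arrow.homMk 0 (f.right ≫ b) ((isZero_zero V).eq_of_src _ _)), ?_⟩
    rw [← Functor.map_comp, freyd_map_eq_iff]
    refine ⟨- (f.right ≫ a), ?_⟩
    change (f.right ≫ b) ≫ e.right - f.right = _
    have := congrArg (fun m => f.right ≫ m) hh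
    simp only [Category.comp_id, comp_add] at this
    rw [neg_comp, sub_eq_iff_eq_add, neg_add_eq_sub, eq_sub_iff_add_eq', Category.assoc,
      Category.assoc]
    exact this.symm

omit [HasBinaryBiproducts V] in
theorem freyd_exists_cover (Z : RightFreyd V) :
    ∃ (X : V) (p : (RightFreyd.functor V).obj X ⟶ Z), Epi p := by
  obtain ⟨Z, rfl⟩ := freyd_exists_rep Z
  refine ⟨Z.right, (RightFreyd.quotient V).map (X := (RightFreyd.rightFunctor V).obj Z.right)
    (Y := Z) (Arrow.homMk 0 (𝟙 Z.right) ((isZero_zero V).eq_of_src _ _)), ?_⟩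
  have : IsIso (Arrow.homMk 0 (𝟙 Z.right) ((isZero_zero V).eq_of_src _ _) :
    (RightFreyd.rightFunctor V).obj Z.right ⟶ Z).right := inferInstanceAs (IsIso (𝟙 Z.right))
  exact RightFreyd.epi_of_isIso_right _

variable (k : Type*) [Field k] [Linear k V]

instance freyd_quotient_linear : (RightFreyd.quotient V).Linear k where

instance freyd_functor_linear : (RightFreyd.functor V).Linear k where
  map_smul f c := by
    change (RightFreyd.quotient V).map ((RightFreyd.rightFunctor V).map (c • f)) =
      c • (RightFreyd.quotient V).map ((RightFreyd.rightFunctor V).map f)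
    rw [← CategoryTheory.Functor.map_smul]
    exact quotient_map_congr ((isZero_zero V).eq_of_src _ _) rfl

theorem freyd_hom_finite (h : ∀ X Y : V, Module.Finite k (X ⟶ Y)) (X : V) (Z : RightFreyd V) :
    Module.Finite k ((RightFreyd.functor V).obj X ⟶ Z) := by
  obtain ⟨Y, p, hp⟩ := freyd_exists_cover Z
  have := h X Y
  let φ : (X ⟶ Y) →ₗ[k] ((RightFreyd.functor V).obj X ⟶ Z) :=
    { toFun := fun f => (RightFreyd.functor V).map f ≫ p
      map_add' := fun f g => by rw [Functor.map_add, add_comp]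
      map_smul' := fun c f => by rw [Functor.map_smul, Linear.smul_comp]; rfl }
  refine Module.Finite.of_surjective φ fun g => ?_
  obtain ⟨f, hf⟩ := (RightFreyd.functor V).map_surjective (Projective.factorThru g p)
  exact ⟨f, by
    change (RightFreyd.functor V).map f ≫ p = g
    rw [hf, Projective.factorThru_comp]⟩

end FreydProjectives

section FreydKrullSchmidt

variable {k : Type*} [Field k] {V : Type*} [Category V] [Preadditive V] [HasZeroObject V]
  [HasBinaryBiproducts V] [Linear k V] (hV : IsKrullSchmidt k V)

include hV

/-- The endomorphism ring of G is local and `𝟙 G - s` kills p, so it cannot be invertible. This is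
how P_G is used as a projective cover of each of its nonzero quotients. -/
theorem isIso_of_comp_eq {G : V} (hG : Indecomposable G) {Z : RightFreyd V}
    {p : (RightFreyd.functor V).obj G ⟶ Z} (hp : p ≠ 0) (s : G ⟶ G)
    (h : (RightFreyd.functor V).map s ≫ p = p) : IsIso s := by
  rcases hV.local_end hG s with hs | hs
  · exact hs
  · refine absurd ?_ hp
    rw [← cancel_epi ((RightFreyd.functor V).map (𝟙 G - s)), comp_zero, Functor.map_sub, sub_comp,
      h, CategoryTheory.Functor.map_id, Category.id_comp, sub_self]

/-- A quotient of P_G inherits indecomposability: the projector onto A lifts to an endomorphism s of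
G, and whichever of s, `𝟙 G - s` is invertible forces the other summand to vanish. -/
theorem isZero_or_isZero_of_epi_biprod [HasWeakKernels V] {G : V} (hG : Indecomposable G)
    {A B : RightFreyd V} (e : (RightFreyd.functor V).obj G ⟶ A ⊞ B) [Epi e] :
    IsZero A ∨ IsZero B := by
  obtain ⟨s, hs⟩ := (RightFreyd.functor V).map_surjective
    (Projective.factorThru (e ≫ biprod.fst ≫ biprod.inl) e)
  have hs : (RightFreyd.functor V).map s ≫ e = e ≫ biprod.fst ≫ biprod.inl := by
    rw [hs, Projective.factorThru_comp]
  rcases hV.local_end hG s with h | h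
  · right
    have h1 : (RightFreyd.functor V).map s ≫ e ≫ biprod.snd = 0 := by
      rw [← Category.assoc, hs]; simp
    have h2 : e ≫ biprod.snd = 0 := by
      rwa [← cancel_epi ((RightFreyd.functor V).map s), comp_zero]
    rw [IsZero.iff_id_eq_zero, ← cancel_epi (e ≫ biprod.snd), h2, zero_comp, zero_comp]
  · left
    have h1 : (RightFreyd.functor V).map (𝟙 G - s) ≫ e ≫ biprod.fst = 0 := by
      rw [Functor.map_sub, CategoryTheory.Functor.map_id, sub_comp, Category.id_comp,
        ← Category.assoc _ e, hs]; simp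
    have h2 : e ≫ biprod.fst = 0 := by
      rwa [← cancel_epi ((RightFreyd.functor V).map (𝟙 G - s)), comp_zero]
    rw [IsZero.iff_id_eq_zero, ← cancel_epi (e ≫ biprod.fst), h2, zero_comp, zero_comp]

theorem exists_indec_of_ne_zero {Z : RightFreyd V} {X : V}
    (f : (RightFreyd.functor V).obj X ⟶ Z) (hf : f ≠ 0) :
    ∃ G : V, Indecomposable G ∧ ∃ g : (RightFreyd.functor V).obj G ⟶ Z, g ≠ 0 := by
  by_contra hcon
  push Not at hcon
  refine hf ?_
  clear hf
  induction X using hV.induction with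
  | iso e h =>
    rw [← cancel_epi ((RightFreyd.functor V).map e.hom), comp_zero]
    exact h _
  | zero X hX => exact ((RightFreyd.functor V).map_isZero hX).eq_of_src _ _
  | indec X hX => exact hcon X hX f
  | sum A B hA hB =>
    have h1 := hA ((RightFreyd.functor V).map biprod.inl ≫ f)
    have h2 := hB ((RightFreyd.functor V).map biprod.inr ≫ f)
    rw [← Category.id_comp f, ← CategoryTheory.Functor.map_id, ← biprod.total, Functor.map_add, add_comp,
      Functor.map_comp, Functor.map_comp, Category.assoc, Category.assoc, h1, h2, comp_zero,
      comp_zero, add_zero]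

omit hV in
omit [HasBinaryBiproducts V] in
theorem exists_ne_zero_of_not_isZero {Z : RightFreyd V} (hZ : ¬ IsZero Z) :
    ∃ (X : V) (p : (RightFreyd.functor V).obj X ⟶ Z), p ≠ 0 := by
  obtain ⟨X, p, hp⟩ := freyd_exists_cover Z
  refine ⟨X, p, fun h => hZ ?_⟩
  rw [IsZero.iff_id_eq_zero, ← cancel_epi p, h, zero_comp, zero_comp]

theorem hasSimpleTop_of_ne_zero [HasWeakKernels V] {G : V} (hG : Indecomposable G)
    {L : RightFreyd V} [Simple L] (p : (RightFreyd.functor V).obj G ⟶ L) (hp : p ≠ 0) :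
    Epi p ∧ ∀ (M : RightFreyd V) (m : M ⟶ (RightFreyd.functor V).obj G) [Mono m],
      m ≫ p ≠ 0 → IsIso m := by
  refine ⟨epi_of_nonzero_to_simple hp, fun M m _ hm => ?_⟩
  have : Epi (m ≫ p) := epi_of_nonzero_to_simple hm
  obtain ⟨s, hs⟩ := (RightFreyd.functor V).map_surjective (Projective.factorThru p (m ≫ p) ≫ m)
  have := isIso_of_comp_eq hV hG hp s (by
    rw [hs, Category.assoc, Projective.factorThru_comp])
  have h1 : IsIso ((RightFreyd.functor V).map s) := inferInstance
  rw [hs] at h1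
  have : Epi m := epi_of_epi (Projective.factorThru p (m ≫ p)) m
  exact isIso_of_mono_of_epi m

/-- Lift each of the two epimorphisms onto L through the other. The composite endomorphism of G
fixes p, hence is invertible. -/
theorem nonempty_retract_of_ne_zero {G X : V} (hG : Indecomposable G) {L : RightFreyd V} [Simple L]
    [HasWeakKernels V]
    (p : (RightFreyd.functor V).obj G ⟶ L) (hp : p ≠ 0) (f : (RightFreyd.functor V).obj X ⟶ L)
    (hf : f ≠ 0) : Nonempty (Retract G X) := by
  have : Epi p := epi_of_nonzero_to_simple hp
  have : Epi f := epi_of_nonzero_to_simple hf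
  obtain ⟨a, ha⟩ := (RightFreyd.functor V).map_surjective (Projective.factorThru p f)
  obtain ⟨b, hb⟩ := (RightFreyd.functor V).map_surjective (Projective.factorThru f p)
  refine retract_of_isIso a b (isIso_of_comp_eq hV hG hp _ ?_)
  rw [Functor.map_comp, ha, hb, Category.assoc, Projective.factorThru_comp,
    Projective.factorThru_comp]

/-- The kernel of P_G ⟶ L is the radical, so a morphism into G vanishes on L exactly when it does
not split. The right-hand side no longer mentions L or the abelianization, which allows comparison
between two 2-categories. -/
theorem map_comp_eq_zero_iff [HasWeakKernels V] {G X : V} (hG : Indecomposable G)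
    {L : RightFreyd V} [Simple L] (p : (RightFreyd.functor V).obj G ⟶ L) (hp : p ≠ 0) (g : X ⟶ G) :
    (RightFreyd.functor V).map g ≫ p = 0 ↔ ∀ s : G ⟶ X, ¬ IsIso (s ≫ g) := by
  constructor
  · intro h s hs
    refine hp ?_
    rw [← cancel_epi ((RightFreyd.functor V).map (s ≫ g)), Functor.map_comp, Category.assoc, h,
      comp_zero, comp_zero]
  · intro h
    by_contra hg
    have : Epi ((RightFreyd.functor V).map g ≫ p) := epi_of_nonzero_to_simple hg
    obtain ⟨s, hs⟩ := (RightFreyd.functor V).map_surjective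
      (Projective.factorThru p ((RightFreyd.functor V).map g ≫ p))
    refine h s (isIso_of_comp_eq hV hG hp _ ?_)
    rw [Functor.map_comp, hs, Category.assoc, Projective.factorThru_comp]

/-- Take d(Z) to be the sum of dim Hom(P_G, Z) over representatives G of the indecomposables. The
P_G detect monomorphisms and epimorphisms, so equality of all dimensions forces an isomorphism. This
replaces composition series in every later induction. -/
theorem exists_length [HasWeakKernels V] : ∃ d : RightFreyd V → ℕ,
    (∀ {N Z : RightFreyd V} (m : N ⟶ Z) [Mono m], ¬ IsIso m → d N < d Z) ∧
    (∀ {Z W : RightFreyd V} (p : Z ⟶ W) [Epi p], ¬ IsIso p → d W < d Z) := by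
  obtain ⟨s, hs, hsi⟩ := hV.finite_indec
  have fin := freyd_hom_finite k hV.finite
  have hs' : Fintype s := hs.fintype
  have hom_iso : ∀ {X G : V} (e : X ≅ G) {Z W : RightFreyd V} (f : Z ⟶ W),
      (∀ x : (RightFreyd.functor V).obj G ⟶ Z, x ≫ f = 0 → x = 0) →
      ∀ x : (RightFreyd.functor V).obj X ⟶ Z, x ≫ f = 0 → x = 0 := by
    intro X G e Z W f h x hx
    rw [← cancel_epi ((RightFreyd.functor V).map e.inv), comp_zero]
    exact h _ (by rw [Category.assoc, hx, comp_zero])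
  refine ⟨fun Z => ∑ G : s, Module.finrank k ((RightFreyd.functor V).obj G.1 ⟶ Z), ?_, ?_⟩
  · intro N Z m _ hm
    have hle : ∀ G : s, Module.finrank k ((RightFreyd.functor V).obj G.1 ⟶ N) ≤
        Module.finrank k ((RightFreyd.functor V).obj G.1 ⟶ Z) := fun G =>
      LinearMap.finrank_le_finrank_of_injective
        (f := Linear.rightComp k ((RightFreyd.functor V).obj G.1) m)
        fun x y h => (cancel_mono m).mp h
    refine Finset.sum_lt_sum (fun G _ => hle G) ?_
    by_contra hcon
    push Not at hcon
    refine hm ?_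
    have hsurj : ∀ (X : V) (x : (RightFreyd.functor V).obj X ⟶ Z), ∃ y, y ≫ m = x := by
      intro X
      induction X using hV.induction with
      | @iso X Y e h =>
        intro x
        obtain ⟨y, hy⟩ := h ((RightFreyd.functor V).map e.hom ≫ x)
        exact ⟨(RightFreyd.functor V).map e.inv ≫ y, by
          rw [Category.assoc, hy, ← Functor.map_comp_assoc, e.inv_hom_id, CategoryTheory.Functor.map_id,
            Category.id_comp]⟩
      | zero X hX => exact fun x => ⟨0, ((RightFreyd.functor V).map_isZero hX).eq_of_src _ _⟩
      | indec X hX =>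
        intro x
        obtain ⟨G, hG, ⟨e⟩⟩ := hsi X hX
        have h1 := hcon ⟨G, hG⟩ (Finset.mem_univ _)
        have hi : Function.Injective (Linear.rightComp k ((RightFreyd.functor V).obj G) m) :=
          fun x y h => (cancel_mono m).mp h
        have h2 := (LinearMap.injective_iff_surjective_of_finrank_eq_finrank
          (f := Linear.rightComp k ((RightFreyd.functor V).obj G) m)
          (le_antisymm (hle ⟨G, hG⟩) h1)).mp hi
        obtain ⟨y, hy⟩ := h2 ((RightFreyd.functor V).map e.inv ≫ x)
        have hy : y ≫ m = (RightFreyd.functor V).map e.inv ≫ x := hy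
        exact ⟨(RightFreyd.functor V).map e.hom ≫ y, by
          rw [Category.assoc, hy, ← Functor.map_comp_assoc, e.hom_inv_id, CategoryTheory.Functor.map_id,
            Category.id_comp]⟩
      | sum A B hA hB =>
        intro x
        obtain ⟨a, ha⟩ := hA ((RightFreyd.functor V).map biprod.inl ≫ x)
        obtain ⟨b, hb⟩ := hB ((RightFreyd.functor V).map biprod.inr ≫ x)
        refine ⟨(RightFreyd.functor V).map biprod.fst ≫ a +
          (RightFreyd.functor V).map biprod.snd ≫ b, ?_⟩
        rw [add_comp, Category.assoc, Category.assoc, ha, hb, ← Functor.map_comp_assoc,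
          ← Functor.map_comp_assoc, ← add_comp, ← Functor.map_add, biprod.total, CategoryTheory.Functor.map_id,
          Category.id_comp]
    obtain ⟨X, p, hp⟩ := freyd_exists_cover Z
    obtain ⟨y, hy⟩ := hsurj X p
    have : Epi (y ≫ m) := hy ▸ hp
    have : Epi m := epi_of_epi y m
    exact isIso_of_mono_of_epi m
  · intro Z W p _ hp
    have hsurj : ∀ G : V, Function.Surjective
        (Linear.rightComp k ((RightFreyd.functor V).obj G) p) := fun G x =>
      ⟨Projective.factorThru x p, Projective.factorThru_comp x p⟩
    have hle : ∀ G : s, Module.finrank k ((RightFreyd.functor V).obj G.1 ⟶ W) ≤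
        Module.finrank k ((RightFreyd.functor V).obj G.1 ⟶ Z) := fun G =>
      LinearMap.finrank_le_finrank_of_surjective (hsurj G.1)
    refine Finset.sum_lt_sum (fun G _ => hle G) ?_
    by_contra hcon
    push Not at hcon
    refine hp ?_
    have hinj : ∀ (X : V) (x : (RightFreyd.functor V).obj X ⟶ Z), x ≫ p = 0 → x = 0 := by
      intro X
      induction X using hV.induction with
      | @iso X Y e h => exact hom_iso e.symm p h
      | zero X hX => exact fun x _ => ((RightFreyd.functor V).map_isZero hX).eq_of_src _ _
      | indec X hX =>
        obtain ⟨G, hG, ⟨e⟩⟩ := hsi X hX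
        refine hom_iso e p fun x hx => ?_
        have h1 := hcon ⟨G, hG⟩ (Finset.mem_univ _)
        have h2 := (LinearMap.injective_iff_surjective_of_finrank_eq_finrank
          (f := Linear.rightComp k ((RightFreyd.functor V).obj G) p)
          (le_antisymm h1 (hle ⟨G, hG⟩))).mpr (hsurj G)
        exact (injective_iff_map_eq_zero _).mp h2 x hx
      | sum A B hA hB =>
        intro x hx
        have h1 := hA ((RightFreyd.functor V).map biprod.inl ≫ x)
          (by rw [Category.assoc, hx, comp_zero])
        have h2 := hB ((RightFreyd.functor V).map biprod.inr ≫ x)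
          (by rw [Category.assoc, hx, comp_zero])
        rw [← Category.id_comp x, ← CategoryTheory.Functor.map_id, ← biprod.total, Functor.map_add, add_comp,
          Functor.map_comp, Functor.map_comp, Category.assoc, Category.assoc, h1, h2, comp_zero,
          comp_zero, add_zero]
    have : Mono p := by
      rw [Preadditive.mono_iff_cancel_zero]
      intro T f hf
      obtain ⟨X, q, hq⟩ := freyd_exists_cover T
      rw [← cancel_epi q, comp_zero]
      exact hinj X _ (by rw [Category.assoc, hf, comp_zero])
    exact isIso_of_mono_of_epi p

end FreydKrullSchmidt

end FiatCells

namespace FiatCells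
open Preadditive

/-! ### Right exactness of the action, adjunctions, and its values on projectives. -/

section FreydMap

variable {V : Type*} [Category V] [Preadditive V] {W : Type*} [Category W] [Preadditive W]

instance freydMap_additive (T : V ⥤ W) [T.Additive] : (freydMap T).Additive where
  map_add {X Y f g} := by
    obtain ⟨X, rfl⟩ := freyd_exists_rep X
    obtain ⟨Y, rfl⟩ := freyd_exists_rep Y
    obtain ⟨f, rfl⟩ := (RightFreyd.quotient V).map_surjective f
    obtain ⟨g, rfl⟩ := (RightFreyd.quotient V).map_surjective g
    rw [← Functor.map_add]
    change (RightFreyd.quotient W).map (T.mapArrow.map (f + g)) =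
      (RightFreyd.quotient W).map (T.mapArrow.map f) +
        (RightFreyd.quotient W).map (T.mapArrow.map g)
    rw [← Functor.map_add]
    exact quotient_map_congr T.map_add T.map_add

variable [HasZeroObject V] [HasBinaryBiproducts V] [HasZeroObject W] [HasBinaryBiproducts W]

/-- The cokernel of f is explicitly `biprod.desc Y.hom f.right : Y.left ⊞ X.right ⟶ Y.right`. An
additive functor respects this biproduct, so the image again has the universal property. -/
instance freydMap_preservesCokernel (T : V ⥤ W) [T.Additive] {X Y : RightFreyd V} (f : X ⟶ Y) :
    PreservesColimit (parallelPair f 0) (freydMap T) := by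
  obtain ⟨X, rfl⟩ := freyd_exists_rep X
  obtain ⟨Y, rfl⟩ := freyd_exists_rep Y
  obtain ⟨f, rfl⟩ := (RightFreyd.quotient V).map_surjective f
  refine preservesColimit_of_preserves_colimit_cocone
    (RightFreyd.Candidate.isColimitCokernelCofork f)
    ((CokernelCofork.isColimitMapCoconeEquiv _ (freydMap T)).symm ?_)
  have : IsIso (T.mapArrow.map (RightFreyd.Candidate.π f)).right :=
    inferInstanceAs (IsIso (T.map (𝟙 Y.right)))
  have : Epi ((RightFreyd.quotient W).map (T.mapArrow.map (RightFreyd.Candidate.π f))) :=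
    RightFreyd.epi_of_isIso_right _
  refine CokernelCofork.IsColimit.ofπ' (hp := this)
    ((RightFreyd.quotient W).map (T.mapArrow.map (RightFreyd.Candidate.π f)))
    ((RightFreyd.Candidate.cokernelCofork f).map (freydMap T)).condition fun {Z} g hg => Nonempty.some ?_
  obtain ⟨Z, rfl⟩ := freyd_exists_rep Z
  obtain ⟨g, rfl⟩ := (RightFreyd.quotient W).map_surjective (X := T.mapArrow.obj Y) g
  obtain ⟨a, b, hab, rfl⟩ : ∃ (a : T.obj Y.left ⟶ Z.left) (b : T.obj Y.right ⟶ Z.right)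
      (hab : a ≫ Z.hom = T.map Y.hom ≫ b),
      g = (Arrow.homMk a b hab : T.mapArrow.obj Y ⟶ Z) := ⟨g.left, g.right, g.w, rfl⟩
  have hg : (RightFreyd.quotient W).map (T.mapArrow.map f ≫ Arrow.homMk a b hab) = 0 := by
    rw [Functor.map_comp]; exact hg
  obtain ⟨h, hh⟩ : ∃ h : T.obj X.right ⟶ Z.left, T.map f.right ≫ b = h ≫ Z.hom :=
    (freyd_map_eq_zero_iff _).mp hg
  have hw : (T.map biprod.fst ≫ a + T.map biprod.snd ≫ h) ≫ Z.hom =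
      T.map (biprod.desc Y.hom f.right) ≫ b := by
    rw [biprod.desc_eq, T.map_add, T.map_comp, T.map_comp, add_comp, add_comp, Category.assoc,
      Category.assoc, Category.assoc, Category.assoc, hab, hh]
  refine ⟨⟨(RightFreyd.quotient W).map
    (X := T.mapArrow.obj (RightFreyd.Candidate.cokernel f)) (Y := Z) (Arrow.homMk _ b hw), ?_⟩⟩
  rw [← Functor.map_comp]
  apply quotient_map_congr
  · change T.map biprod.inl ≫ (T.map biprod.fst ≫ a + T.map biprod.snd ≫ h) = a
    rw [comp_add, ← T.map_comp_assoc, ← T.map_comp_assoc]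
    simp
  · change T.map (𝟙 _) ≫ b = b
    rw [T.map_id]
    exact Category.id_comp b

end FreydMap

section Act

variable {B : Type u} [Bicategory.{w, v} B] [PreadditiveBicategory B]

instance act_additive (i : B) {j l : B} (F : j ⟶ l) : (act i F).Additive :=
  inferInstanceAs (freydMap (postcomp i F)).Additive

/-- The adjunction between the actions of adjoint 1-morphisms. -/
def actAdj (i : B) {j l : B} {F : j ⟶ l} {G : l ⟶ j} (adj : F ⊣ G) : act i F ⊣ act i G :=
  CategoryTheory.Adjunction.ofCat ((principal i).mapAdjunction adj)

variable [AdditiveBicategory B]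

instance act_preservesCokernel (i : B) {j l : B} (F : j ⟶ l) {X Y : RightFreyd (i ⟶ j)}
    (f : X ⟶ Y) : PreservesColimit (parallelPair f 0) (act i F) :=
  inferInstanceAs (PreservesColimit (parallelPair f 0) (freydMap (postcomp i F)))

instance act_preservesFiniteColimits (i : B) {j l : B} (F : j ⟶ l)
    [HasWeakKernels (i ⟶ j)] : PreservesFiniteColimits (act i F) :=
  (act i F).preservesFiniteColimits_of_preservesCokernels

open ZeroObject in
/-- The projective objects `P_X` are compatible with the action of 1-morphisms. -/
def actProj {i j l : B} (X : i ⟶ j) (F : j ⟶ l) :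
    (act i F).obj ((RightFreyd.functor (i ⟶ j)).obj X) ≅ (RightFreyd.functor (i ⟶ l)).obj (X ≫ F) :=
  (RightFreyd.quotient (i ⟶ l)).mapIso
    (Arrow.isoMk (((postcomp i F).map_isZero (isZero_zero (i ⟶ j))).iso (isZero_zero (i ⟶ l)))
      (Iso.refl (X ≫ F)) (((postcomp i F).map_isZero (isZero_zero (i ⟶ j))).eq_of_src _ _) :
      (postcomp i F).mapArrow.obj ((RightFreyd.rightFunctor (i ⟶ j)).obj X) ≅
        (RightFreyd.rightFunctor (i ⟶ l)).obj (X ≫ F))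

theorem actProj_naturality_left {i j l : B} {X Y : i ⟶ j} (x : X ⟶ Y) (F : j ⟶ l) :
    (act i F).map ((RightFreyd.functor (i ⟶ j)).map x) ≫ (actProj Y F).hom =
      (actProj X F).hom ≫ (RightFreyd.functor (i ⟶ l)).map (x ▷ F) := by
  change (RightFreyd.quotient _).map _ ≫ (RightFreyd.quotient _).map _ =
    (RightFreyd.quotient _).map _ ≫ (RightFreyd.quotient _).map _
  rw [← Functor.map_comp, ← Functor.map_comp]
  apply quotient_map_congr
  · exact ((postcomp i F).map_isZero (isZero_zero (i ⟶ j))).eq_of_src _ _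
  · change x ▷ F ≫ 𝟙 _ = 𝟙 _ ≫ x ▷ F
    simp

theorem actProj_naturality_right {i j l : B} (X : i ⟶ j) {F G : j ⟶ l} (α : F ⟶ G) :
    (actHom i α).app ((RightFreyd.functor (i ⟶ j)).obj X) ≫ (actProj X G).hom =
      (actProj X F).hom ≫ (RightFreyd.functor (i ⟶ l)).map (X ◁ α) := by
  change (RightFreyd.quotient _).map _ ≫ (RightFreyd.quotient _).map _ =
    (RightFreyd.quotient _).map _ ≫ (RightFreyd.quotient _).map _
  rw [← Functor.map_comp, ← Functor.map_comp]
  apply quotient_map_congr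
  · exact ((postcomp i F).map_isZero (isZero_zero (i ⟶ j))).eq_of_src _ _
  · change X ◁ α ≫ 𝟙 _ = 𝟙 _ ≫ X ◁ α
    simp

/-- The isomorphism between `P_F` and the action of `F` on `P_{𝟙}`. -/
def projIso {i j : B} (F : i ⟶ j) :
    (RightFreyd.functor (i ⟶ j)).obj F ≅
      (act i F).obj ((RightFreyd.functor (i ⟶ i)).obj (𝟙 i)) :=
  (RightFreyd.functor (i ⟶ j)).mapIso (λ_ F).symm ≪≫ (actProj (𝟙 i) F).symm

theorem projIso_naturality {i j : B} {F G : i ⟶ j} (α : F ⟶ G) :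
    (RightFreyd.functor (i ⟶ j)).map α ≫ (projIso G).hom =
      (projIso F).hom ≫ (actHom i α).app ((RightFreyd.functor (i ⟶ i)).obj (𝟙 i)) := by
  have h := actProj_naturality_right (𝟙 i) α
  rw [← Iso.eq_comp_inv, Category.assoc] at h
  rw [h]
  change _ ≫ (RightFreyd.functor (i ⟶ j)).map (λ_ G).inv ≫ _ =
    ((RightFreyd.functor (i ⟶ j)).map (λ_ F).inv ≫ (actProj (𝟙 i) F).inv) ≫ _
  rw [Category.assoc, Iso.inv_hom_id_assoc, ← Functor.map_comp_assoc, ← Functor.map_comp_assoc,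
    leftUnitor_inv_naturality]
  rfl

theorem act_isZero_cokernel_iff (i : B) {j l : B} (F : j ⟶ l) {X Y : RightFreyd (i ⟶ j)}
    (f : X ⟶ Y) : IsZero ((act i F).obj (cokernel f)) ↔ Epi ((act i F).map f) := by
  rw [epi_iff_isZero_cokernel]
  exact (PreservesCokernel.iso (act i F) f).isZero_iff

end Act

end FiatCells

namespace FiatCells
open Preadditive

/-! ### The cell preorders, and propagation of vanishing along them. -/

section Orders

variable {B : Type u} [Bicategory.{w, v} B]

/-- A retract of 1-morphisms, whiskered on the right. -/
def retractWhiskerRight {i j l : B} {F G : i ⟶ j} (r : Retract F G) (H : j ⟶ l) :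
    Retract (F ≫ H) (G ≫ H) := r.map (postcomp i H)

/-- A retract of 1-morphisms, whiskered on the left. -/
def retractWhiskerLeft {i j l : B} (H : i ⟶ j) {F G : j ⟶ l} (r : Retract F G) :
    Retract (H ≫ F) (H ≫ G) := r.map (precomp l H)

/-- A retract of an object isomorphic to a given one. -/
def retractOfIso {A : Type*} [Category A] {X Y Z : A} (r : Retract X Y) (e : Y ≅ Z) : Retract X Z :=
  r.trans (Retract.ofIso e)

theorem leR_iff {i j l : B} {F : i ⟶ j} {G : i ⟶ l} :
    LeR ⟨i, j, F⟩ ⟨i, l, G⟩ ↔ ∃ H : j ⟶ l, Nonempty (Retract G (F ≫ H)) :=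
  ⟨fun h => by cases h with | mk H r => exact ⟨H, ⟨r⟩⟩, fun ⟨H, ⟨r⟩⟩ => LeR.mk H r⟩

theorem LeR.refl (F : OneMor B) : LeR F F :=
  LeR.mk (𝟙 _) (Retract.ofIso (ρ_ F.mor).symm)

theorem LeR.trans {F G H : OneMor B} (h₁ : LeR F G) (h₂ : LeR G H) : LeR F H := by
  cases h₁ with
  | mk A r =>
    cases h₂ with
    | mk A' r' =>
      exact LeR.mk (A ≫ A') (retractOfIso (r'.trans (retractWhiskerRight r A')) (α_ _ _ _))

theorem LeL.refl (F : OneMor B) : LeL F F :=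
  LeL.mk (𝟙 _) (Retract.ofIso (λ_ F.mor).symm)

theorem LeL.trans {F G H : OneMor B} (h₁ : LeL F G) (h₂ : LeL G H) : LeL F H := by
  cases h₁ with
  | mk A r =>
    cases h₂ with
    | mk A' r' =>
      exact LeL.mk (A' ≫ A) (retractOfIso (r'.trans (retractWhiskerLeft A' r)) (α_ _ _ _).symm)

theorem LeR.leLR {F G : OneMor B} (h : LeR F G) : LeLR F G := by
  cases h with
  | mk A r => exact LeLR.mk (𝟙 _) A (retractOfIso r (λ_ _).symm)

theorem LeL.leLR {F G : OneMor B} (h : LeL F G) : LeLR F G := by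
  cases h with
  | mk A r => exact LeLR.mk A (𝟙 _) (retractOfIso r (whiskerLeftIso A (ρ_ _).symm))

theorem LeLR.trans {F G H : OneMor B} (h₁ : LeLR F G) (h₂ : LeLR G H) : LeLR F H := by
  cases h₁ with
  | mk A B r =>
    cases h₂ with
    | mk A' B' r' =>
      refine LeLR.mk (A' ≫ A) (B ≫ B') (retractOfIso (r'.trans
        (retractWhiskerLeft A' (retractWhiskerRight r B'))) ?_)
      exact whiskerLeftIso A' (α_ _ _ _ ≪≫ whiskerLeftIso A (α_ _ _ _)) ≪≫ (α_ _ _ _).symm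

variable [PreadditiveBicategory B] [AdditiveBicategory B]

theorem mem_rightCell_self {F : OneMor B} (hF : F.Indec) : F ∈ rightCell F :=
  ⟨hF, LeR.refl F, LeR.refl F⟩

theorem IsRightCell.eq_rightCell {R : Set (OneMor B)} (hR : IsRightCell R) {F : OneMor B}
    (hF : F ∈ R) : R = rightCell F := by
  obtain ⟨F₀, -, rfl⟩ := hR
  ext G
  exact ⟨fun h => ⟨h.1, hF.2.2.trans h.2.1, h.2.2.trans hF.2.1⟩,
    fun h => ⟨h.1, hF.2.1.trans h.2.1, h.2.2.trans hF.2.2⟩⟩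

theorem IsRightCell.indec {R : Set (OneMor B)} (hR : IsRightCell R) {F : OneMor B}
    (hF : F ∈ R) : F.Indec := by
  obtain ⟨F₀, -, rfl⟩ := hR
  exact hF.1

theorem IsRightCell.leR {R : Set (OneMor B)} (hR : IsRightCell R) {F G : OneMor B}
    (hF : F ∈ R) (hG : G ∈ R) : LeR F G := by
  rw [hR.eq_rightCell hF] at hG
  exact hG.2.1

theorem IsRightCell.mem {R : Set (OneMor B)} (hR : IsRightCell R) {F G : OneMor B}
    (hF : F ∈ R) (hG : G.Indec) (h₁ : LeR F G) (h₂ : LeR G F) : G ∈ R := by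
  rw [hR.eq_rightCell hF]
  exact ⟨hG, h₁, h₂⟩

theorem IsRightCell.exists_mem {R : Set (OneMor B)} (hR : IsRightCell R) {i : B}
    (hi : ∀ F ∈ R, F.dom = i) : ∃ (j : B) (F : i ⟶ j), (⟨i, j, F⟩ : OneMor B) ∈ R := by
  obtain ⟨F₀, h, rfl⟩ := hR
  have := hi _ (mem_rightCell_self h)
  subst this
  exact ⟨_, _, mem_rightCell_self h⟩

end Orders

section Acting

variable {B : Type u} [Bicategory.{w, v} B] [PreadditiveBicategory B] [AdditiveBicategory B]

omit [AdditiveBicategory B] in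
theorem act_isZero_of_retract {i j l : B} {F G : j ⟶ l} (r : Retract F G) {X : RightFreyd (i ⟶ j)}
    (h : IsZero ((act i G).obj X)) : IsZero ((act i F).obj X) := by
  have h1 : (actHom i r.i).app X ≫ (actHom i r.r).app X = 𝟙 _ := by
    have := congrArg (fun τ => τ.toNatTrans.app X) ((principal i).map₂_comp r.i r.r)
    rw [r.retract, (principal i).map₂_id] at this
    exact this.symm
  rw [IsZero.iff_id_eq_zero, ← h1, h.eq_of_src ((actHom i r.r).app X) 0, comp_zero]

omit [AdditiveBicategory B] in
theorem act_comp_isZero {i j l m : B} {F : j ⟶ l} {G : l ⟶ m} {X : RightFreyd (i ⟶ j)}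
    (h : IsZero ((act i F).obj X)) : IsZero ((act i (F ≫ G)).obj X) :=
  ((act i G).map_isZero h).of_iso ((actComp i F G).app X)

omit [AdditiveBicategory B] in
theorem act_isZero_of_leR {i j l : B} {F : i ⟶ j} {G : i ⟶ l} (h : LeR ⟨i, j, F⟩ ⟨i, l, G⟩)
    {X : RightFreyd (i ⟶ i)} (hX : IsZero ((act i F).obj X)) : IsZero ((act i G).obj X) := by
  obtain ⟨H, ⟨r⟩⟩ := leR_iff.mp h
  exact act_isZero_of_retract r (act_comp_isZero hX)

theorem isZero_of_projObj_isZero {i j : B} {F : i ⟶ j}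
    (h : IsZero ((RightFreyd.functor (i ⟶ j)).obj F)) : IsZero F :=
  IsZero.of_full_of_faithful_of_isZero (RightFreyd.functor (i ⟶ j)) F h

end Acting

/-! ### Existence of the simple object L_R. -/

section Existence

variable {k : Type t} [Field k] {B : Type u} [Bicategory.{w, v} B] [PreadditiveBicategory B]
  [LinearBicategory k B] [AdditiveBicategory B] [hw : ∀ i j : B, HasWeakKernels (i ⟶ j)]

/-- The elements of `R` with source `i` have left adjoints. -/
def HasLeftAdjoints (i : B) (R : Set (OneMor B)) : Prop :=
  ∀ {j : B} (F : i ⟶ j), (⟨i, j, F⟩ : OneMor B) ∈ R → ∃ F' : j ⟶ i, Nonempty (F' ⊣ F)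

theorem act_map_mono {i j : B} {F : i ⟶ j} {F' : j ⟶ i} (adj : F' ⊣ F) {X Y : RightFreyd (i ⟶ i)}
    (f : X ⟶ Y) [Mono f] : Mono ((act i F).map f) := by
  have := (actAdj i adj).rightAdjoint_preservesLimits
  infer_instance

/-- A nonzero quotient of least length has no proper nonzero quotient, hence is simple. -/
theorem exists_simple_quotient (hB : ∀ i j : B, IsKrullSchmidt k (i ⟶ j)) {i j : B}
    {K : RightFreyd (i ⟶ j)} (hK : ¬ IsZero K) :
    ∃ (L : RightFreyd (i ⟶ j)) (q : K ⟶ L), Simple L ∧ Epi q := by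
  classical
  obtain ⟨d, -, hd⟩ := exists_length (hB i j)
  have hex : ∃ n, ∃ (L : RightFreyd (i ⟶ j)) (q : K ⟶ L), Epi q ∧ ¬ IsZero L ∧ d L = n :=
    ⟨_, K, 𝟙 K, inferInstance, hK, rfl⟩
  obtain ⟨L, q, hq, hL, hdL⟩ := Nat.find_spec hex
  have hmin : ∀ (M : RightFreyd (i ⟶ j)) (p : L ⟶ M) [Epi p], ¬ IsZero M → IsIso p := by
    intro M p _ hM
    by_contra hp
    exact Nat.find_min hex (m := d M) (hdL ▸ hd p hp) ⟨M, q ≫ p, epi_comp q p, hM, rfl⟩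
  refine ⟨L, q, simple_of_cosimple L fun {Z} f _ => ⟨fun h hf => ?_, fun hf => ?_⟩, hq⟩
  · subst hf
    refine hL ?_
    rw [IsZero.iff_id_eq_zero, ← cancel_mono (0 : L ⟶ Z), comp_zero, comp_zero]
  · refine hmin _ f fun hZ => hf (hZ.eq_of_tgt _ _)

/-- Choose K of least length among subobjects of P_𝟙 on which every F in R still surjects onto F P_𝟙
= P_F. Left adjoints make the action of F exact, so F K = P_F. Minimality of K then yields a simple
top that no F in R kills. Only left adjoints of the elements of R are needed, so the argument
applies to C_Q as well. -/
theorem exists_isCellSimple (hB : ∀ i j : B, IsKrullSchmidt k (i ⟶ j)) {i : B}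
    {R : Set (OneMor B)} (hR : IsRightCell R) (hi : ∀ F ∈ R, F.dom = i)
    (hadj : HasLeftAdjoints i R) : ∃ L : RightFreyd (i ⟶ i), IsCellSimple i R L := by
  classical
  obtain ⟨j₀, F₀, hF₀⟩ := hR.exists_mem hi
  obtain ⟨d, hd, -⟩ := exists_length (hB i i)
  let P := (RightFreyd.functor (i ⟶ i)).obj (𝟙 i)
  let good : ∀ {K : RightFreyd (i ⟶ i)}, (K ⟶ P) → Prop := fun m =>
    ∀ {j : B} (F : i ⟶ j), (⟨i, j, F⟩ : OneMor B) ∈ R → Epi ((act i F).map m)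
  have hex : ∃ n, ∃ (K : RightFreyd (i ⟶ i)) (m : K ⟶ P), Mono m ∧ good m ∧ d K = n :=
    ⟨_, P, 𝟙 P, inferInstance, fun F _ => inferInstance, rfl⟩
  obtain ⟨K, m, hm, hgood, hdK⟩ := Nat.find_spec hex
  have hiso : ∀ {j : B} (F : i ⟶ j), (⟨i, j, F⟩ : OneMor B) ∈ R → IsIso ((act i F).map m) := by
    intro j F hF
    obtain ⟨F', ⟨adj⟩⟩ := hadj F hF
    have := act_map_mono adj m
    have := hgood F hF
    exact isIso_of_mono_of_epi _
  -- Minimality in usable form: a proper subobject of K has a quotient that survives under some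
  -- element of R.
  have hmin : ∀ {M : RightFreyd (i ⟶ i)} (u : M ⟶ K) [Mono u], ¬ IsIso u →
      ∃ (j : B) (F : i ⟶ j), (⟨i, j, F⟩ : OneMor B) ∈ R ∧ ¬ IsZero ((act i F).obj (cokernel u)) := by
    intro M u _ hu
    by_contra hcon
    push Not at hcon
    refine Nat.find_min hex (m := d M) (hdK ▸ hd u hu)
      ⟨M, u ≫ m, mono_comp u m, fun {j} F hF => ?_, rfl⟩
    have h1 := (act_isZero_cokernel_iff i F u).mp (hcon j F hF)
    have h2 := hgood F hF
    rw [Functor.map_comp]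
    exact epi_comp _ _
  have hK : ¬ IsZero K := by
    intro hK
    have := hiso F₀ hF₀
    have h1 : IsZero ((act i F₀).obj P) :=
      ((act i F₀).map_isZero hK).of_iso (asIso ((act i F₀).map m)).symm
    exact (hR.indec hF₀).1 (isZero_of_projObj_isZero (h1.of_iso (projIso F₀)))
  obtain ⟨L, p, hL, hp⟩ := exists_simple_quotient hB hK
  -- The kernel of `p : K ⟶ L` is proper, so some F' in R does not kill L. Inside a right cell F ≤_R
  -- F', so killing by one element would mean killing by all.
  have hne : ∀ {j : B} (F : i ⟶ j), (⟨i, j, F⟩ : OneMor B) ∈ R → ¬ IsZero ((act i F).obj L) := by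
    intro j F hF hz
    have hk : ¬ IsIso (kernel.ι p) := by
      intro h
      have : p = 0 := by rw [← cancel_epi (kernel.ι p), kernel.condition, comp_zero]
      subst this
      refine Simple.not_isZero L ?_
      rw [IsZero.iff_id_eq_zero, ← cancel_epi (0 : K ⟶ L), zero_comp, zero_comp]
    obtain ⟨j', F', hF', h⟩ := hmin (kernel.ι p) hk
    refine h ?_
    exact (act_isZero_of_leR (hR.leR hF hF') hz).of_iso
      ((act i F').mapIso ((cokernelIsCokernel (kernel.ι p)).coconePointUniqueUpToIso
        (Abelian.epiIsCokernelOfKernel _ (limit.isLimit _))))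
  have htop : ∀ (M : RightFreyd (i ⟶ i)) (u : M ⟶ K) [Mono u], u ≫ p ≠ 0 → IsIso u := by
    intro M u _ hu
    by_contra hcon
    obtain ⟨j, F, hF, hz⟩ := hmin u hcon
    have hup : Epi (u ≫ p) := epi_of_nonzero_to_simple hu
    -- Since u already maps onto L, the two quotients K/M and L of K are independent.
    have hepi : Epi (biprod.lift (cokernel.π u) p) := by
      rw [Preadditive.epi_iff_cancel_zero]
      intro T x hx
      have e : cokernel.π u ≫ biprod.inl ≫ x + p ≫ biprod.inr ≫ x = 0 := by
        rw [← hx, biprod.lift_eq, add_comp, Category.assoc, Category.assoc]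
      have e2 : biprod.inr ≫ x = 0 := by
        rw [← cancel_epi (u ≫ p), comp_zero]
        have := congrArg (fun y => u ≫ y) e
        simpa using this
      have e1 : biprod.inl ≫ x = 0 := by
        rw [e2, comp_zero, add_zero] at e
        rwa [← cancel_epi (cokernel.π u), comp_zero]
      apply biprod.hom_ext'
      · rw [e1, comp_zero]
      · rw [e2, comp_zero]
    have := hiso F hF
    have := preservesBinaryBiproducts_of_preservesBiproducts (act i F)
    -- Applying F gives an epimorphism from P_F = F K onto F(K/M) ⊞ F L with both summands nonzero,
    -- which contradicts the indecomposability of F.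
    have := isZero_or_isZero_of_epi_biprod (hB i j) (hR.indec hF)
      ((projIso F).hom ≫ inv ((act i F).map m) ≫
        (act i F).map (biprod.lift (cokernel.π u) p) ≫ ((act i F).mapBiprod _ _).hom)
    exact this.elim hz (hne F hF)
  refine ⟨L, K, m, hm, fun S hS j F hF => ?_, ⟨hL, p, hp, htop⟩, ?_, hne⟩
  · obtain ⟨hS, N, n, e, hn, he⟩ := hS
    obtain ⟨F', ⟨adj⟩⟩ := hadj F hF
    have h1 := act_map_mono adj n
    have h2 := (act_isZero_cokernel_iff i F m).mpr (hgood F hF)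
    have h3 : IsZero ((act i F).obj N) := IsZero.of_mono ((act i F).map n) h2
    exact IsZero.of_epi ((act i F).map e) h3
  · obtain ⟨X, x, hx⟩ := exists_ne_zero_of_not_isZero (Simple.not_isZero L)
    obtain ⟨G, hG, g, hg⟩ := exists_indec_of_ne_zero (hB i i) x hx
    obtain ⟨h1, h2⟩ := hasSimpleTop_of_ne_zero (hB i i) hG g hg
    exact ⟨G, hG, hL, g, h1, h2⟩

end Existence

end FiatCells

namespace FiatCells
open Preadditive

/-! ### Evaluation at an object, annihilator ideals, and criteria for stability and annihilation. -/

section Eval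

variable {B : Type u} [Bicategory.{w, v} B] [PreadditiveBicategory B]

theorem actHom_id (i : B) {j l : B} (F : j ⟶ l) (X : RightFreyd (i ⟶ j)) :
    (actHom i (𝟙 F)).app X = 𝟙 _ :=
  congrArg (fun τ => τ.toNatTrans.app X) ((principal i).map₂_id F)

theorem actHom_comp (i : B) {j l : B} {F G H : j ⟶ l} (η : F ⟶ G) (θ : G ⟶ H)
    (X : RightFreyd (i ⟶ j)) :
    (actHom i (η ≫ θ)).app X = (actHom i η).app X ≫ (actHom i θ).app X :=
  congrArg (fun τ => τ.toNatTrans.app X) ((principal i).map₂_comp η θ)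

theorem actHom_whiskerLeft (i : B) {j l m : B} (H : j ⟶ l) {F G : l ⟶ m} (α : F ⟶ G)
    (X : RightFreyd (i ⟶ j)) :
    (actHom i (H ◁ α)).app X = (actComp i H F).hom.app X ≫ (actHom i α).app ((act i H).obj X) ≫
      (actComp i H G).inv.app X :=
  congrArg (fun τ => τ.toNatTrans.app X) ((principal i).map₂_whisker_left H α)

theorem actHom_whiskerRight (i : B) {j l m : B} {F G : j ⟶ l} (α : F ⟶ G) (H : l ⟶ m)
    (X : RightFreyd (i ⟶ j)) :
    (actHom i (α ▷ H)).app X = (actComp i F H).hom.app X ≫ (act i H).map ((actHom i α).app X) ≫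
      (actComp i G H).inv.app X :=
  congrArg (fun τ => τ.toNatTrans.app X) ((principal i).map₂_whisker_right α H)

/-- Evaluation of the action at an object of the abelianization. -/
def evalAt {i j : B} (X : RightFreyd (i ⟶ j)) (l : B) : (j ⟶ l) ⥤ RightFreyd (i ⟶ l) where
  obj F := (act i F).obj X
  map α := (actHom i α).app X
  map_id F := actHom_id i F X
  map_comp η θ := actHom_comp i η θ X

instance evalAt_additive {i j : B} (X : RightFreyd (i ⟶ j)) (l : B) : (evalAt X l).Additive where
  map_add {F G α β} := by
    obtain ⟨X, rfl⟩ := freyd_exists_rep X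
    refine Eq.trans ?_ ((RightFreyd.quotient (i ⟶ l)).map_add)
    exact quotient_map_congr (PreadditiveBicategory.whiskerLeft_add _ _ _)
      (PreadditiveBicategory.whiskerLeft_add _ _ _)

instance evalAt_linear {k : Type t} [Field k] [LinearBicategory k B] {i j : B}
    (X : RightFreyd (i ⟶ j)) (l : B) : (evalAt X l).Linear k where
  map_smul {F G} α c := by
    obtain ⟨X, rfl⟩ := freyd_exists_rep X
    refine Eq.trans ?_ (CategoryTheory.Functor.map_smul (RightFreyd.quotient (i ⟶ l)) c _)
    exact quotient_map_congr (LinearBicategory.whiskerLeft_smul _ _ _)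
      (LinearBicategory.whiskerLeft_smul _ _ _)

/-- The 2-ideal of the 2-morphisms which annihilate all objects obtained from `L` by the action. -/
def annIdeal (k : Type t) [Field k] [LinearBicategory k B] {i : B} (L : RightFreyd (i ⟶ i)) :
    TwoIdeal k B where
  carrier {j l} F G :=
    { carrier := {α | ∀ H : i ⟶ j, (actHom i α).app ((act i H).obj L) = 0}
      add_mem' := fun {α β} hα hβ H => by
        change (evalAt ((act i H).obj L) l).map (α + β) = 0
        rw [Functor.map_add]
        exact (congrArg₂ (· + ·) (hα H) (hβ H)).trans (add_zero _)
      zero_mem' := fun H => (evalAt ((act i H).obj L) l).map_zero F G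
      smul_mem' := fun c α hα H => by
        change (evalAt ((act i H).obj L) l).map (c • α) = 0
        rw [CategoryTheory.Functor.map_smul]
        have h0 : (evalAt ((act i H).obj L) l).map α = 0 := hα H
        rw [h0, smul_zero] }
  precomp_mem {_ _ _ _ _} η {_} h H := by rw [actHom_comp, h H, comp_zero]
  postcomp_mem {_ _ _ _ _ _} η h H := by rw [actHom_comp, h H, zero_comp]
  whiskerLeft_mem {i' j l} H' {F G α} h H := by
    -- The annihilator is defined with all H, not only with H = 𝟙, precisely for this: H'(H L) is
    -- the value at L of `H ≫ H'`.
    have e : (actHom i α).app ((act i H').obj ((act i H).obj L)) = 0 := by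
      have := (actHom i α).naturality ((actComp i H H').hom.app L)
      have h0 := h (H ≫ H')
      rw [h0, zero_comp] at this
      have hi : IsIso ((act i F).map ((actComp i H H').hom.app L)) := inferInstance
      exact (cancel_epi _).mp (this.trans comp_zero.symm)
    rw [actHom_whiskerLeft, e, zero_comp, comp_zero]
  whiskerRight_mem {_ _ _ _ _ _} H' h H := by
    rw [actHom_whiskerRight, h H, Functor.map_zero, zero_comp, comp_zero]

end Eval

section AddClosure

variable {A : Type*} [Category A] [Preadditive A] {A' : Type*} [Category A'] [Preadditive A']

theorem AddClosure.of_iso {S : Set A} {X Y : A} (e : X ≅ Y) (h : AddClosure S X) :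
    AddClosure S Y := AddClosure.retract (Retract.ofIso e.symm) h

theorem AddClosure.map {S : Set A} {S' : Set A'} (T : A ⥤ A') [T.Additive]
    (h : ∀ X ∈ S, AddClosure S' (T.obj X)) {X : A} (hX : AddClosure S X) :
    AddClosure S' (T.obj X) := by
  induction hX with
  | of hX => exact h _ hX
  | zero hX => exact AddClosure.zero (T.map_isZero hX)
  | sum b hb _ _ h1 h2 =>
    have := preservesBinaryBiproducts_of_preservesBiproducts T
    exact AddClosure.sum (T.mapBinaryBicone b) (isBinaryBilimitOfPreserves T hb) h1 h2
  | retract r _ h => exact AddClosure.retract (r.map T) h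

theorem AddClosure.natTrans_app_eq_zero {S : Set A} {T T' : A ⥤ A'} [T.Additive]
    [T'.Additive] (τ : T ⟶ T') (h : ∀ X ∈ S, τ.app X = 0) {X : A} (hX : AddClosure S X) :
    τ.app X = 0 := by
  induction hX with
  | of hX => exact h _ hX
  | zero hX => exact (T.map_isZero hX).eq_of_src _ _
  | sum b hb _ _ h1 h2 =>
    rw [← Category.id_comp (τ.app b.pt), ← CategoryTheory.Functor.map_id, ← IsBilimit.binary_total hb,
      Functor.map_add, add_comp, Functor.map_comp, Functor.map_comp, Category.assoc,
      Category.assoc, τ.naturality, τ.naturality, h1, h2]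
    simp
  | @retract X Y r _ h =>
    rw [← Category.id_comp (τ.app X), ← CategoryTheory.Functor.map_id, ← r.retract,
      Functor.map_comp, Category.assoc, τ.naturality, reassoc_of% h, zero_comp, comp_zero]

theorem AddClosure.isZero {S : Set A} (h : ∀ X ∈ S, IsZero X) {X : A} (hX : AddClosure S X) :
    IsZero X := by
  rw [IsZero.iff_id_eq_zero]
  exact AddClosure.natTrans_app_eq_zero (𝟙 (𝟭 A))
    (fun X hX => (IsZero.iff_id_eq_zero X).mp (h X hX)) hX

end AddClosure

theorem act_map_epi {B : Type u} [Bicategory.{w, v} B] [PreadditiveBicategory B]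
    [AdditiveBicategory B] {i j l : B} (F : j ⟶ l) {X Y : RightFreyd (i ⟶ j)} (f : X ⟶ Y) [Epi f] :
    Epi ((act i F).map f) :=
  (act_isZero_cokernel_iff i F f).mp ((act i F).map_isZero (isZero_cokernel_of_epi f))

section Stable

variable {k : Type t} [Field k] {B : Type u} [Bicategory.{w, v} B] [PreadditiveBicategory B]
  [LinearBicategory k B] [AdditiveBicategory B]

/-- Evaluation at X is additive in the 1-morphism, so only the indecomposable summands of Y matter.
-/
theorem evalAt_mem_addClosure (hB : ∀ i j : B, IsKrullSchmidt k (i ⟶ j)) {i j l : B}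
    (X : RightFreyd (i ⟶ j)) (S : Set (RightFreyd (i ⟶ l))) (Y : j ⟶ l)
    (h : ∀ G : j ⟶ l, Indecomposable G → Nonempty (Retract G Y) →
      AddClosure S ((act i G).obj X)) : AddClosure S ((act i Y).obj X) := by
  induction Y using (hB j l).induction with
  | iso e ih =>
    refine AddClosure.of_iso ((evalAt X l).mapIso e) (ih fun G hG ⟨r⟩ => h G hG ⟨?_⟩)
    exact retractOfIso r e
  | zero Z hZ => exact AddClosure.zero ((evalAt X l).map_isZero hZ)
  | indec Z hZ => exact h Z hZ ⟨Retract.refl Z⟩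
  | sum Y Z hY hZ =>
    have := preservesBinaryBiproducts_of_preservesBiproducts (evalAt X l)
    refine AddClosure.sum ((evalAt X l).mapBinaryBicone (BinaryBiproduct.bicone Y Z))
      (isBinaryBilimitOfPreserves _ (BinaryBiproduct.isBilimit Y Z)) (hY fun G hG ⟨r⟩ => ?_)
      (hZ fun G hG ⟨r⟩ => ?_)
    · exact h G hG ⟨r.trans ⟨biprod.inl, biprod.fst, biprod.inl_fst⟩⟩
    · exact h G hG ⟨r.trans ⟨biprod.inr, biprod.snd, biprod.inr_snd⟩⟩

theorem act_isZero_of_indec (hB : ∀ i j : B, IsKrullSchmidt k (i ⟶ j)) {i j l : B}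
    (X : RightFreyd (i ⟶ j)) (Y : j ⟶ l)
    (h : ∀ G : j ⟶ l, Indecomposable G → Nonempty (Retract G Y) →
      IsZero ((act i G).obj X)) : IsZero ((act i Y).obj X) :=
  AddClosure.isZero (S := ∅) (by simp)
    (evalAt_mem_addClosure hB X ∅ Y fun G hG r => AddClosure.zero (h G hG r))

theorem cellStable_of (hB : ∀ i j : B, IsKrullSchmidt k (i ⟶ j)) {i : B} {R : Set (OneMor B)}
    {L : RightFreyd (i ⟶ i)}
    (h : ∀ {j l : B} (F : i ⟶ j) (H : j ⟶ l) (G : i ⟶ l), (⟨i, j, F⟩ : OneMor B) ∈ R →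
      Indecomposable G → Nonempty (Retract G (F ≫ H)) →
      IsZero ((act i G).obj L) ∨ (⟨i, l, G⟩ : OneMor B) ∈ R) : CellStable i R L := by
  intro j l H X hX
  obtain ⟨X₁, X₀, f, h₁, h₀, ⟨e⟩⟩ := hX
  have key : ∀ Y ∈ {X | ∃ F : i ⟶ j, (⟨i, j, F⟩ : OneMor B) ∈ R ∧ X = (act i F).obj L},
      AddClosure {X | ∃ F : i ⟶ l, (⟨i, l, F⟩ : OneMor B) ∈ R ∧ X = (act i F).obj L}
        ((act i H).obj Y) := by
    rintro _ ⟨F, hF, rfl⟩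
    refine AddClosure.of_iso ((actComp i F H).app L)
      (evalAt_mem_addClosure hB L _ (F ≫ H) fun G hG hr => ?_)
    rcases h F H G hF hG hr with hz | hm
    · exact AddClosure.zero hz
    · exact AddClosure.of ⟨G, hm, rfl⟩
  exact ⟨_, _, (act i H).map f, AddClosure.map (act i H) key h₁, AddClosure.map (act i H) key h₀,
    ⟨(PreservesCokernel.iso (act i H) f).symm ≪≫ (act i H).mapIso e⟩⟩

/-- The cell ideal is the smallest one that contains its generators, so it suffices that the
generating 1-morphisms send every H L to zero; this is tested on indecomposable summands. -/
theorem mem_annIdeal_of_cellIdeal (hB : ∀ i j : B, IsKrullSchmidt k (i ⟶ j)) {i : B}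
    {Q : Set (OneMor B)} {L : RightFreyd (i ⟶ i)}
    (h : ∀ {j l : B} (H : i ⟶ j) (F : j ⟶ l) (G : i ⟶ l), (∀ X ∈ Q, ¬ LeLR ⟨j, l, F⟩ X) →
      Indecomposable G → Nonempty (Retract G (H ≫ F)) → IsZero ((act i G).obj L))
    {j l : B} {F G : j ⟶ l} {α : F ⟶ G} (hα : α ∈ (cellIdeal k Q).carrier F G) :
    α ∈ (annIdeal k L).carrier F G := by
  refine (Submodule.mem_sInf.mp hα) _ ⟨annIdeal k L, fun X hX H => ?_, rfl⟩
  obtain ⟨j, l, X⟩ := X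
  have hz : IsZero ((act i X).obj ((act i H).obj L)) :=
    (act_isZero_of_indec hB L (H ≫ X) fun G hG hr => h H X G hX.2 hG hr).of_iso
      ((actComp i H X).symm.app L)
  exact hz.eq_of_src _ _

/-- A 2-morphism that vanishes on the F L vanishes on their additive closure, and then on cokernels
because the action preserves epimorphisms. -/
theorem cellAnnihilated_of {i : B} {R Q : Set (OneMor B)} {L : RightFreyd (i ⟶ i)}
    (hs : CellStable i R L)
    (h : ∀ {j l : B} {F G : j ⟶ l} {α : F ⟶ G}, α ∈ (cellIdeal k Q).carrier F G →
      α ∈ (annIdeal k L).carrier F G) : CellAnnihilated k Q i R L hs := by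
  intro j l F G α β hαβ
  have key : ∀ X : RightFreyd (i ⟶ j), cellProp i R L j X →
      (actHom i α).app X = (actHom i β).app X := by
    rintro X ⟨X₁, X₀, f, h₁, h₀, ⟨e⟩⟩
    have hsub : (actHom i (α - β)).app X = (actHom i α).app X - (actHom i β).app X :=
      (evalAt X l).map_sub
    rw [← sub_eq_zero, ← hsub]
    have h0 : (actHom i (α - β)).app X₀ = 0 :=
      AddClosure.natTrans_app_eq_zero (actHom i (α - β)) (by
        rintro _ ⟨H, hH, rfl⟩
        exact h hαβ H) h₀
    have hn := (actHom i (α - β)).naturality (cokernel.π f ≫ e.hom)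
    rw [h0, zero_comp] at hn
    have := act_map_epi F (cokernel.π f ≫ e.hom)
    exact (cancel_epi _).mp (hn.trans comp_zero.symm)
  apply Cat.Hom₂.ext; apply NatTrans.ext; funext X; apply ObjectProperty.hom_ext
  exact key X.obj X.property

end Stable

/-! ### The Duflo 1-morphism attached to L_R, and the morphisms between the objects F L. -/

section CellTop

variable {k : Type t} [Field k] {B : Type u} [Bicategory.{w, v} B] [PreadditiveBicategory B]
  [LinearBicategory k B] [AdditiveBicategory B]

/-- The data provided by an object `L_R`: a projective cover `P_G ⟶ L`, and a subobject `K` of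
`P_{𝟙 i}` with quotient `L` such that `F K = F P_{𝟙 i}` for all `F ∈ R`. -/
structure CellTop (i : B) (R : Set (OneMor B)) (L : RightFreyd (i ⟶ i)) where
  G : i ⟶ i
  indec : Indecomposable G
  simple : Simple L
  p : (RightFreyd.functor (i ⟶ i)).obj G ⟶ L
  p_ne : p ≠ 0
  K : RightFreyd (i ⟶ i)
  m : K ⟶ (RightFreyd.functor (i ⟶ i)).obj (𝟙 i)
  q : K ⟶ L
  epi_q : Epi q
  isIso_act {j : B} (F : i ⟶ j) : (⟨i, j, F⟩ : OneMor B) ∈ R → IsIso ((act i F).map m)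
  retract_act {j : B} (F : i ⟶ j) : (⟨i, j, F⟩ : OneMor B) ∈ R → Nonempty (Retract F (G ≫ F))
  act_ne {j : B} (F : i ⟶ j) : (⟨i, j, F⟩ : OneMor B) ∈ R → ¬ IsZero ((act i F).obj L)

theorem IsSimpleSubquotient.of_mono {A : Type*} [Category A] [HasZeroMorphisms A] {S N M : A}
    (h : IsSimpleSubquotient S N) (n : N ⟶ M) [Mono n] : IsSimpleSubquotient S M := by
  obtain ⟨hS, X, m, p, hm, hp⟩ := h
  exact ⟨hS, X, m ≫ n, p, mono_comp m n, hp⟩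

theorem IsSimpleSubquotient.of_epi {A : Type*} [Category A] [Abelian A] {S N M : A}
    (h : IsSimpleSubquotient S N) (e : M ⟶ N) [Epi e] : IsSimpleSubquotient S M := by
  obtain ⟨hS, X, m, p, hm, hp⟩ := h
  exact ⟨hS, pullback m e, pullback.snd m e, pullback.fst m e ≫ p, inferInstance, epi_comp _ _⟩

variable [hw : ∀ i j : B, HasWeakKernels (i ⟶ j)]

/-- Induction on length: a non-simple object is an extension of two shorter ones, and right
exactness of F is enough to pass from them to Z. -/
theorem act_isZero_of_simpleSubquotient (hB : ∀ i j : B, IsKrullSchmidt k (i ⟶ j)) {i j : B}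
    (F : i ⟶ j) (Z : RightFreyd (i ⟶ i))
    (h : ∀ S : RightFreyd (i ⟶ i), IsSimpleSubquotient S Z → IsZero ((act i F).obj S)) :
    IsZero ((act i F).obj Z) := by
  obtain ⟨d, hd, hd'⟩ := exists_length (hB i i)
  generalize hn : d Z = n
  induction n using Nat.strong_induction_on generalizing Z with
  | _ n ih =>
    by_cases hz : IsZero Z
    · exact (act i F).map_isZero hz
    by_cases hs : Simple Z
    · exact h Z ⟨hs, Z, 𝟙 Z, 𝟙 Z, inferInstance, inferInstance⟩
    obtain ⟨N, m, hm, hm0, hmi⟩ : ∃ (N : RightFreyd (i ⟶ i)) (m : N ⟶ Z), Mono m ∧ m ≠ 0 ∧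
        ¬ IsIso m := by
      by_contra hcon
      push Not at hcon
      refine hs ⟨fun {Y} f _ => ⟨fun hf h0 => hz ?_, fun h0 => hcon Y f inferInstance h0⟩⟩
      subst h0
      rw [IsZero.iff_id_eq_zero, ← cancel_epi (0 : Y ⟶ Z), zero_comp, zero_comp]
    have h1 := ih _ (hn ▸ hd m hmi) N (fun S hS => h S (hS.of_mono m)) rfl
    have hc : ¬ IsIso (cokernel.π m) := by
      intro hc
      refine hm0 ?_
      rw [← cancel_mono (cokernel.π m), cokernel.condition, zero_comp]
    have h2 := ih _ (hn ▸ hd' (cokernel.π m) hc) (cokernel m)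
      (fun S hS => h S (hS.of_epi (cokernel.π m))) rfl
    have := (act_isZero_cokernel_iff i F m).mp h2
    exact IsZero.of_epi ((act i F).map m) h1

/-- F kills P_𝟙/K, hence F K = F P_𝟙. The projective cover P_G of L covers K too, and applying F
gives an epimorphism of P_{G ≫ F} onto P_F, which splits. -/
theorem IsCellSimple.nonempty_cellTop (hB : ∀ i j : B, IsKrullSchmidt k (i ⟶ j)) {i : B}
    {R : Set (OneMor B)} (hadj : HasLeftAdjoints i R) {L : RightFreyd (i ⟶ i)}
    (h : IsCellSimple i R L) : Nonempty (CellTop i R L) := by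
  obtain ⟨K, (m : K ⟶ (RightFreyd.functor (i ⟶ i)).obj (𝟙 i)), hm, hann, ⟨hL, q, hq, htop⟩,
    ⟨G, hG, -, (p : (RightFreyd.functor (i ⟶ i)).obj G ⟶ L), hp, -⟩, hne⟩ := h
  have hp : Epi p := hp
  have hm : Mono m := hm
  have hp0 : p ≠ 0 := by
    intro h0
    refine Simple.not_isZero L ?_
    rw [IsZero.iff_id_eq_zero, ← cancel_epi p, h0, zero_comp, zero_comp]
  have hiso : ∀ {j : B} (F : i ⟶ j), (⟨i, j, F⟩ : OneMor B) ∈ R → IsIso ((act i F).map m) := by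
    intro j F hF
    obtain ⟨F', ⟨adj⟩⟩ := hadj F hF
    have := act_map_mono adj m
    have := (act_isZero_cokernel_iff i F m).mp
      (act_isZero_of_simpleSubquotient hB F _ fun S hS => hann S hS F hF)
    exact isIso_of_mono_of_epi _
  let P := (RightFreyd.functor (i ⟶ i)).obj G
  have : Projective P := freyd_projective G
  let s : P ⟶ K := Projective.factorThru (P := P) p q
  have hs : s ≫ q = p := Projective.factorThru_comp (P := P) p q
  -- The image of s is not contained in the kernel of q, so by the simple top property it is all of
  -- K.
  have hsepi : Epi s := by
    have : IsIso (Abelian.image.ι s) := htop _ (Abelian.image.ι s) (by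
      intro h0
      refine hp0 ?_
      rw [← hs, ← Abelian.image.fac s, Category.assoc, h0, comp_zero])
    rw [← Abelian.image.fac s]
    exact epi_comp _ _
  refine ⟨⟨G, hG, hL, p, hp0, K, m, q, hq, hiso, fun {j} F hF => ?_, hne⟩⟩
  have := hiso F hF
  let e : (RightFreyd.functor (i ⟶ j)).obj (G ≫ F) ⟶ (RightFreyd.functor (i ⟶ j)).obj F :=
    (actProj G F).inv ≫ (act i F).map s ≫ (act i F).map m ≫ (projIso F).inv
  have he : Epi e := by
    have := act_map_epi F s
    have h1 : Epi ((act i F).map m ≫ (projIso F).inv) := epi_comp _ _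
    have h2 : Epi ((act i F).map s ≫ (act i F).map m ≫ (projIso F).inv) := epi_comp _ _
    exact epi_comp _ _
  obtain ⟨a, ha⟩ := (RightFreyd.functor (i ⟶ j)).map_surjective (Projective.factorThru (𝟙 _) e)
  obtain ⟨b, hb⟩ := (RightFreyd.functor (i ⟶ j)).map_surjective e
  refine ⟨⟨a, b, (RightFreyd.functor (i ⟶ j)).map_injective ?_⟩⟩
  rw [Functor.map_comp, ha, hb, Projective.factorThru_comp, CategoryTheory.Functor.map_id]

namespace CellTop

variable {i : B} {R : Set (OneMor B)} {L : RightFreyd (i ⟶ i)} (T : CellTop i R L)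

/-- The projection of `P_F = F K` onto `F L`. -/
def π {j : B} (F : i ⟶ j) (hF : (⟨i, j, F⟩ : OneMor B) ∈ R) :
    (RightFreyd.functor (i ⟶ j)).obj F ⟶ (act i F).obj L :=
  have := T.isIso_act F hF
  (projIso F).hom ≫ inv ((act i F).map T.m) ≫ (act i F).map T.q

omit [LinearBicategory k B] in
theorem act_map_q_epi {j : B} (F : i ⟶ j) : Epi ((act i F).map T.q) := by
  have := T.epi_q
  infer_instance

omit [LinearBicategory k B] in
theorem π_epi {j : B} (F : i ⟶ j) (hF : (⟨i, j, F⟩ : OneMor B) ∈ R) : Epi (T.π F hF) := by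
  have := T.isIso_act F hF
  have := T.act_map_q_epi F
  unfold π
  infer_instance

omit [LinearBicategory k B] hw in
-- A need not belong to R, so A(m) need not be invertible and there may be no projection from P_A to
-- A L. Precomposing with A(m) gives the form of naturality that is still available.
theorem map_comp_π {j : B} {A F : i ⟶ j} (hF : (⟨i, j, F⟩ : OneMor B) ∈ R) (α : A ⟶ F) :
    (act i A).map T.m ≫ (projIso A).inv ≫ (RightFreyd.functor (i ⟶ j)).map α ≫ T.π F hF =
      (act i A).map T.q ≫ (actHom i α).app L := by
  have := T.isIso_act F hF
  have h1 := projIso_naturality α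
  have h2 := (actHom i α).naturality T.m
  have h3 := (actHom i α).naturality T.q
  have hπ : T.π F hF = (projIso F).hom ≫ inv ((act i F).map T.m) ≫ (act i F).map T.q := rfl
  rw [hπ, ← Category.assoc ((RightFreyd.functor (i ⟶ j)).map α), h1, Category.assoc,
    Iso.inv_hom_id_assoc, ← Category.assoc ((act i A).map T.m), h2, Category.assoc,
    IsIso.hom_inv_id_assoc, h3]

omit [LinearBicategory k B] hw in
theorem π_naturality {j : B} {F F' : i ⟶ j} (hF : (⟨i, j, F⟩ : OneMor B) ∈ R)
    (hF' : (⟨i, j, F'⟩ : OneMor B) ∈ R) (α : F ⟶ F') :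
    (RightFreyd.functor (i ⟶ j)).map α ≫ T.π F' hF' = T.π F hF ≫ (actHom i α).app L := by
  have := T.isIso_act F hF
  have h := T.map_comp_π hF' α
  have e : T.π F hF ≫ (actHom i α).app L =
      (projIso F).hom ≫ inv ((act i F).map T.m) ≫ (act i F).map T.q ≫ (actHom i α).app L := by
    simp [π]
  rw [e, ← h]
  simp

omit [LinearBicategory k B] in
theorem actHom_eq_zero {j : B} {A F : i ⟶ j} (hF : (⟨i, j, F⟩ : OneMor B) ∈ R) (α : A ⟶ F)
    (h : (RightFreyd.functor (i ⟶ j)).map α ≫ T.π F hF = 0) : (actHom i α).app L = 0 := by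
  have := T.act_map_q_epi A
  rw [← cancel_epi ((act i A).map T.q), ← T.map_comp_π hF α, h, comp_zero, comp_zero, comp_zero]

omit [LinearBicategory k B] in
theorem exists_map_comp_π {j : B} {A F : i ⟶ j} (hF : (⟨i, j, F⟩ : OneMor B) ∈ R)
    (f : (RightFreyd.functor (i ⟶ j)).obj A ⟶ (act i F).obj L) :
    ∃ α : A ⟶ F, (RightFreyd.functor (i ⟶ j)).map α ≫ T.π F hF = f := by
  have := T.π_epi F hF
  obtain ⟨α, hα⟩ := (RightFreyd.functor (i ⟶ j)).map_surjective
    (Projective.factorThru f (T.π F hF))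
  exact ⟨α, by rw [hα, Projective.factorThru_comp]⟩

include T in
omit [LinearBicategory k B] in
-- Lift the morphism from F L to F' L to the projectives P_F and P_{F'}; morphisms between
-- projectives are 2-morphisms. This gives fullness of the comparison functor.
theorem exists_actHom {j : B} {F F' : i ⟶ j} (hF : (⟨i, j, F⟩ : OneMor B) ∈ R)
    (hF' : (⟨i, j, F'⟩ : OneMor B) ∈ R) (f : (act i F).obj L ⟶ (act i F').obj L) :
    ∃ α : F ⟶ F', (actHom i α).app L = f := by
  have := T.π_epi F hF
  obtain ⟨α, hα⟩ := T.exists_map_comp_π hF' (T.π F hF ≫ f)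
  exact ⟨α, by rw [← cancel_epi (T.π F hF), ← hα, T.π_naturality hF hF']⟩

omit [LinearBicategory k B] in
-- A morphism P_F ⟶ F' L is induced by a 2-morphism, and 2-morphisms act compatibly on F L. Thus F L
-- behaves like a projective towards the other F' L.
theorem exists_factor {j : B} {F F' : i ⟶ j} (hF : (⟨i, j, F⟩ : OneMor B) ∈ R)
    (hF' : (⟨i, j, F'⟩ : OneMor B) ∈ R)
    (f : (RightFreyd.functor (i ⟶ j)).obj F ⟶ (act i F').obj L) :
    ∃ g : (act i F).obj L ⟶ (act i F').obj L, T.π F hF ≫ g = f := by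
  obtain ⟨α, hα⟩ := T.exists_map_comp_π hF' f
  exact ⟨(actHom i α).app L, by rw [← hα, T.π_naturality hF hF']⟩

/-- By adjunction the nonzero morphism P_H ⟶ X L becomes a nonzero morphism from X' P_H = P_{H ≫ X'}
to L, and P_G is the projective cover of L. -/
theorem nonempty_retract (hB : ∀ i j : B, IsKrullSchmidt k (i ⟶ j)) {j : B} {X : i ⟶ j}
    {X' : j ⟶ i} (adj : X' ⊣ X) {H : i ⟶ j}
    (f : (RightFreyd.functor (i ⟶ j)).obj H ⟶ (act i X).obj L) (hf : f ≠ 0) :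
    Nonempty (Retract T.G (H ≫ X')) := by
  have := T.simple
  refine nonempty_retract_of_ne_zero (hB i i) T.indec T.p T.p_ne
    ((actProj H X').inv ≫ ((actAdj i adj).homEquiv _ _).symm f) fun h => hf ?_
  have h : ((actAdj i adj).homEquiv _ _).symm f = 0 := by
    rwa [← cancel_epi ((actProj H X').inv), comp_zero]
  have e : f = ((actAdj i adj).homEquiv _ _) 0 := by rw [← h, Equiv.apply_symm_apply]
  rw [e, CategoryTheory.Adjunction.homEquiv_unit, Functor.map_zero, comp_zero]

theorem nonempty_retract_comp_adjoint (hB : ∀ i j : B, IsKrullSchmidt k (i ⟶ j)) {j : B}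
    {F : i ⟶ j} (hF : (⟨i, j, F⟩ : OneMor B) ∈ R) {F' : j ⟶ i} (adj : F' ⊣ F) :
    Nonempty (Retract T.G (F ≫ F')) := by
  refine T.nonempty_retract hB adj (T.π F hF) fun h => T.act_ne F hF ?_
  have := T.π_epi F hF
  rw [IsZero.iff_id_eq_zero, ← cancel_epi (T.π F hF), h, zero_comp, zero_comp]

theorem exists_retract_of_act_ne (hB : ∀ i j : B, IsKrullSchmidt k (i ⟶ j)) {j : B} {X : i ⟶ j}
    {X' : j ⟶ i} (adj : X' ⊣ X) (h : ¬ IsZero ((act i X).obj L)) :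
    ∃ H : i ⟶ j, Nonempty (Retract T.G (H ≫ X')) := by
  obtain ⟨H, f, hf⟩ := exists_ne_zero_of_not_isZero h
  exact ⟨H, T.nonempty_retract hB adj f hf⟩

/-- For F in R with left adjoint F', G is a summand of `F ≫ F'` and F is a summand of `G ≫ F`. -/
theorem mem (hB : ∀ i j : B, IsKrullSchmidt k (i ⟶ j)) (hR : IsRightCell R)
    (hi : ∀ F ∈ R, F.dom = i) (hadj : HasLeftAdjoints i R) : (⟨i, i, T.G⟩ : OneMor B) ∈ R := by
  obtain ⟨j, F, hF⟩ := hR.exists_mem hi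
  obtain ⟨F', ⟨adj⟩⟩ := hadj F hF
  exact hR.mem hF T.indec (leR_iff.mpr ⟨F', T.nonempty_retract_comp_adjoint hB hF adj⟩)
    (leR_iff.mpr ⟨F, T.retract_act F hF⟩)

end CellTop

end CellTop

end FiatCells

namespace FiatCells
open Preadditive

/-! ### Adjoints up to isomorphism, and the effect of the involution on the preorders. -/

section AdjunctionOfIso

variable {B : Type u} [Bicategory.{w, v} B]

/-- Replace the right adjoint by an isomorphic 1-morphism. -/
def adjunctionOfIsoRight {i j : B} {F : i ⟶ j} {G G' : j ⟶ i} (adj : F ⊣ G) (e : G ≅ G') :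
    F ⊣ G' where
  unit := adj.unit ≫ F ◁ e.hom
  counit := e.inv ▷ F ≫ adj.counit
  left_triangle := by
    have h := adj.left_triangle
    simp only [leftZigzag, bicategoricalComp] at h ⊢
    rw [← h]
    simp [BicategoricalCoherence.iso]
  right_triangle := by
    have h := adj.right_triangle
    rw [← cancel_epi (e.hom ▷ 𝟙 _)]
    calc e.hom ▷ 𝟙 i ≫ rightZigzag (adj.unit ≫ F ◁ e.hom) (e.inv ▷ F ≫ adj.counit)
        = (e.hom ▷ 𝟙 i ≫ G' ◁ adj.unit) ⊗≫ (G' ≫ F) ◁ e.hom ⊗≫ (e.inv ▷ F ≫ adj.counit) ▷ G' := by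
          bicategory
      _ = G ◁ adj.unit ⊗≫ e.hom ▷ (F ≫ G) ⊗≫ ((G' ≫ F) ◁ e.hom ≫ (e.inv ▷ F ≫ adj.counit) ▷ G') := by
          rw [← whisker_exchange]; bicategory
      _ = G ◁ adj.unit ⊗≫ ((e.hom ≫ e.inv) ▷ (F ≫ G)) ⊗≫ adj.counit ▷ G ⊗≫ (𝟙 j ◁ e.hom) := by
          rw [whisker_exchange]; bicategory
      _ = rightZigzag adj.unit adj.counit ≫ 𝟙 _ ◁ e.hom := by
          rw [e.hom_inv_id]; bicategory
      _ = _ := by rw [h]; simp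

end AdjunctionOfIso

section Star

variable {B : Type u} [Bicategory.{w, v} B] (S : Involution B)

theorem Involution.starHom_injective {i j : B} {F G : i ⟶ j} {η θ : F ⟶ G}
    (h : S.starHom η = S.starHom θ) : η = θ := by
  rw [← cancel_epi (S.invol F).hom, ← S.invol_naturality, ← S.invol_naturality, h]

/-- The involution, applied to a retract. -/
def Involution.starRetract {i j : B} {F G : i ⟶ j} (r : Retract F G) :
    Retract (S.star F) (S.star G) where
  i := S.starHom r.r
  r := S.starHom r.i
  retract := by rw [← S.starHom_comp, r.retract, S.starHom_id]

/-- The involution on 1-morphisms with their source and target. -/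
def Involution.starMor (F : OneMor B) : OneMor B := ⟨F.cod, F.dom, S.star F.mor⟩

theorem Iso₁.leR {F G : OneMor B} (h : Iso₁ F G) : LeR F G := by
  cases h with
  | mk e => exact LeR.mk (𝟙 _) (retractOfIso (Retract.ofIso e.symm) (ρ_ _).symm)

theorem Iso₁.leL {F G : OneMor B} (h : Iso₁ F G) : LeL F G := by
  cases h with
  | mk e => exact LeL.mk (𝟙 _) (retractOfIso (Retract.ofIso e.symm) (λ_ _).symm)

theorem Iso₁.symm {F G : OneMor B} (h : Iso₁ F G) : Iso₁ G F := by
  cases h with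
  | mk e => exact ⟨e.symm⟩

theorem Iso₁.trans {F G H : OneMor B} (h : Iso₁ F G) (h' : Iso₁ G H) : Iso₁ F H := by
  cases h with
  | mk e =>
    cases h' with
    | mk e' => exact ⟨e ≪≫ e'⟩

theorem Involution.starMor_starMor (F : OneMor B) : Iso₁ (S.starMor (S.starMor F)) F :=
  ⟨S.invol F.mor⟩

theorem LeR.star {F G : OneMor B} (h : LeR F G) : LeL (S.starMor F) (S.starMor G) := by
  cases h with
  | mk H r => exact LeL.mk (S.star H) (retractOfIso (S.starRetract r) (S.starComp _ _))

theorem LeL.star {F G : OneMor B} (h : LeL F G) : LeR (S.starMor F) (S.starMor G) := by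
  cases h with
  | mk H r => exact LeR.mk (S.star H) (retractOfIso (S.starRetract r) (S.starComp _ _))

theorem LeLR.star {F G : OneMor B} (h : LeLR F G) : LeLR (S.starMor F) (S.starMor G) := by
  cases h with
  | mk H₁ H₂ r =>
    exact LeLR.mk (S.star H₂) (S.star H₁) (retractOfIso (S.starRetract r)
      (S.starComp _ _ ≪≫ whiskerRightIso (S.starComp _ _) _ ≪≫ α_ _ _ _))

theorem LeL.of_star {F G : OneMor B} (h : LeL (S.starMor F) G) : LeR F (S.starMor G) :=
  (S.starMor_starMor F).symm.leR.trans (h.star S)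

theorem LeR.of_star_star {F G : OneMor B} (h : LeR (S.starMor F) (S.starMor G)) : LeL F G :=
  ((S.starMor_starMor F).symm.leL.trans (h.star S)).trans (S.starMor_starMor G).leL

variable [PreadditiveBicategory B] [AdditiveBicategory B]

omit [AdditiveBicategory B] in
theorem Involution.star_isZero {i j : B} {F : i ⟶ j} (h : IsZero F) : IsZero (S.star F) := by
  rw [IsZero.iff_id_eq_zero]
  exact S.starHom_injective ((h.of_iso (S.invol F)).eq_of_src _ _)

/-- Additivity is not part of the definition of the involution; zero 2-morphisms are preserved
because they factor through a zero object. -/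
theorem Involution.starHom_zero {i j : B} (F G : i ⟶ j) : S.starHom (0 : F ⟶ G) = 0 := by
  have h0 : IsZero (HasZeroObject.zero' (i ⟶ j)).zero := isZero_zero _
  have : (0 : F ⟶ G) = (0 : F ⟶ (HasZeroObject.zero' (i ⟶ j)).zero) ≫ 0 := zero_comp.symm
  rw [this, S.starHom_comp]
  rw [(S.star_isZero h0).eq_of_src (S.starHom (0 : F ⟶ (HasZeroObject.zero' (i ⟶ j)).zero)) 0, comp_zero]

/-- The argument goes through idempotents, since functoriality transports these without any
additivity: an idempotent of F* becomes one of F** ≅ F, where it is trivial. -/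
theorem Involution.star_indec {i j : B} [IsIdempotentComplete (i ⟶ j)] {F : i ⟶ j}
    (hF : Indecomposable F) :
    Indecomposable (S.star F) := by
  have key : ∀ e : S.star F ⟶ S.star F, e ≫ e = e → e = 0 ∨ e = 𝟙 _ := by
    intro e he
    have he' := congrArg S.starHom he
    rw [S.starHom_comp] at he'
    rcases idempotent_trivial_of_indecomposable hF
      ((S.invol F).inv ≫ S.starHom e ≫ (S.invol F).hom) (by
        simp only [Category.assoc, Iso.hom_inv_id_assoc, reassoc_of% he']) with h | h
    · left
      apply S.starHom_injective
      rw [S.starHom_zero, ← cancel_epi (S.invol F).inv, ← cancel_mono (S.invol F).hom]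
      simpa using h
    · right
      apply S.starHom_injective
      rw [S.starHom_id, ← cancel_epi (S.invol F).inv, ← cancel_mono (S.invol F).hom]
      simpa using h
  refine ⟨fun h => hF.1 ((S.star_isZero h).of_iso (S.invol F).symm), fun Y Z f => ?_⟩
  rcases key (f.hom ≫ biprod.fst ≫ biprod.inl ≫ f.inv) (by simp) with h | h
  · left
    rw [IsZero.iff_id_eq_zero]
    have := congrArg (fun x => biprod.inl ≫ f.inv ≫ x ≫ f.hom ≫ biprod.fst) h
    simpa using this
  · right
    rw [IsZero.iff_id_eq_zero]
    have := congrArg (fun x => biprod.inr ≫ f.inv ≫ x ≫ f.hom ≫ biprod.snd) h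
    simpa using this.symm

end Star

/-! ### Regularity and strong regularity of two-sided cells. -/

section TwoSided

variable {B : Type u} [Bicategory.{w, v} B] [PreadditiveBicategory B] [AdditiveBicategory B]
  {Q : Set (OneMor B)}

theorem IsTwoSidedCell.indec (hQ : IsTwoSidedCell Q) {F : OneMor B} (hF : F ∈ Q) : F.Indec := by
  obtain ⟨F₀, -, rfl⟩ := hQ
  exact hF.1

theorem IsTwoSidedCell.leLR (hQ : IsTwoSidedCell Q) {F G : OneMor B} (hF : F ∈ Q) (hG : G ∈ Q) :
    LeLR F G := by
  obtain ⟨F₀, -, rfl⟩ := hQ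
  exact hF.2.2.trans hG.2.1

theorem IsTwoSidedCell.mem (hQ : IsTwoSidedCell Q) {F G : OneMor B} (hF : F ∈ Q) (hG : G.Indec)
    (h₁ : LeLR F G) (h₂ : LeLR G F) : G ∈ Q := by
  obtain ⟨F₀, -, rfl⟩ := hQ
  exact ⟨hG, hF.2.1.trans h₁, h₂.trans hF.2.2⟩

theorem IsTwoSidedCell.nonempty (hQ : IsTwoSidedCell Q) : ∃ F, F ∈ Q := by
  obtain ⟨F₀, h, rfl⟩ := hQ
  exact ⟨F₀, h, (LeR.refl _).leLR, (LeR.refl _).leLR⟩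

theorem IsTwoSidedCell.rightCell_subset (hQ : IsTwoSidedCell Q) {F : OneMor B} (hF : F ∈ Q) :
    rightCell F ⊆ Q := fun _ hG => hQ.mem hF hG.1 hG.2.1.leLR hG.2.2.leLR

theorem IsTwoSidedCell.leftCell_subset (hQ : IsTwoSidedCell Q) {F : OneMor B} (hF : F ∈ Q) :
    leftCell F ⊆ Q := fun _ hG => hQ.mem hF hG.1 hG.2.1.leLR hG.2.2.leLR

theorem IsRegular.leR_symm (hreg : IsRegular Q) (hQ : IsTwoSidedCell Q) {F G : OneMor B}
    (hF : F ∈ Q) (hG : G ∈ Q) (h : LeR F G) : LeR G F := by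
  by_contra hcon
  refine hreg (rightCell F) (rightCell G) ⟨F, hQ.indec hF, rfl⟩ ⟨G, hQ.indec hG, rfl⟩
    (hQ.rightCell_subset hF) (hQ.rightCell_subset hG) (fun he => ?_) F
    (mem_rightCell_self (hQ.indec hF)) G (mem_rightCell_self (hQ.indec hG)) h
  have := mem_rightCell_self (hQ.indec hF)
  rw [he] at this
  exact hcon this.2.1

theorem IsStronglyRegular.exists_leR_leL (hreg : IsStronglyRegular Q) (hQ : IsTwoSidedCell Q)
    {F G : OneMor B} (hF : F ∈ Q) (hG : G ∈ Q) :
    ∃ H ∈ Q, (LeR F H ∧ LeR H F) ∧ LeL H G ∧ LeL G H := by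
  obtain ⟨H, hH, -⟩ := hreg.2 (leftCell G) (rightCell F) ⟨G, hQ.indec hG, rfl⟩
    ⟨F, hQ.indec hF, rfl⟩ (hQ.leftCell_subset hG) (hQ.rightCell_subset hF)
  exact ⟨H, hQ.leftCell_subset hG hH.1, hH.2.2, hH.1.2.2, hH.1.2.1⟩

theorem IsStronglyRegular.iso₁ (hreg : IsStronglyRegular Q) (hQ : IsTwoSidedCell Q)
    {F G : OneMor B} (hF : F ∈ Q) (hG : G ∈ Q) (h₁ : LeR F G) (h₂ : LeR G F) (h₃ : LeL F G)
    (h₄ : LeL G F) : Iso₁ F G := by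
  obtain ⟨H, -, hH⟩ := hreg.2 (leftCell F) (rightCell F) ⟨F, hQ.indec hF, rfl⟩
    ⟨F, hQ.indec hF, rfl⟩ (hQ.leftCell_subset hF) (hQ.rightCell_subset hF)
  exact (hH F ⟨⟨hQ.indec hF, LeL.refl _, LeL.refl _⟩, mem_rightCell_self (hQ.indec hF)⟩).trans
    (hH G ⟨⟨hQ.indec hG, h₃, h₄⟩, hQ.indec hG, h₁, h₂⟩).symm

end TwoSided

end FiatCells

namespace FiatCells
open Preadditive

/-! ### Consequences of adjunction and involution: the Duflo property, stability of Q under *, the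
cell ideal. -/

section Fiat

variable {k : Type t} [Field k] {B : Type u} [Bicategory.{w, v} B] [PreadditiveBicategory B]
  [LinearBicategory k B] [AdditiveBicategory B] [hw : ∀ i j : B, HasWeakKernels (i ⟶ j)]
  [hidem : ∀ i j : B, IsIdempotentComplete (i ⟶ j)]
  (hB : ∀ i j : B, IsKrullSchmidt k (i ⟶ j)) (S : Involution B)
  (hS : ∀ {i j : B} (F : i ⟶ j), Nonempty (F ⊣ S.star F))

omit [PreadditiveBicategory B] [LinearBicategory k B] [AdditiveBicategory B] hw hidem in
include hS in
-- Apply the hypothesis to F* and use F** ≅ F: the 1-morphism F* is also a left adjoint of F.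
theorem Involution.star_adj {i j : B} (F : i ⟶ j) : Nonempty (S.star F ⊣ F) := by
  obtain ⟨adj⟩ := hS (S.star F)
  exact ⟨adjunctionOfIsoRight adj (S.invol F)⟩

omit [PreadditiveBicategory B] [LinearBicategory k B] [AdditiveBicategory B] hw hidem in
include hS in
theorem Involution.hasLeftAdjoints (i : B) (R : Set (OneMor B)) : HasLeftAdjoints i R :=
  fun F _ => ⟨S.star F, S.star_adj hS F⟩

omit hw in
theorem Involution.starMor_indec {F : OneMor B} (hF : F.Indec) : (S.starMor F).Indec :=
  S.star_indec hF

include hB hS in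
omit hidem in
/-- In each right cell there is `G` which is a direct summand of `F ≫ F*` for all elements `F`. -/
theorem exists_duflo {R : Set (OneMor B)} (hR : IsRightCell R) {i : B} (hi : ∀ F ∈ R, F.dom = i) :
    ∃ G : i ⟶ i, (⟨i, i, G⟩ : OneMor B) ∈ R ∧
      ∀ {j : B} (F : i ⟶ j), (⟨i, j, F⟩ : OneMor B) ∈ R →
        Nonempty (Retract G (F ≫ S.star F)) ∧ Nonempty (Retract F (G ≫ F)) := by
  obtain ⟨L, hL⟩ := exists_isCellSimple hB hR hi (S.hasLeftAdjoints hS i R)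
  obtain ⟨T⟩ := hL.nonempty_cellTop hB (S.hasLeftAdjoints hS i R)
  refine ⟨T.G, T.mem hB hR hi (S.hasLeftAdjoints hS i R), fun F hF => ⟨?_, T.retract_act F hF⟩⟩
  obtain ⟨adj⟩ := S.star_adj hS F
  exact T.nonempty_retract_comp_adjoint hB hF adj

omit [LinearBicategory k B] hw hidem in
theorem rightCell_dom {F G : OneMor B} (h : G ∈ rightCell F) : G.dom = F.dom := by
  cases h.2.1
  rfl

include hB hS in
-- The Duflo 1-morphism G of the right cell of F is a summand of `G ≫ G*`, so G* ≤_L G; the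
-- involution turns this into G ≤_R G*. Hence G* lies in Q, and the other elements follow because *
-- preserves ≤_LR.
theorem starMor_mem {Q : Set (OneMor B)} (hQ : IsTwoSidedCell Q) {F : OneMor B} (hF : F ∈ Q) :
    S.starMor F ∈ Q := by
  obtain ⟨G, hG, h⟩ := exists_duflo hB S hS ⟨F, hQ.indec hF, rfl⟩ fun G hG => rightCell_dom hG
  obtain ⟨⟨r⟩, -⟩ := h G hG
  have h1 : LeL (S.starMor ⟨_, _, G⟩) ⟨_, _, G⟩ := LeL.mk G r
  have h2 : LeR ⟨_, _, G⟩ (S.starMor ⟨_, _, G⟩) := h1.of_star S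
  have hGQ := hQ.rightCell_subset hF hG
  have h3 : S.starMor ⟨_, _, G⟩ ∈ Q :=
    hQ.mem hGQ (S.starMor_indec (hQ.indec hGQ)) h2.leLR h1.leLR
  exact hQ.mem h3 (S.starMor_indec (hQ.indec hF)) ((hQ.leLR hGQ hF).star S)
    ((hQ.leLR hF hGQ).star S)

include hB hS in
omit hidem in
-- With D the Duflo 1-morphism, G is a summand of `D ≫ G` and D of `F ≫ F*`. The gain over the
-- definition of ≤_R is an explicit multiplier `F* ≫ G`, which belongs to C_Q when F and G are in Q.
theorem nonempty_retract_of_leR {i j l : B} {F : i ⟶ j} {G : i ⟶ l} (hF : Indecomposable F)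
    (hG : Indecomposable G) (h₁ : LeR ⟨i, j, F⟩ ⟨i, l, G⟩) (h₂ : LeR ⟨i, l, G⟩ ⟨i, j, F⟩) :
    Nonempty (Retract G (F ≫ S.star F ≫ G)) := by
  obtain ⟨D, hD, h⟩ := exists_duflo hB S hS ⟨⟨i, j, F⟩, hF, rfl⟩ fun G hG => rightCell_dom hG
  obtain ⟨⟨r⟩, -⟩ := h F (mem_rightCell_self hF)
  obtain ⟨-, ⟨r'⟩⟩ := h G ⟨hG, h₁, h₂⟩
  exact ⟨retractOfIso (r'.trans (retractWhiskerRight r G)) (α_ _ _ _)⟩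

include hB hS in
theorem nonempty_retract_of_leL {i j l : B} {F : j ⟶ i} {G : l ⟶ i} (hF : Indecomposable F)
    (hG : Indecomposable G) (h₁ : LeL ⟨j, i, F⟩ ⟨l, i, G⟩) (h₂ : LeL ⟨l, i, G⟩ ⟨j, i, F⟩) :
    Nonempty (Retract G ((G ≫ S.star F) ≫ F)) := by
  obtain ⟨r⟩ := nonempty_retract_of_leR hB S hS (S.star_indec hF) (S.star_indec hG)
    (h₁.star S) (h₂.star S)
  refine ⟨(Retract.ofIso (S.invol G).symm).trans (retractOfIso (S.starRetract r) ?_)⟩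
  exact S.starComp _ _ ≪≫ whiskerRightIso (S.starComp _ _) _ ≪≫
    whiskerLeftIso _ (S.invol F) ≪≫
    whiskerRightIso (whiskerRightIso (S.invol G) _ ≪≫ whiskerLeftIso _ (S.invol (S.star F))) _

include hB hS in
theorem leL_symm {Q : Set (OneMor B)} (hQ : IsTwoSidedCell Q) (hreg : IsRegular Q)
    {F G : OneMor B} (hF : F ∈ Q) (hG : G ∈ Q) (h : LeL F G) : LeL G F :=
  (hreg.leR_symm hQ (starMor_mem hB S hS hQ hF) (starMor_mem hB S hS hQ hG)
    (h.star S)).of_star_star S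

include hB hS in
-- Both F and G are ≥_L G*, so regularity puts them in the left cell of G*. They also share a right
-- cell, and a left and a right cell of Q meet in only one element up to isomorphism.
theorem iso₁_of_retract {Q : Set (OneMor B)} (hQ : IsTwoSidedCell Q) (hreg : IsStronglyRegular Q)
    {i : B} {F G : i ⟶ i} (hF : (⟨i, i, F⟩ : OneMor B) ∈ Q) (hG : (⟨i, i, G⟩ : OneMor B) ∈ Q)
    (h₁ : LeR ⟨i, i, F⟩ ⟨i, i, G⟩) (r : Retract F (G ≫ S.star G)) (r' : Retract G (G ≫ S.star G)) :
    Iso₁ ⟨i, i, F⟩ ⟨i, i, G⟩ := by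
  have h2 : LeL (S.starMor ⟨i, i, G⟩) ⟨i, i, F⟩ := LeL.mk G r
  have h3 : LeL (S.starMor ⟨i, i, G⟩) ⟨i, i, G⟩ := LeL.mk G r'
  have hs := starMor_mem hB S hS hQ hG
  exact hreg.iso₁ hQ hF hG h₁ (hreg.1.leR_symm hQ hF hG h₁)
    ((leL_symm hB S hS hQ hreg.1 hs hF h2).trans h3)
    ((leL_symm hB S hS hQ hreg.1 hs hG h3).trans h2)

section CellTop

variable {Q : Set (OneMor B)} (hQ : IsTwoSidedCell Q) {R : Set (OneMor B)} (hR : IsRightCell R)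
  (hRQ : R ⊆ Q) {i : B} (hi : ∀ F ∈ R, F.dom = i) {L : RightFreyd (i ⟶ i)} (T : CellTop i R L)

include hB hS hQ hR hRQ hi T

/-- If X L is nonzero, the Duflo 1-morphism G is a summand of some `H ≫ X*`, so X* ≤_L G and X ≤_R
G*, with G* in Q. Thus only 1-morphisms below Q can act nontrivially on L. -/
theorem leLR_of_act_ne {j : B} {X : i ⟶ j} (h : ¬ IsZero ((act i X).obj L)) {F : OneMor B}
    (hF : F ∈ Q) : LeLR ⟨i, j, X⟩ F := by
  obtain ⟨adj⟩ := S.star_adj hS X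
  obtain ⟨H, ⟨r⟩⟩ := T.exists_retract_of_act_ne hB adj h
  have h1 : LeL (S.starMor ⟨i, j, X⟩) ⟨i, i, T.G⟩ := LeL.mk H r
  have hG := hRQ (T.mem hB hR hi (S.hasLeftAdjoints hS i R))
  exact (h1.of_star S).leLR.trans (hQ.leLR (starMor_mem hB S hS hQ hG) hF)

/-- A summand G of `F ≫ H` that does not kill L lies between F and Q for ≤_LR, hence in Q; it is ≥_R
F, so regularity places it in R. -/
theorem cellStable (hreg : IsRegular Q) : CellStable i R L :=
  cellStable_of hB fun {j l} F H G hF hG ⟨r⟩ => by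
    by_cases hz : IsZero ((act i G).obj L)
    · exact Or.inl hz
    · right
      have h1 : LeR ⟨i, j, F⟩ ⟨i, l, G⟩ := LeR.mk H r
      have hGQ : (⟨i, l, G⟩ : OneMor B) ∈ Q := hQ.mem (hRQ hF) hG h1.leLR
        (leLR_of_act_ne hB S hS hQ hR hRQ hi T hz (hRQ hF))
      exact hR.mem hF hG h1 (hreg.leR_symm hQ (hRQ hF) hGQ h1)

theorem mem_annIdeal {j l : B} {F G : j ⟶ l} {α : F ⟶ G} (hα : α ∈ (cellIdeal k Q).carrier F G) :
    α ∈ (annIdeal k L).carrier F G :=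
  mem_annIdeal_of_cellIdeal hB (fun H F G hF _ ⟨r⟩ => by
    by_contra hz
    obtain ⟨X, hX⟩ := hQ.nonempty
    exact hF X hX ((LeL.mk H r).leLR.trans (leLR_of_act_ne hB S hS hQ hR hRQ hi T hz hX))) hα

theorem cellAnnihilated (h : CellStable i R L) : CellAnnihilated k Q i R L h :=
  cellAnnihilated_of h fun hα => mem_annIdeal hB S hS hQ hR hRQ hi T hα

end CellTop

include hB hS in
-- Test on L_R for the right cell R of F itself: the ideal acts by zero on it, but F L_R is nonzero.
theorem id_notMem_cellIdeal {Q : Set (OneMor B)} (hQ : IsTwoSidedCell Q) {i j : B} {F : i ⟶ j}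
    (hF : (⟨i, j, F⟩ : OneMor B) ∈ Q) : 𝟙 F ∉ (cellIdeal k Q).carrier F F := by
  intro h
  have hR : IsRightCell (rightCell (⟨i, j, F⟩ : OneMor B)) := ⟨_, hQ.indec hF, rfl⟩
  have hi : ∀ G ∈ rightCell (⟨i, j, F⟩ : OneMor B), G.dom = i := fun G hG => rightCell_dom hG
  obtain ⟨L, hL⟩ := exists_isCellSimple hB hR hi (S.hasLeftAdjoints hS i _)
  obtain ⟨T⟩ := hL.nonempty_cellTop hB (S.hasLeftAdjoints hS i _)
  have h0 := mem_annIdeal hB S hS hQ hR (hQ.rightCell_subset hF) hi T h (𝟙 i)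
  rw [actHom_id, ← IsZero.iff_id_eq_zero] at h0
  exact T.act_ne F (mem_rightCell_self (hQ.indec hF))
    (h0.of_iso ((act i F).mapIso ((actId i i).app L).symm))

include hB in
omit hw hidem in
-- Were `𝟙 F - f` invertible, the identity of F would lie in J. This is the lifting principle modulo
-- ideals: retracts, isomorphisms and cell relations are all lifted through it.
theorem isIso_of_sub_mem (J : TwoIdeal k B) {i j : B} {F : i ⟶ j} (hF : Indecomposable F)
    (h : 𝟙 F ∉ J.carrier F F) {f : F ⟶ F} (hf : f - 𝟙 F ∈ J.carrier F F) : IsIso f := by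
  refine ((hB i j).local_end hF f).resolve_right fun h1 => h ?_
  have h2 := J.postcomp_mem (inv (𝟙 F - f)) ((J.carrier F F).neg_mem hf)
  rwa [neg_sub, IsIso.hom_inv_id] at h2

include hB in
omit hw hidem in
theorem nonempty_retract_of_proj (J : TwoIdeal k B) {i j : B} {F G : i ⟶ j} (hF : Indecomposable F)
    (h : 𝟙 F ∉ J.carrier F F) (r : Retract ((J.proj i j).obj F) ((J.proj i j).obj G)) :
    Nonempty (Retract F G) := by
  obtain ⟨a, ha⟩ := (J.proj i j).map_surjective r.i
  obtain ⟨b, hb⟩ := (J.proj i j).map_surjective r.r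
  refine retract_of_isIso a b (isIso_of_sub_mem hB J hF h ?_)
  have e : (J.proj i j).map (a ≫ b) = (J.proj i j).map (𝟙 F) := by
    rw [Functor.map_comp, ha, hb, r.retract, CategoryTheory.Functor.map_id]
  exact (CategoryTheory.Quotient.functor_map_eq_iff _ _ _).mp e

end Fiat

end FiatCells

namespace FiatCells
open Preadditive

theorem indecomposable_of_local {V : Type*} [Category V] [Preadditive V] [HasBinaryBiproducts V]
    {X : V} (hX : ¬ IsZero X) (h : ∀ f : X ⟶ X, IsIso f ∨ IsIso (𝟙 X - f)) : Indecomposable X := by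
  refine ⟨hX, fun Y Z e => ?_⟩
  have h1 : (e.hom ≫ biprod.fst ≫ biprod.inl ≫ e.inv) ≫ e.hom ≫ biprod.snd = 0 := by simp
  have h2 : (𝟙 X - e.hom ≫ biprod.fst ≫ biprod.inl ≫ e.inv) ≫ e.hom ≫ biprod.fst = 0 := by
    simp [sub_comp]
  rcases h (e.hom ≫ biprod.fst ≫ biprod.inl ≫ e.inv) with hi | hi
  · right
    have h3 : e.hom ≫ biprod.snd = 0 := by rwa [← cancel_epi (e.hom ≫ biprod.fst ≫ biprod.inl ≫ e.inv), comp_zero]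
    rw [IsZero.iff_id_eq_zero, ← biprod.inr_snd (X := Y), ← e.inv_hom_id_assoc (biprod.snd), h3,
      comp_zero, comp_zero]
  · left
    have h3 : e.hom ≫ biprod.fst = 0 := by
      rwa [← cancel_epi (𝟙 X - e.hom ≫ biprod.fst ≫ biprod.inl ≫ e.inv), comp_zero]
    rw [IsZero.iff_id_eq_zero, ← biprod.inl_fst (Y := Z), ← e.inv_hom_id_assoc (biprod.fst), h3,
      comp_zero, comp_zero]

theorem indecomposable_of_iso {V : Type*} [Category V] [Preadditive V] [HasBinaryBiproducts V]
    {X Y : V} (e : X ≅ Y) (h : Indecomposable X) : Indecomposable Y :=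
  ⟨fun hY => h.1 (hY.of_iso e), fun A B f => h.2 A B (e ≪≫ f)⟩

/-! ### Lifting 1-morphisms and 2-morphisms from C_Q to C; C_Q is Krull–Schmidt. -/

section Gen

variable (k : Type t) [Field k] {B : Type u} [Bicategory.{w, v} B] [PreadditiveBicategory B]
  [LinearBicategory k B] [AdditiveBicategory B] (Q : Set (OneMor B))

/-- The image of `F` in the quotient by `cellIdeal k Q` belongs to the 2-category associated
with `Q`. -/
def IsGen {i j : B} (F : i ⟶ j) : Prop :=
  Gen ((cellIdeal k Q).toQuot '' Q) (((cellIdeal k Q).proj i j).obj F)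

variable {k Q}

theorem IsGen.of_mem {i j : B} {F : i ⟶ j} (h : (⟨i, j, F⟩ : OneMor B) ∈ Q) : IsGen k Q F :=
  Gen.mem ⟨_, h, rfl⟩

theorem IsGen.comp {i j l : B} {F : i ⟶ j} {G : j ⟶ l} (hF : IsGen k Q F) (hG : IsGen k Q G) :
    IsGen k Q (F ≫ G) := Gen.comp hF hG

theorem IsGen.retract {i j : B} {F G : i ⟶ j} (r : Retract F G) (hG : IsGen k Q G) :
    IsGen k Q F := Gen.retract (r.map ((cellIdeal k Q).proj i j)) hG

/-- A 1-morphism whose image belongs to the 2-category associated with `Q`. -/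
def genObj {i j : B} (F : i ⟶ j) (h : IsGen k Q F) : cellObj k Q i ⟶ cellObj k Q j :=
  ⟨((cellIdeal k Q).proj i j).obj F, h⟩

theorem exists_genObj {i j : B} (X : cellObj k Q i ⟶ cellObj k Q j) :
    ∃ (F : i ⟶ j) (h : IsGen k Q F), X = genObj F h := ⟨X.obj.as, X.property, rfl⟩

/-- The image of a 2-morphism. -/
def genHom {i j : B} {F G : i ⟶ j} (hF : IsGen k Q F) (hG : IsGen k Q G) (α : F ⟶ G) :
    genObj F hF ⟶ genObj G hG := ObjectProperty.homMk (((cellIdeal k Q).proj i j).map α)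

section

variable {i j : B} {F G H : i ⟶ j} (hF : IsGen k Q F) (hG : IsGen k Q G) (hH : IsGen k Q H)

theorem genHom_surjective (f : genObj F hF ⟶ genObj G hG) : ∃ α, genHom hF hG α = f := by
  obtain ⟨α, hα⟩ := ((cellIdeal k Q).proj i j).map_surjective f.hom
  exact ⟨α, ObjectProperty.hom_ext _ hα⟩

theorem genHom_id : genHom hF hF (𝟙 F) = 𝟙 _ :=
  ObjectProperty.hom_ext _ (((cellIdeal k Q).proj i j).map_id F)

theorem genHom_comp (α : F ⟶ G) (β : G ⟶ H) :
    genHom hF hH (α ≫ β) = genHom hF hG α ≫ genHom hG hH β :=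
  ObjectProperty.hom_ext _ (((cellIdeal k Q).proj i j).map_comp α β)

theorem genHom_add (α β : F ⟶ G) : genHom hF hG (α + β) = genHom hF hG α + genHom hF hG β := rfl

theorem genHom_smul (c : k) (α : F ⟶ G) : genHom hF hG (c • α) = c • genHom hF hG α := rfl

theorem genHom_eq_iff (α β : F ⟶ G) :
    genHom hF hG α = genHom hF hG β ↔ α - β ∈ (cellIdeal k Q).carrier F G :=
  ⟨fun h => (CategoryTheory.Quotient.functor_map_eq_iff ((cellIdeal k Q).rel i j) α β).mp
    (congrArg (fun f : genObj F hF ⟶ genObj G hG => f.hom) h),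
    fun h => ObjectProperty.hom_ext _ ((cellIdeal k Q).proj_map_eq h)⟩

/-- `genHom` as a linear map. -/
def genHomLinear : (F ⟶ G) →ₗ[k] (genObj F hF ⟶ genObj G hG) where
  toFun := genHom hF hG
  map_add' := genHom_add hF hG
  map_smul' := genHom_smul hF hG

/-- The image of an isomorphism. -/
def genIso (e : F ≅ G) : genObj F hF ≅ genObj G hG where
  hom := genHom hF hG e.hom
  inv := genHom hG hF e.inv
  hom_inv_id := by rw [← genHom_comp, e.hom_inv_id, genHom_id]
  inv_hom_id := by rw [← genHom_comp, e.inv_hom_id, genHom_id]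

/-- The image of a retract. -/
def genRetract (r : Retract F G) : Retract (genObj F hF) (genObj G hG) where
  i := genHom hF hG r.i
  r := genHom hG hF r.r
  retract := by rw [← genHom_comp, r.retract, genHom_id]

theorem genObj_isZero_iff : IsZero (genObj F hF) ↔ 𝟙 F ∈ (cellIdeal k Q).carrier F F := by
  rw [IsZero.iff_id_eq_zero, ← genHom_id, ← sub_zero (𝟙 F), ← genHom_eq_iff hF hF, sub_zero]
  rfl

end

/-- The image of an adjunction. -/
def genAdjunction {i j : B} {F : i ⟶ j} {G : j ⟶ i} (hF : IsGen k Q F) (hG : IsGen k Q G)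
    (adj : F ⊣ G) : genObj F hF ⊣ genObj G hG where
  unit := ObjectProperty.homMk (((cellIdeal k Q).proj i i).map adj.unit)
  counit := ObjectProperty.homMk (((cellIdeal k Q).proj j j).map adj.counit)
  left_triangle := ObjectProperty.hom_ext _
    (congrArg ((cellIdeal k Q).proj i j).map adj.left_triangle)
  right_triangle := ObjectProperty.hom_ext _
    (congrArg ((cellIdeal k Q).proj j i).map adj.right_triangle)

theorem exists_leLR_of_id_notMem {i j : B} {F : i ⟶ j} (hF : Indecomposable F)
    (h : 𝟙 F ∉ (cellIdeal k Q).carrier F F) : ∃ G ∈ Q, LeLR ⟨i, j, F⟩ G := by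
  by_contra hcon
  push Not at hcon
  refine h (Submodule.mem_sInf.mpr ?_)
  rintro _ ⟨J, hJ, rfl⟩
  exact hJ ⟨i, j, F⟩ ⟨hF, hcon⟩

variable (hB : ∀ i j : B, IsKrullSchmidt k (i ⟶ j))

include hB in
-- Decompose a representative in C. Its summands still give objects of C_Q, which is closed under
-- retracts, and indecomposability of X leaves just one nonzero image.
theorem exists_indec_genObj {i j : B} (X : cellObj k Q i ⟶ cellObj k Q j) (hX : Indecomposable X) :
    ∃ (F : i ⟶ j) (h : IsGen k Q F), Indecomposable F ∧ 𝟙 F ∉ (cellIdeal k Q).carrier F F ∧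
      Nonempty (X ≅ genObj F h) := by
  obtain ⟨F, hF, rfl⟩ := exists_genObj X
  suffices h : ∃ (G : i ⟶ j) (h : IsGen k Q G), Indecomposable G ∧
      Nonempty (genObj F hF ≅ genObj G h) by
    obtain ⟨G, h, h1, ⟨e⟩⟩ := h
    refine ⟨G, h, h1, ?_, ⟨e⟩⟩
    rw [← genObj_isZero_iff h]
    exact fun hz => hX.1 (hz.of_iso e)
  induction F using (hB i j).induction with
  | iso e ih =>
    have hF' := IsGen.retract (Retract.ofIso e) hF
    obtain ⟨G, h, hG, ⟨e'⟩⟩ := ih hF' (indecomposable_of_iso (genIso hF hF' e.symm) hX)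
    exact ⟨G, h, hG, ⟨genIso hF hF' e.symm ≪≫ e'⟩⟩
  | zero F hz =>
    refine absurd ((genObj_isZero_iff hF).mpr ?_) hX.1
    rw [(IsZero.iff_id_eq_zero F).mp hz]
    exact Submodule.zero_mem _
  | indec F h => exact ⟨F, hF, h, ⟨Iso.refl _⟩⟩
  | sum F G ih₁ ih₂ =>
    have h₁ := IsGen.retract (⟨biprod.inl, biprod.fst, biprod.inl_fst⟩ : Retract F (F ⊞ G)) hF
    have h₂ := IsGen.retract (⟨biprod.inr, biprod.snd, biprod.inr_snd⟩ : Retract G (F ⊞ G)) hF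
    let e : genObj (F ⊞ G) hF ≅ genObj F h₁ ⊞ genObj G h₂ :=
      { hom := biprod.lift (genHom hF h₁ biprod.fst) (genHom hF h₂ biprod.snd)
        inv := biprod.desc (genHom h₁ hF biprod.inl) (genHom h₂ hF biprod.inr)
        hom_inv_id := by
          rw [biprod.lift_desc, ← genHom_comp, ← genHom_comp, ← genHom_add, biprod.total, genHom_id]
        inv_hom_id := by
          have e0 : ∀ {A C : i ⟶ j} (hA : IsGen k Q A) (hC : IsGen k Q C),
            genHom hA hC 0 = 0 := fun _ _ => rfl
          ext
          · simp [← genHom_comp, genHom_id]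
          · simp [← genHom_comp, e0]
          · simp [← genHom_comp, e0]
          · simp [← genHom_comp, genHom_id] }
    rcases hX.2 _ _ e with hz | hz
    · have : genObj F h₁ ⊞ genObj G h₂ ≅ genObj G h₂ := (isoZeroBiprod hz).symm
      obtain ⟨H, h, hH, ⟨e'⟩⟩ := ih₂ h₂ (indecomposable_of_iso (e ≪≫ this) hX)
      exact ⟨H, h, hH, ⟨e ≪≫ this ≪≫ e'⟩⟩
    · have : genObj F h₁ ⊞ genObj G h₂ ≅ genObj F h₁ := (isoBiprodZero hz).symm
      obtain ⟨H, h, hH, ⟨e'⟩⟩ := ih₁ h₁ (indecomposable_of_iso (e ≪≫ this) hX)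
      exact ⟨H, h, hH, ⟨e ≪≫ this ≪≫ e'⟩⟩

include hB in
theorem genObj_local {i j : B} {F : i ⟶ j} (hF : IsGen k Q F) (h : Indecomposable F)
    (f : genObj F hF ⟶ genObj F hF) : IsIso f ∨ IsIso (𝟙 _ - f) := by
  obtain ⟨α, rfl⟩ := genHom_surjective hF hF f
  rcases (hB i j).local_end h α with h | h
  · left
    exact (genIso hF hF (asIso α)).isIso_hom
  · right
    have h1 := (genIso hF hF (asIso (𝟙 F - α))).isIso_hom
    have h2 : 𝟙 (genObj F hF) - genHom hF hF α = genHom hF hF (𝟙 F - α) := by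
      rw [← genHom_id]; exact ((genHomLinear hF hF).map_sub (𝟙 F) α).symm
    rw [h2]
    exact h1

include hB in
theorem genObj_indec {i j : B} {F : i ⟶ j} (hF : IsGen k Q F) (h : Indecomposable F)
    (h' : 𝟙 F ∉ (cellIdeal k Q).carrier F F) : Indecomposable (genObj F hF) :=
  indecomposable_of_local (by rwa [genObj_isZero_iff]) (genObj_local hB hF h)

include hB in
-- All three properties descend along the full projection from C: spaces of 2-morphisms are
-- quotients, local rings have local quotients, and indecomposables come from indecomposables.
theorem cellTwoCat_isKrullSchmidt (i j : CellTwoCat k Q) : IsKrullSchmidt k (i ⟶ j) where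
  finite X Y := by
    obtain ⟨⟨i⟩⟩ := i
    obtain ⟨⟨j⟩⟩ := j
    obtain ⟨F, hF, rfl⟩ := exists_genObj X
    obtain ⟨G, hG, rfl⟩ := exists_genObj Y
    have := (hB i j).finite F G
    exact Module.Finite.of_surjective (genHomLinear hF hG) (genHom_surjective hF hG)
  local_end {X} hX f := by
    obtain ⟨⟨i⟩⟩ := i
    obtain ⟨⟨j⟩⟩ := j
    obtain ⟨F, hF, h, -, ⟨e⟩⟩ := exists_indec_genObj hB X hX
    rcases genObj_local hB hF h (e.inv ≫ f ≫ e.hom) with h | h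
    · left
      have : f = e.hom ≫ (e.inv ≫ f ≫ e.hom) ≫ e.inv := by simp
      rw [this]; infer_instance
    · right
      have : 𝟙 X - f = e.hom ≫ (𝟙 _ - e.inv ≫ f ≫ e.hom) ≫ e.inv := by
        simp [sub_comp, comp_sub]
      rw [this]; infer_instance
  finite_indec := by
    classical
    obtain ⟨⟨i⟩⟩ := i
    obtain ⟨⟨j⟩⟩ := j
    obtain ⟨s, hs, hsi⟩ := (hB i j).finite_indec
    obtain ⟨Z, hZ⟩ := HasZeroObject.zero (C := cellObj k Q i ⟶ cellObj k Q j)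
    refine ⟨(fun F => if h : IsGen k Q F then genObj F h else Z) '' s, hs.image _, fun X hX => ?_⟩
    obtain ⟨F, hF, h, -, ⟨e⟩⟩ := exists_indec_genObj hB X hX
    obtain ⟨G, hG, ⟨e'⟩⟩ := hsi F h
    have hG' := IsGen.retract (Retract.ofIso e'.symm) hF
    refine ⟨_, ⟨G, hG, rfl⟩, ⟨?_⟩⟩
    dsimp only
    rw [dif_pos hG']
    exact e ≪≫ genIso hF hG' e'

end Gen

end FiatCells

namespace FiatCells
open Preadditive

theorem indec_of_iso₁ {B : Type u} [Bicategory.{w, v} B] [PreadditiveBicategory B]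
    [AdditiveBicategory B] {F G : OneMor B} (h : Iso₁ F G) (hF : F.Indec) : G.Indec := by
  cases h with
  | mk e => exact indecomposable_of_iso e hF

/-! ### The cells of C_Q. -/

section Cells

variable {k : Type t} [Field k] {B : Type u} [Bicategory.{w, v} B] [PreadditiveBicategory B]
  [LinearBicategory k B] [AdditiveBicategory B] {Q : Set (OneMor B)}

/-- The image of a 1-morphism with its source and target. -/
def genMor {i j : B} (F : i ⟶ j) (h : IsGen k Q F) : OneMor (CellTwoCat k Q) :=
  ⟨cellObj k Q i, cellObj k Q j, genObj F h⟩

theorem mem_imageCell_iff {S : Set (OneMor B)} (hS : S ⊆ Q) {X : OneMor (CellTwoCat k Q)} :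
    X ∈ imageCell k Q S ↔ ∃ (i j : B) (F : i ⟶ j) (hF : (⟨i, j, F⟩ : OneMor B) ∈ S),
      Iso₁ X (genMor F (IsGen.of_mem (hS hF))) := by
  constructor
  · obtain ⟨⟨⟨i⟩⟩, ⟨⟨j⟩⟩, X⟩ := X
    rintro ⟨⟨i', j', F⟩, hF, h⟩
    have h : Iso₁ (⟨⟨i⟩, ⟨j⟩, X.obj⟩ : OneMor (cellIdeal k Q).QuotObj)
      ⟨⟨i'⟩, ⟨j'⟩, ((cellIdeal k Q).proj i' j').obj F⟩ := h
    cases h with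
    | mk e =>
      refine ⟨i, j, F, hF, ⟨?_⟩⟩
      exact ObjectProperty.isoMk _ e
  · rintro ⟨i, j, F, hF, h⟩
    obtain ⟨i', j', X⟩ := X
    cases h with
    | mk e =>
      exact ⟨⟨i, j, F⟩, hF, ⟨((generated ((cellIdeal k Q).toQuot '' Q)).prop ⟨i⟩ ⟨j⟩).ι.mapIso e⟩⟩

theorem exists_genMor (hB : ∀ i j : B, IsKrullSchmidt k (i ⟶ j)) {X : OneMor (CellTwoCat k Q)}
    (hX : X.Indec) : ∃ (i j : B) (F : i ⟶ j) (h : IsGen k Q F), Indecomposable F ∧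
      𝟙 F ∉ (cellIdeal k Q).carrier F F ∧ Iso₁ X (genMor F h) := by
  obtain ⟨⟨⟨i⟩⟩, ⟨⟨j⟩⟩, X⟩ := X
  obtain ⟨F, h, h1, h2, ⟨e⟩⟩ := exists_indec_genObj hB (i := i) (j := j) X hX
  exact ⟨i, j, F, h, h1, h2, ⟨e⟩⟩

theorem nonempty_retract_of_gen (hB : ∀ i j : B, IsKrullSchmidt k (i ⟶ j)) {i j : B} {F G : i ⟶ j}
    (hF : IsGen k Q F) (hG : IsGen k Q G) (h : Indecomposable F)
    (h' : 𝟙 F ∉ (cellIdeal k Q).carrier F F) (r : Retract (genObj F hF) (genObj G hG)) :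
    Nonempty (Retract F G) :=
  nonempty_retract_of_proj hB (cellIdeal k Q) h h'
    (r.map ((generated ((cellIdeal k Q).toQuot '' Q)).prop ⟨i⟩ ⟨j⟩).ι)

theorem leR_of_genMor (hB : ∀ i j : B, IsKrullSchmidt k (i ⟶ j)) {i j i' j' : B} {F : i ⟶ j}
    {G : i' ⟶ j'} (hF : IsGen k Q F) (hG : IsGen k Q G) (h : Indecomposable G)
    (h' : 𝟙 G ∉ (cellIdeal k Q).carrier G G) (hle : LeR (genMor F hF) (genMor G hG)) :
    LeR ⟨i, j, F⟩ ⟨i', j', G⟩ := by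
  have hle : LeR (⟨⟨⟨i⟩⟩, ⟨⟨j⟩⟩, genObj F hF⟩ : OneMor (CellTwoCat k Q))
    ⟨⟨⟨i'⟩⟩, ⟨⟨j'⟩⟩, genObj G hG⟩ := hle
  cases hle with
  | mk H r =>
    obtain ⟨H, hH, rfl⟩ := exists_genObj H
    obtain ⟨r⟩ := nonempty_retract_of_gen hB hG (hF.comp hH) h h' r
    exact LeR.mk H r

theorem leLR_of_genMor (hB : ∀ i j : B, IsKrullSchmidt k (i ⟶ j)) {i j i' j' : B} {F : i ⟶ j}
    {G : i' ⟶ j'} (hF : IsGen k Q F) (hG : IsGen k Q G) (h : Indecomposable G)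
    (h' : 𝟙 G ∉ (cellIdeal k Q).carrier G G) (hle : LeLR (genMor F hF) (genMor G hG)) :
    LeLR ⟨i, j, F⟩ ⟨i', j', G⟩ := by
  cases hle with
  | mk H₁ H₂ r =>
    obtain ⟨H₁, h₁, rfl⟩ := exists_genObj H₁
    obtain ⟨H₂, h₂, rfl⟩ := exists_genObj H₂
    obtain ⟨r⟩ := nonempty_retract_of_gen hB hG (h₁.comp (hF.comp h₂)) h h' r
    exact LeLR.mk H₁ H₂ r

end Cells

section FiatCells

variable {k : Type t} [Field k] {B : Type u} [Bicategory.{w, v} B] [PreadditiveBicategory B]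
  [LinearBicategory k B] [AdditiveBicategory B] [hw : ∀ i j : B, HasWeakKernels (i ⟶ j)]
  [hidem : ∀ i j : B, IsIdempotentComplete (i ⟶ j)]
  (hB : ∀ i j : B, IsKrullSchmidt k (i ⟶ j)) (S : Involution B)
  (hS : ∀ {i j : B} (F : i ⟶ j), Nonempty (F ⊣ S.star F))
  {Q : Set (OneMor B)} (hQ : IsTwoSidedCell Q)

include hB hS hQ

theorem genMor_indec {i j : B} {F : i ⟶ j} (hF : (⟨i, j, F⟩ : OneMor B) ∈ Q) :
    (genMor (k := k) F (IsGen.of_mem hF)).Indec :=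
  genObj_indec hB _ (hQ.indec hF) (id_notMem_cellIdeal hB S hS hQ hF)

/-- An arbitrary multiplier from C may be missing in C_Q, but `F* ≫ G` is a composite of elements of
Q. -/
theorem genMor_leR {i j l : B} {F : i ⟶ j} {G : i ⟶ l} (hF : (⟨i, j, F⟩ : OneMor B) ∈ Q)
    (hG : (⟨i, l, G⟩ : OneMor B) ∈ Q) (h₁ : LeR ⟨i, j, F⟩ ⟨i, l, G⟩)
    (h₂ : LeR ⟨i, l, G⟩ ⟨i, j, F⟩) :
    LeR (genMor (k := k) F (IsGen.of_mem hF)) (genMor G (IsGen.of_mem hG)) := by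
  obtain ⟨r⟩ := nonempty_retract_of_leR hB S hS (F := F) (G := G) (hQ.indec hF) (hQ.indec hG) h₁ h₂
  have h := (IsGen.of_mem (k := k) (starMor_mem hB S hS hQ hF)).comp (IsGen.of_mem hG)
  exact LeR.mk (genObj _ h) (genRetract _ ((IsGen.of_mem hF).comp h) r)

theorem genMor_leL {i j l : B} {F : j ⟶ i} {G : l ⟶ i} (hF : (⟨j, i, F⟩ : OneMor B) ∈ Q)
    (hG : (⟨l, i, G⟩ : OneMor B) ∈ Q) (h₁ : LeL ⟨j, i, F⟩ ⟨l, i, G⟩)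
    (h₂ : LeL ⟨l, i, G⟩ ⟨j, i, F⟩) :
    LeL (genMor (k := k) F (IsGen.of_mem hF)) (genMor G (IsGen.of_mem hG)) := by
  obtain ⟨r⟩ := nonempty_retract_of_leL hB S hS (F := F) (G := G) (hQ.indec hF) (hQ.indec hG) h₁ h₂
  have h := (IsGen.of_mem hG).comp (IsGen.of_mem (k := k) (starMor_mem hB S hS hQ hF))
  exact LeL.mk (genObj _ h) (genRetract _ (h.comp (IsGen.of_mem hF)) r)

/-- The right cell of F meets the left cell of G in some H; passing from F to H and from H to G uses
only the one-sided relations that survive in C_Q. -/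
theorem genMor_leLR (hreg : IsStronglyRegular Q) {i j i' j' : B} {F : i ⟶ j} {G : i' ⟶ j'}
    (hF : (⟨i, j, F⟩ : OneMor B) ∈ Q) (hG : (⟨i', j', G⟩ : OneMor B) ∈ Q) :
    LeLR (genMor (k := k) F (IsGen.of_mem hF)) (genMor G (IsGen.of_mem hG)) := by
  obtain ⟨⟨a, b, H⟩, hH, ⟨h1, h2⟩, h3, h4⟩ := hreg.exists_leR_leL hQ hF hG
  have ha : a = i := by cases h1; rfl
  have hb : b = j' := by cases h3; rfl
  subst ha hb
  exact (genMor_leR hB S hS hQ hF hH h1 h2).leLR.trans (genMor_leL hB S hS hQ hH hG h3 h4).leLR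

theorem imageCell_isTwoSidedCell (hreg : IsStronglyRegular Q) :
    IsTwoSidedCell (imageCell k Q Q) := by
  obtain ⟨⟨i, j, F⟩, hF⟩ := hQ.nonempty
  have hid := id_notMem_cellIdeal hB S hS hQ hF
  refine ⟨genMor F (IsGen.of_mem hF), genMor_indec hB S hS hQ hF, ?_⟩
  ext X
  constructor
  · intro hX
    obtain ⟨i', j', G, hG, e⟩ := (mem_imageCell_iff subset_rfl).mp hX
    exact ⟨indec_of_iso₁ e.symm (genMor_indec hB S hS hQ hG),
      (genMor_leLR hB S hS hQ hreg hF hG).trans e.symm.leR.leLR,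
      e.leR.leLR.trans (genMor_leLR hB S hS hQ hreg hG hF)⟩
  · rintro ⟨hX, h1, h2⟩
    obtain ⟨i', j', G, hGen, hG, hG1, e⟩ := exists_genMor hB hX
    have h3 := leLR_of_genMor hB _ hGen hG hG1 (h1.trans e.leR.leLR)
    have h4 := leLR_of_genMor hB hGen _ (hQ.indec hF) hid (e.symm.leR.leLR.trans h2)
    exact (mem_imageCell_iff subset_rfl).mpr ⟨i', j', G, hQ.mem hF hG h3 h4, e⟩

theorem imageCell_isRightCell {R : Set (OneMor B)} (hR : IsRightCell R) (hRQ : R ⊆ Q) :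
    IsRightCell (imageCell k Q R) := by
  obtain ⟨⟨i, j, F⟩, hF, hR'⟩ := id hR
  have hFR : (⟨i, j, F⟩ : OneMor B) ∈ R := hR' ▸ mem_rightCell_self hF
  have hid := id_notMem_cellIdeal hB S hS hQ (hRQ hFR)
  refine ⟨genMor F (IsGen.of_mem (hRQ hFR)), genMor_indec hB S hS hQ (hRQ hFR), ?_⟩
  ext X
  constructor
  · intro hX
    obtain ⟨i', j', G, hG, e⟩ := (mem_imageCell_iff hRQ).mp hX
    have h1 := hR.leR hFR hG
    have h2 := hR.leR hG hFR
    have hi : i' = i := by cases h1; rfl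
    subst hi
    exact ⟨indec_of_iso₁ e.symm (genMor_indec hB S hS hQ (hRQ hG)),
      (genMor_leR hB S hS hQ (hRQ hFR) (hRQ hG) h1 h2).trans e.symm.leR,
      e.leR.trans (genMor_leR hB S hS hQ (hRQ hG) (hRQ hFR) h2 h1)⟩
  · rintro ⟨hX, h1, h2⟩
    obtain ⟨i', j', G, hGen, hG, hG1, e⟩ := exists_genMor hB hX
    have h3 := leR_of_genMor hB _ hGen hG hG1 (h1.trans e.leR)
    have h4 := leR_of_genMor hB hGen _ hF hid (e.symm.leR.trans h2)
    exact (mem_imageCell_iff hRQ).mpr ⟨i', j', G, hR.mem hFR hG h3 h4, e⟩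

/-- Lift the isomorphism and its inverse; both composites are congruent to identities modulo the
ideal, hence invertible. -/
theorem iso₁_of_toQuot {F G : OneMor B} (hF : F ∈ Q) (hG : G ∈ Q)
    (h : Iso₁ ((cellIdeal k Q).toQuot F) ((cellIdeal k Q).toQuot G)) : Iso₁ F G := by
  obtain ⟨i, j, F⟩ := F
  obtain ⟨i', j', G⟩ := G
  have h : Iso₁ (⟨⟨i⟩, ⟨j⟩, ((cellIdeal k Q).proj i j).obj F⟩ : OneMor (cellIdeal k Q).QuotObj)
    ⟨⟨i'⟩, ⟨j'⟩, ((cellIdeal k Q).proj i' j').obj G⟩ := h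
  cases h with
  | mk e =>
    obtain ⟨a, ha⟩ := ((cellIdeal k Q).proj i j).map_surjective e.hom
    obtain ⟨b, hb⟩ := ((cellIdeal k Q).proj i j).map_surjective e.inv
    have h1 : IsIso (a ≫ b) := isIso_of_sub_mem hB _ (F := F) (hQ.indec hF)
      (id_notMem_cellIdeal hB S hS hQ hF)
      ((CategoryTheory.Quotient.functor_map_eq_iff ((cellIdeal k Q).rel i j) _ _).mp (by
        change ((cellIdeal k Q).proj i j).map _ = ((cellIdeal k Q).proj i j).map _
        rw [Functor.map_comp, ha, hb, e.hom_inv_id, CategoryTheory.Functor.map_id]))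
    have h2 : IsIso (b ≫ a) := isIso_of_sub_mem hB _ (F := G) (hQ.indec hG)
      (id_notMem_cellIdeal hB S hS hQ hG)
      ((CategoryTheory.Quotient.functor_map_eq_iff ((cellIdeal k Q).rel i j) _ _).mp (by
        change ((cellIdeal k Q).proj i j).map _ = ((cellIdeal k Q).proj i j).map _
        rw [Functor.map_comp, ha, hb, e.inv_hom_id, CategoryTheory.Functor.map_id]))
    have h3 : IsSplitMono a := IsSplitMono.mk' ⟨b ≫ inv (a ≫ b), by
      rw [← Category.assoc, IsIso.hom_inv_id]⟩
    have h4 : Epi a := epi_of_epi b a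
    have h5 : IsIso a := isIso_of_epi_of_isSplitMono a
    exact ⟨asIso a⟩

omit hw hidem hB hS hQ in
theorem imageCell_dom {R : Set (OneMor B)} (hRQ : R ⊆ Q) {i : B} (hi : ∀ F ∈ R, F.dom = i) :
    ∀ X ∈ imageCell k Q R, X.dom = cellObj k Q i := by
  intro X hX
  obtain ⟨i', j', F, hF, e⟩ := (mem_imageCell_iff hRQ).mp hX
  have h := hi _ hF
  subst h
  unfold genMor at e
  cases e
  rfl

/-- The left adjoint F* of F in R lies in Q, so the whole adjunction passes to C_Q. No involution on
C_Q is constructed; these adjoints are all that the later arguments use there. -/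
theorem hasLeftAdjoints_imageCell {R : Set (OneMor B)} (hRQ : R ⊆ Q) (i : B) :
    HasLeftAdjoints (cellObj k Q i) (imageCell k Q R) := by
  intro j X hX
  obtain ⟨i', j', F, hF, e⟩ := (mem_imageCell_iff hRQ).mp hX
  have hs := IsGen.of_mem (k := k) (starMor_mem hB S hS hQ (hRQ hF))
  obtain ⟨adj⟩ := S.star_adj hS F
  have adj' := genAdjunction hs (IsGen.of_mem (hRQ hF)) adj
  unfold genMor at e
  cases e with
  | mk e => exact ⟨_, ⟨adjunctionOfIsoRight adj' e.symm⟩⟩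

omit hw hidem hS in
theorem cellStable_imageCell (hreg : IsRegular Q) {R : Set (OneMor B)} (hR : IsRightCell R)
    (hRQ : R ⊆ Q) (i : B) (L : RightFreyd (cellObj k Q i ⟶ cellObj k Q i)) :
    CellStable (cellObj k Q i) (imageCell k Q R) L :=
  cellStable_of (cellTwoCat_isKrullSchmidt hB) fun {j l} F H G hF hG ⟨r⟩ => by
    right
    obtain ⟨a, b, F', hF', e⟩ := (mem_imageCell_iff hRQ).mp hF
    obtain ⟨a', b', G', hGen, hG', hG1, e'⟩ := exists_genMor (X := ⟨_, _, G⟩) hB hG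
    have h1 : LeR ⟨a, b, F'⟩ ⟨a', b', G'⟩ :=
      leR_of_genMor hB (IsGen.of_mem (hRQ hF')) hGen hG' hG1
        (e.symm.leR.trans ((LeR.mk H r).trans e'.leR))
    -- Surviving in the quotient already forces `G'` below Q, so every summand lands in R and
    -- nothing about L is needed, unlike over C.
    obtain ⟨X, hX, h2⟩ := exists_leLR_of_id_notMem hG' hG1
    have hGQ := hQ.mem (G := ⟨a', b', G'⟩) (hRQ hF') hG' h1.leLR (h2.trans (hQ.leLR hX (hRQ hF')))
    exact (mem_imageCell_iff hRQ).mpr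
      ⟨a', b', G', hR.mem hF' hG' h1 (hreg.leR_symm hQ (hRQ hF') hGQ h1), e'⟩

end FiatCells

end FiatCells

namespace FiatCells
open Preadditive

/-! ### An intrinsic criterion for a 2-morphism to vanish on L, and its invariance under passage to
C_Q. -/

section Mate

variable {B : Type u} [Bicategory.{w, v} B]

/-- The 2-morphism `(G ≫ A) ≫ F' ⟶ G` which corresponds to `G ◁ α` under the adjunction `F' ⊣ F`. -/
def mate {i j : B} (G : i ⟶ i) {A F : i ⟶ j} {F' : j ⟶ i} (adj : F' ⊣ F) (α : A ⟶ F) :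
    (G ≫ A) ≫ F' ⟶ G :=
  (G ◁ α) ▷ F' ≫ (α_ G F F').hom ≫ G ◁ adj.counit ≫ (ρ_ G).hom

variable [PreadditiveBicategory B] [AdditiveBicategory B]

open ZeroObject in
theorem actProj_comp_counit {i j : B} (G : i ⟶ i) {F : i ⟶ j} {F' : j ⟶ i} (adj : F' ⊣ F) :
    (act i F').map (actProj G F).inv ≫
        (actAdj i adj).counit.app ((RightFreyd.functor (i ⟶ i)).obj G) =
      (actProj (G ≫ F) F').hom ≫
        (RightFreyd.functor (i ⟶ i)).map ((α_ G F F').hom ≫ G ◁ adj.counit ≫ (ρ_ G).hom) := by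
  change (RightFreyd.quotient _).map _ ≫ (RightFreyd.quotient _).map _ ≫
    (RightFreyd.quotient _).map _ ≫ (RightFreyd.quotient _).map _ =
      (RightFreyd.quotient _).map _ ≫ (RightFreyd.quotient _).map _
  rw [← Functor.map_comp, ← Functor.map_comp, ← Functor.map_comp]
  refine Eq.trans ?_ ((RightFreyd.quotient _).map_comp _ _)
  apply quotient_map_congr
  · exact ((postcomp i F').map_isZero (isZero_zero (i ⟶ j))).eq_of_src _ _
  · change 𝟙 (G ≫ F) ▷ F' ≫ (α_ G F F').hom ≫ G ◁ adj.counit ≫ (ρ_ G).hom =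
      𝟙 _ ≫ (α_ G F F').hom ≫ G ◁ adj.counit ≫ (ρ_ G).hom
    simp

variable {k : Type t} [Field k] [LinearBicategory k B] [hw : ∀ i j : B, HasWeakKernels (i ⟶ j)]

/-- Vanishing on L can be tested on the cover P_G. The resulting morphism into F L is adjoint to the
mate of α followed by `p : P_G ⟶ L`, and that composite vanishes exactly when the mate does not
split. -/
theorem actHom_app_eq_zero_iff (hB : ∀ i j : B, IsKrullSchmidt k (i ⟶ j)) {i j : B} {G : i ⟶ i}
    (hG : Indecomposable G) {L : RightFreyd (i ⟶ i)} [Simple L]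
    (p : (RightFreyd.functor (i ⟶ i)).obj G ⟶ L) (hp : p ≠ 0) {A F : i ⟶ j} {F' : j ⟶ i}
    (adj : F' ⊣ F) (α : A ⟶ F) :
    (actHom i α).app L = 0 ↔ ∀ s : G ⟶ (G ≫ A) ≫ F', ¬ IsIso (s ≫ mate G adj α) := by
  rw [← map_comp_eq_zero_iff (hB i i) hG p hp]
  have : Epi p := epi_of_nonzero_to_simple hp
  have hA := act_map_epi A p
  have h1 : (actHom i α).app L = 0 ↔
      (RightFreyd.functor (i ⟶ j)).map (G ◁ α) ≫ (actProj G F).inv ≫ (act i F).map p = 0 := by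
    have h2 := (actHom i α).naturality p
    have h3 := actProj_naturality_right G α
    rw [← Iso.eq_comp_inv, Category.assoc] at h3
    rw [h3, Category.assoc, Category.assoc] at h2
    rw [← cancel_epi ((act i A).map p), comp_zero, h2]
    constructor
    · intro h
      rwa [← cancel_epi (actProj G A).hom, comp_zero]
    · intro h
      exact (congrArg ((actProj G A).hom ≫ ·) h).trans comp_zero
  -- Naturality of the counit at p identifies the adjunct of the test morphism with the mate.
  have h4 : (actProj (G ≫ A) F').hom ≫ (RightFreyd.functor (i ⟶ i)).map (mate G adj α) ≫ p =
      ((actAdj i adj).homEquiv _ _).symm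
        ((RightFreyd.functor (i ⟶ j)).map (G ◁ α) ≫ (actProj G F).inv ≫ (act i F).map p) := by
    rw [CategoryTheory.Adjunction.homEquiv_counit, Functor.map_comp, Functor.map_comp,
      Category.assoc, Category.assoc]
    have h5 : (act i F').map ((act i F).map p) ≫ (actAdj i adj).counit.app L =
      (actAdj i adj).counit.app _ ≫ p := (actAdj i adj).counit.naturality p
    rw [h5, reassoc_of% (actProj_comp_counit G adj), mate, Functor.map_comp, Category.assoc,
      ← Category.assoc ((act i F').map _) (actProj (G ≫ F) F').hom,
      actProj_naturality_left (G ◁ α) F', Category.assoc]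
    rfl
  rw [h1]
  constructor
  · intro h
    rw [h] at h4
    rw [← cancel_epi (actProj (G ≫ A) F').hom, h4, comp_zero,
      CategoryTheory.Adjunction.homEquiv_counit, Functor.map_zero, zero_comp]
  · intro h
    rw [h, comp_zero] at h4
    rw [← ((actAdj i adj).homEquiv _ _).apply_symm_apply ((RightFreyd.functor (i ⟶ j)).map _ ≫ _),
      ← h4, CategoryTheory.Adjunction.homEquiv_unit, Functor.map_zero, comp_zero]

end Mate

section Compare

variable {k : Type t} [Field k] {B : Type u} [Bicategory.{w, v} B] [PreadditiveBicategory B]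
  [LinearBicategory k B] [AdditiveBicategory B] {Q : Set (OneMor B)}
  (hB : ∀ i j : B, IsKrullSchmidt k (i ⟶ j))

include hB in
-- The ideal meets the endomorphisms of F in a proper ideal of a local ring, so units are detected
-- in the quotient.
theorem isIso_genHom_iff {i j : B} {F : i ⟶ j} (hF : IsGen k Q F) (h : Indecomposable F)
    (h' : 𝟙 F ∉ (cellIdeal k Q).carrier F F) (f : F ⟶ F) : IsIso (genHom hF hF f) ↔ IsIso f := by
  refine ⟨fun hf => ?_, fun hf => (genIso hF hF (asIso f)).isIso_hom⟩
  obtain ⟨g, hg⟩ := genHom_surjective hF hF (inv (genHom hF hF f))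
  have h1 : IsIso (f ≫ g) := isIso_of_sub_mem hB _ h h' ((genHom_eq_iff hF hF _ _).mp (by
    rw [genHom_comp hF hF hF, hg, IsIso.hom_inv_id, genHom_id]))
  have h2 : IsIso (g ≫ f) := isIso_of_sub_mem hB _ h h' ((genHom_eq_iff hF hF _ _).mp (by
    rw [genHom_comp hF hF hF, hg, IsIso.inv_hom_id, genHom_id]))
  have h3 : IsSplitMono f := IsSplitMono.mk' ⟨g ≫ inv (f ≫ g), by
    rw [← Category.assoc, IsIso.hom_inv_id]⟩
  have h4 : Epi f := epi_of_epi g f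
  exact isIso_of_epi_of_isSplitMono f

theorem genHom_mate {i j : B} {G : i ⟶ i} {A F : i ⟶ j} {F' : j ⟶ i} (hG : IsGen k Q G)
    (hA : IsGen k Q A) (hF : IsGen k Q F) (hF' : IsGen k Q F') (adj : F' ⊣ F) (α : A ⟶ F) :
    mate (genObj G hG) (genAdjunction hF' hF adj) (genHom hA hF α) =
      genHom ((hG.comp hA).comp hF') hG (mate G adj α) := by
  unfold mate
  rw [genHom_comp _ ((hG.comp hF).comp hF') hG, genHom_comp _ (hG.comp (hF.comp hF')) hG,
    genHom_comp _ (hG.comp (Gen.id _)) hG]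
  rfl

variable [hw : ∀ i j : B, HasWeakKernels (i ⟶ j)]

include hB in
theorem actHom_genHom_eq_zero_iff {i j : B} {G : i ⟶ i} (hG : Indecomposable G)
    (hGen : IsGen k Q G) (h' : 𝟙 G ∉ (cellIdeal k Q).carrier G G) {L : RightFreyd (i ⟶ i)}
    [Simple L] (p : (RightFreyd.functor (i ⟶ i)).obj G ⟶ L) (hp : p ≠ 0)
    {L' : RightFreyd (cellObj k Q i ⟶ cellObj k Q i)} [Simple L']
    (p' : (RightFreyd.functor (cellObj k Q i ⟶ cellObj k Q i)).obj (genObj G hGen) ⟶ L')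
    (hp' : p' ≠ 0) {A F : i ⟶ j} {F' : j ⟶ i} (hA : IsGen k Q A) (hF : IsGen k Q F)
    (hF' : IsGen k Q F') (adj : F' ⊣ F) (α : A ⟶ F) :
    (actHom (cellObj k Q i) (genHom hA hF α)).app L' = 0 ↔ (actHom i α).app L = 0 := by
  have hB' : ∀ i j : CellTwoCat k Q, IsKrullSchmidt k (i ⟶ j) := cellTwoCat_isKrullSchmidt hB
  have hw' : ∀ i j : CellTwoCat k Q, HasWeakKernels (i ⟶ j) := fun i j => (hB' i j).hasWeakKernels
  rw [actHom_app_eq_zero_iff hB hG p hp adj, actHom_app_eq_zero_iff hB'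
    (genObj_indec hB hGen hG h') p' hp' (genAdjunction hF' hF adj), genHom_mate]
  have key : ∀ s : G ⟶ (G ≫ A) ≫ F', IsIso (genHom hGen ((hGen.comp hA).comp hF') s ≫
      genHom ((hGen.comp hA).comp hF') hGen (mate G adj α)) ↔ IsIso (s ≫ mate G adj α) := by
    intro s
    rw [← genHom_comp, isIso_genHom_iff hB hGen hG h']
  constructor
  · exact fun h s hs => h _ ((key s).mpr hs)
  · intro h s hs
    obtain ⟨s, rfl⟩ := genHom_surjective hGen ((hGen.comp hA).comp hF') s
    exact h s ((key s).mp hs)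

end Compare

end FiatCells

namespace FiatCells
open Preadditive

/-! ### Cokernels as a property, and the right exact extension of a functor to the abelianization.
-/

section IsCoker

/-- `c` is a cokernel of `g`. -/
structure IsCoker {A : Type*} [Category A] [HasZeroMorphisms A] {X Y Z : A} (g : X ⟶ Y)
    (c : Y ⟶ Z) : Prop where
  w : g ≫ c = 0
  epi : Epi c
  exists_desc {W : A} (z : Y ⟶ W) : g ≫ z = 0 → ∃ t : Z ⟶ W, c ≫ t = z

variable {A : Type*} [Category A] [HasZeroMorphisms A] {A' : Type*} [Category A']
  [HasZeroMorphisms A'] {X Y Z : A} {g : X ⟶ Y} {c : Y ⟶ Z}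

theorem isCoker_cokernel (g : X ⟶ Y) [HasCokernel g] : IsCoker g (cokernel.π g) :=
  ⟨cokernel.condition g, inferInstance, fun z hz => ⟨cokernel.desc g z hz, cokernel.π_desc g z hz⟩⟩

theorem IsCoker.exists_iso (h : IsCoker g c) {Z' : A} {c' : Y ⟶ Z'} (h' : IsCoker g c') :
    ∃ e : Z ≅ Z', c ≫ e.hom = c' := by
  obtain ⟨s, hs⟩ := h.exists_desc c' h'.w
  obtain ⟨t, ht⟩ := h'.exists_desc c h.w
  have := h.epi
  have := h'.epi
  exact ⟨⟨s, t, by rw [← cancel_epi c, reassoc_of% hs, ht, Category.comp_id],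
    by rw [← cancel_epi c', reassoc_of% ht, hs, Category.comp_id]⟩, hs⟩

theorem IsCoker.comp_iso (h : IsCoker g c) {Z' : A} (e : Z ≅ Z') : IsCoker g (c ≫ e.hom) where
  w := by rw [← Category.assoc, h.w, zero_comp]
  epi := by
    have := h.epi
    exact epi_comp _ _
  exists_desc z hz := by
    obtain ⟨t, ht⟩ := h.exists_desc z hz
    exact ⟨e.inv ≫ t, by simpa using ht⟩

theorem IsCoker.iso_comp (h : IsCoker g c) {X' Y' : A} (a : X' ≅ X) (b : Y' ≅ Y) (g' : X' ⟶ Y')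
    (hg : g' ≫ b.hom = a.hom ≫ g) : IsCoker g' (b.hom ≫ c) where
  w := by rw [← Category.assoc, hg, Category.assoc, h.w, comp_zero]
  epi := by
    have := h.epi
    exact epi_comp _ _
  exists_desc z hz := by
    obtain ⟨t, ht⟩ := h.exists_desc (b.inv ≫ z) (by
      rw [← cancel_epi a.hom, ← reassoc_of% hg, Iso.hom_inv_id_assoc, hz, comp_zero])
    exact ⟨t, by rw [Category.assoc, ht, Iso.hom_inv_id_assoc]⟩

theorem IsCoker.map_of_preserves [HasCokernels A] [HasCokernels A'] (h : IsCoker g c) (T : A ⥤ A')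
    [T.PreservesZeroMorphisms] [PreservesColimit (parallelPair g 0) T] :
    IsCoker (T.map g) (T.map c) := by
  obtain ⟨e, rfl⟩ := (isCoker_cokernel g).exists_iso h
  have h1 := (isCoker_cokernel (T.map g)).comp_iso
    ((PreservesCokernel.iso T g).symm ≪≫ T.mapIso e)
  have h2 : cokernel.π (T.map g) ≫ ((PreservesCokernel.iso T g).symm ≪≫ T.mapIso e).hom =
      T.map (cokernel.π g ≫ e.hom) := by
    simp
  rwa [h2] at h1

theorem isCoker_of_zero_left (h : IsCoker (0 : X ⟶ Y) c) : IsIso c := by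
  obtain ⟨t, ht⟩ := h.exists_desc (𝟙 Y) zero_comp
  have := h.epi
  have : IsSplitMono c := IsSplitMono.mk' ⟨t, ht⟩
  exact isIso_of_epi_of_isSplitMono c

end IsCoker

section Lift

variable {U : Type*} [Category U] [Preadditive U] {A : Type*} [Category A] [Preadditive A]
  [HasCokernels A] (T : U ⥤ A) [T.Additive]

/-- The functor from arrows to cokernels. -/
def arrowLift : Arrow U ⥤ A where
  obj X := cokernel (T.map X.hom)
  map {X Y} f := cokernel.map (T.map X.hom) (T.map Y.hom) (T.map f.left) (T.map f.right) (by
    have h : f.left ≫ Y.hom = X.hom ≫ f.right := f.w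
    rw [← T.map_comp, ← T.map_comp, h])
  map_id X := by
    apply coequalizer.hom_ext
    simp
  map_comp f g := by
    apply coequalizer.hom_ext
    simp

/-- The right exact extension of an additive functor to the abelianization. -/
def freydLift : RightFreyd U ⥤ A :=
  CategoryTheory.Quotient.lift (Arrow.rightHomotopic U) (arrowLift T) (by
    rintro X Y f g ⟨h⟩
    have e : ∀ f : X ⟶ Y, cokernel.π (T.map X.hom) ≫ (arrowLift T).map f =
      T.map f.right ≫ cokernel.π (T.map Y.hom) := fun f => cokernel.π_desc _ _ _
    suffices e' : T.map f.right ≫ cokernel.π (T.map Y.hom) =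
        T.map g.right ≫ cokernel.π (T.map Y.hom) from
      coequalizer.hom_ext ((e f).trans (e'.trans (e g).symm))
    rw [← sub_eq_zero, ← sub_comp, ← T.map_sub, h.comm, T.map_comp,
      Category.assoc, cokernel.condition, comp_zero])

/-- The projection onto the value of `freydLift T`. -/
def liftπ (X : Arrow U) : T.obj X.right ⟶ (freydLift T).obj ((RightFreyd.quotient U).obj X) :=
  cokernel.π (T.map X.hom)

theorem isCoker_liftπ (X : Arrow U) : IsCoker (T.map X.hom) (liftπ T X) :=
  isCoker_cokernel _

theorem liftπ_naturality {X Y : Arrow U} (f : X ⟶ Y) :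
    liftπ T X ≫ (freydLift T).map ((RightFreyd.quotient U).map f) =
      T.map f.right ≫ liftπ T Y :=
  cokernel.π_desc _ _ _

variable {T} in
theorem freydLift_hom_ext {X : Arrow U} {Z : A}
    {f g : (freydLift T).obj ((RightFreyd.quotient U).obj X) ⟶ Z}
    (h : liftπ T X ≫ f = liftπ T X ≫ g) : f = g := by
  have := (isCoker_liftπ T X).epi
  exact (cancel_epi _).mp h

instance freydLift_additive : (freydLift T).Additive where
  map_add {X Y f g} := by
    obtain ⟨X, rfl⟩ := freyd_exists_rep X
    obtain ⟨Y, rfl⟩ := freyd_exists_rep Y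
    obtain ⟨f, rfl⟩ := (RightFreyd.quotient U).map_surjective (X := X) (Y := Y) f
    obtain ⟨g, rfl⟩ := (RightFreyd.quotient U).map_surjective (X := X) (Y := Y) g
    rw [← Functor.map_add]
    apply freydLift_hom_ext
    rw [comp_add, liftπ_naturality, liftπ_naturality, liftπ_naturality, ← add_comp, ← T.map_add]
    rfl

instance freydLift_linear {k : Type*} [Field k] [Linear k U] [Linear k A] [T.Linear k] :
    (freydLift T).Linear k where
  map_smul {X Y} f c := by
    obtain ⟨X, rfl⟩ := freyd_exists_rep X
    obtain ⟨Y, rfl⟩ := freyd_exists_rep Y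
    obtain ⟨f, rfl⟩ := (RightFreyd.quotient U).map_surjective (X := X) (Y := Y) f
    rw [← CategoryTheory.Functor.map_smul]
    apply freydLift_hom_ext
    rw [Linear.comp_smul, liftπ_naturality, liftπ_naturality, ← Linear.smul_comp,
      ← CategoryTheory.Functor.map_smul]
    rfl

/-- It suffices to treat the explicit cokernel, which has the same right object as Y. A morphism on
the image of Y descends once it kills both `Y.hom` and `f.right`, the two components of the new
relation. -/
theorem freydLift_isCoker [HasBinaryBiproducts U] {X Y Z : RightFreyd U} {f : X ⟶ Y} {c : Y ⟶ Z}
    (h : IsCoker f c) : IsCoker ((freydLift T).map f) ((freydLift T).map c) := by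
  obtain ⟨X, rfl⟩ := freyd_exists_rep X
  obtain ⟨Y, rfl⟩ := freyd_exists_rep Y
  obtain ⟨f, rfl⟩ := (RightFreyd.quotient U).map_surjective (X := X) (Y := Y) f
  let q : (RightFreyd.quotient U).obj Y ⟶
      (RightFreyd.quotient U).obj (RightFreyd.Candidate.cokernel f) :=
    (RightFreyd.quotient U).map (RightFreyd.Candidate.π f)
  have hq : IsCoker ((RightFreyd.quotient U).map f) q :=
    ⟨(RightFreyd.Candidate.cokernelCofork f).condition,
      inferInstanceAs (Epi ((RightFreyd.quotient U).map (RightFreyd.Candidate.π f))), fun z hz =>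
      ⟨(RightFreyd.Candidate.isColimitCokernelCofork f).desc (CokernelCofork.ofπ z hz),
        (RightFreyd.Candidate.isColimitCokernelCofork f).fac (CokernelCofork.ofπ z hz)
          WalkingParallelPair.one⟩⟩
  obtain ⟨e, rfl⟩ := hq.exists_iso h
  have hπ : liftπ T Y ≫ (freydLift T).map q = liftπ T (RightFreyd.Candidate.cokernel f) := by
    refine (liftπ_naturality T (RightFreyd.Candidate.π f)).trans ?_
    refine Eq.trans (congrArg (· ≫ liftπ T (RightFreyd.Candidate.cokernel f))
      (T.map_id Y.right)) (Category.id_comp _)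
  have key : IsCoker ((freydLift T).map ((RightFreyd.quotient U).map f)) ((freydLift T).map q) := by
    refine ⟨?_, ?_, fun {W} z hz => ?_⟩
    · rw [← Functor.map_comp, hq.w, Functor.map_zero]
    · have : Epi (liftπ T Y ≫ (freydLift T).map q) := by
        rw [hπ]
        exact (isCoker_liftπ T _).epi
      exact epi_of_epi (liftπ T Y) _
    · have h1 : T.map (biprod.desc Y.hom f.right) ≫ liftπ T Y ≫ z = 0 := by
        have h2 : T.map f.right ≫ liftπ T Y ≫ z = 0 := by
          rw [← Category.assoc, ← liftπ_naturality, Category.assoc, hz, comp_zero]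
        have h3 : T.map Y.hom ≫ liftπ T Y ≫ z = 0 := by
          rw [← Category.assoc, (isCoker_liftπ T Y).w, zero_comp]
        rw [biprod.desc_eq, T.map_add, add_comp, T.map_comp, T.map_comp, Category.assoc,
          Category.assoc, h2, h3, comp_zero, comp_zero, add_zero]
      obtain ⟨t, ht⟩ := (isCoker_liftπ T (RightFreyd.Candidate.cokernel f)).exists_desc
        (liftπ T Y ≫ z) h1
      refine ⟨t, freydLift_hom_ext ?_⟩
      rw [← Category.assoc, hπ]
      exact ht
  rw [Functor.map_comp]
  exact key.comp_iso ((freydLift T).mapIso e)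

/-- The comparison of `T` with the values of `freydLift T` at projective objects. -/
def liftP [HasZeroObject U] (X : U) :
    T.obj X ⟶ (freydLift T).obj ((RightFreyd.functor U).obj X) :=
  liftπ T ((RightFreyd.rightFunctor U).obj X)

theorem liftP_naturality [HasZeroObject U] {X Y : U} (f : X ⟶ Y) :
    T.map f ≫ liftP T Y = liftP T X ≫ (freydLift T).map ((RightFreyd.functor U).map f) :=
  (liftπ_naturality T ((RightFreyd.rightFunctor U).map f)).symm

open ZeroObject in
instance isIso_liftP [HasZeroObject U] (X : U) :
    IsIso (liftP T X) := by
  have h := isCoker_liftπ T ((RightFreyd.rightFunctor U).obj X)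
  have h0 : T.map ((RightFreyd.rightFunctor U).obj X).hom = 0 := T.map_zero _ _
  rw [h0] at h
  exact isCoker_of_zero_left h

end Lift

end FiatCells

namespace FiatCells
open Preadditive

/-! ### A criterion for a right exact functor to be an equivalence between categories of cokernels.
-/

section RelProj

variable {A : Type*} [Category A] [Preadditive A]

/-- `X` is projective with respect to cokernels of morphisms in the additive closure of `S`. -/
def RelProj (S : Set A) (X : A) : Prop :=
  ∀ {Y₁ Y₀ Z : A} (g : Y₁ ⟶ Y₀) (c : Y₀ ⟶ Z), AddClosure S Y₁ → AddClosure S Y₀ → IsCoker g c →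
    (∀ x : X ⟶ Z, ∃ y : X ⟶ Y₀, y ≫ c = x) ∧ ∀ x : X ⟶ Y₀, x ≫ c = 0 → ∃ y : X ⟶ Y₁, y ≫ g = x

theorem RelProj.of_addClosure {S S' : Set A} (h : ∀ X ∈ S', RelProj S X) {X : A}
    (hX : AddClosure S' X) : RelProj S X := by
  induction hX with
  | of hX => exact h _ hX
  | zero hX =>
    exact fun g c _ _ _ => ⟨fun x => ⟨0, hX.eq_of_src _ _⟩, fun x _ => ⟨0, hX.eq_of_src _ _⟩⟩
  | sum b hb _ _ h1 h2 =>
    intro Y₁ Y₀ Z g c hY₁ hY₀ hc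
    constructor
    · intro x
      obtain ⟨y₁, e₁⟩ := (h1 g c hY₁ hY₀ hc).1 (b.inl ≫ x)
      obtain ⟨y₂, e₂⟩ := (h2 g c hY₁ hY₀ hc).1 (b.inr ≫ x)
      refine ⟨b.fst ≫ y₁ + b.snd ≫ y₂, ?_⟩
      rw [add_comp, Category.assoc, Category.assoc, e₁, e₂, ← Category.assoc, ← Category.assoc,
        ← add_comp, IsBilimit.binary_total hb, Category.id_comp]
    · intro x hx
      obtain ⟨y₁, e₁⟩ := (h1 g c hY₁ hY₀ hc).2 (b.inl ≫ x) (by rw [Category.assoc, hx, comp_zero])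
      obtain ⟨y₂, e₂⟩ := (h2 g c hY₁ hY₀ hc).2 (b.inr ≫ x) (by rw [Category.assoc, hx, comp_zero])
      refine ⟨b.fst ≫ y₁ + b.snd ≫ y₂, ?_⟩
      rw [add_comp, Category.assoc, Category.assoc, e₁, e₂, ← Category.assoc, ← Category.assoc,
        ← add_comp, IsBilimit.binary_total hb, Category.id_comp]
  | retract r _ h =>
    intro Y₁ Y₀ Z g c hY₁ hY₀ hc
    constructor
    · intro x
      obtain ⟨y, e⟩ := (h g c hY₁ hY₀ hc).1 (r.r ≫ x)
      exact ⟨r.i ≫ y, by rw [Category.assoc, e, r.retract_assoc]⟩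
    · intro x hx
      obtain ⟨y, e⟩ := (h g c hY₁ hY₀ hc).2 (r.r ≫ x) (by rw [Category.assoc, hx, comp_zero])
      exact ⟨r.i ≫ y, by rw [Category.assoc, e, r.retract_assoc]⟩

end RelProj

section Presented

variable {A : Type*} [Category A] [Preadditive A] [HasCokernels A] {A' : Type*} [Category A']
  [Preadditive A'] [HasCokernels A']

/-- The cokernels of morphisms in the additive closure of `S`. -/
def presented (S : Set A) : ObjectProperty A := fun M =>
  ∃ (X₁ X₀ : A) (f : X₁ ⟶ X₀), AddClosure S X₁ ∧ AddClosure S X₀ ∧ Nonempty (cokernel f ≅ M)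

theorem presented_iff {S : Set A} {M : A} : presented S M ↔ ∃ (X₁ X₀ : A) (f : X₁ ⟶ X₀)
    (c : X₀ ⟶ M), AddClosure S X₁ ∧ AddClosure S X₀ ∧ IsCoker f c := by
  constructor
  · rintro ⟨X₁, X₀, f, h₁, h₀, ⟨e⟩⟩
    exact ⟨X₁, X₀, f, _, h₁, h₀, (isCoker_cokernel f).comp_iso e⟩
  · rintro ⟨X₁, X₀, f, c, h₁, h₀, h⟩
    obtain ⟨e, -⟩ := (isCoker_cokernel f).exists_iso h
    exact ⟨X₁, X₀, f, h₁, h₀, ⟨e⟩⟩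

variable {S : Set A} {S' : Set A'} (T : A' ⥤ A) [T.Additive]

theorem presented_map (hT : ∀ {X Y Z : A'} {f : X ⟶ Y} {c : Y ⟶ Z}, IsCoker f c →
    IsCoker (T.map f) (T.map c)) (h : ∀ X ∈ S', AddClosure S (T.obj X)) {M : A'}
    (hM : presented S' M) : presented S (T.obj M) := by
  obtain ⟨X₁, X₀, f, c, h₁, h₀, hc⟩ := presented_iff.mp hM
  exact presented_iff.mpr ⟨_, _, _, _, AddClosure.map T h h₁, AddClosure.map T h h₀, hT hc⟩

omit [HasCokernels A] [HasCokernels A'] in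
theorem bijective_of_addClosure_right {X : A'}
    (h : ∀ Y ∈ S', Function.Bijective (T.map : (X ⟶ Y) → (T.obj X ⟶ T.obj Y))) {Y : A'}
    (hY : AddClosure S' Y) : Function.Bijective (T.map : (X ⟶ Y) → (T.obj X ⟶ T.obj Y)) := by
  induction hY with
  | of hY => exact h _ hY
  | zero hY => exact ⟨fun f g _ => hY.eq_of_tgt _ _, fun f => ⟨0, (T.map_isZero hY).eq_of_tgt _ _⟩⟩
  | sum b hb _ _ h1 h2 =>
    constructor
    · intro f g hfg
      have e₁ := h1.1 (a₁ := f ≫ b.fst) (a₂ := g ≫ b.fst) (by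
        rw [Functor.map_comp, Functor.map_comp, hfg])
      have e₂ := h2.1 (a₁ := f ≫ b.snd) (a₂ := g ≫ b.snd) (by
        rw [Functor.map_comp, Functor.map_comp, hfg])
      rw [← Category.comp_id f, ← Category.comp_id g, ← IsBilimit.binary_total hb, comp_add,
        comp_add, reassoc_of% e₁, reassoc_of% e₂]
    · intro f
      obtain ⟨f₁, e₁⟩ := h1.2 (f ≫ T.map b.fst)
      obtain ⟨f₂, e₂⟩ := h2.2 (f ≫ T.map b.snd)
      refine ⟨f₁ ≫ b.inl + f₂ ≫ b.inr, ?_⟩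
      rw [Functor.map_add, Functor.map_comp, Functor.map_comp, e₁, e₂, Category.assoc,
        Category.assoc, ← Functor.map_comp, ← Functor.map_comp, ← comp_add, ← Functor.map_add,
        IsBilimit.binary_total hb, CategoryTheory.Functor.map_id, Category.comp_id]
  | retract r _ h =>
    constructor
    · intro f g hfg
      have e := h.1 (a₁ := f ≫ r.i) (a₂ := g ≫ r.i) (by
        rw [Functor.map_comp, Functor.map_comp, hfg])
      rw [← Category.comp_id f, ← Category.comp_id g, ← r.retract, reassoc_of% e]
    · intro f
      obtain ⟨f', e⟩ := h.2 (f ≫ T.map r.i)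
      refine ⟨f' ≫ r.r, ?_⟩
      rw [Functor.map_comp, e, Category.assoc, ← Functor.map_comp, r.retract,
        CategoryTheory.Functor.map_id, Category.comp_id]

omit [HasCokernels A] [HasCokernels A'] in
theorem bijective_of_addClosure_left {Y : A'}
    (h : ∀ X ∈ S', Function.Bijective (T.map : (X ⟶ Y) → (T.obj X ⟶ T.obj Y))) {X : A'}
    (hX : AddClosure S' X) : Function.Bijective (T.map : (X ⟶ Y) → (T.obj X ⟶ T.obj Y)) := by
  induction hX with
  | of hX => exact h _ hX
  | zero hX => exact ⟨fun f g _ => hX.eq_of_src _ _, fun f => ⟨0, (T.map_isZero hX).eq_of_src _ _⟩⟩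
  | sum b hb _ _ h1 h2 =>
    constructor
    · intro f g hfg
      have e₁ := h1.1 (a₁ := b.inl ≫ f) (a₂ := b.inl ≫ g) (by
        rw [Functor.map_comp, Functor.map_comp, hfg])
      have e₂ := h2.1 (a₁ := b.inr ≫ f) (a₂ := b.inr ≫ g) (by
        rw [Functor.map_comp, Functor.map_comp, hfg])
      rw [← Category.id_comp f, ← Category.id_comp g, ← IsBilimit.binary_total hb, add_comp,
        add_comp, Category.assoc, Category.assoc, Category.assoc, Category.assoc, e₁, e₂]
    · intro f
      obtain ⟨f₁, e₁⟩ := h1.2 (T.map b.inl ≫ f)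
      obtain ⟨f₂, e₂⟩ := h2.2 (T.map b.inr ≫ f)
      refine ⟨b.fst ≫ f₁ + b.snd ≫ f₂, ?_⟩
      rw [Functor.map_add, Functor.map_comp, Functor.map_comp, e₁, e₂, ← Functor.map_comp_assoc,
        ← Functor.map_comp_assoc, ← add_comp, ← Functor.map_add,
        IsBilimit.binary_total hb, CategoryTheory.Functor.map_id, Category.id_comp]
  | retract r _ h =>
    constructor
    · intro f g hfg
      have e := h.1 (a₁ := r.r ≫ f) (a₂ := r.r ≫ g) (by
        rw [Functor.map_comp, Functor.map_comp, hfg])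
      rw [← Category.id_comp f, ← Category.id_comp g, ← r.retract, Category.assoc, e, Category.assoc]
    · intro f
      obtain ⟨f', e⟩ := h.2 (T.map r.r ≫ f)
      refine ⟨r.i ≫ f', ?_⟩
      rw [Functor.map_comp, e, ← Functor.map_comp_assoc, r.retract,
        CategoryTheory.Functor.map_id, Category.id_comp]

section

variable (hT : ∀ {X Y Z : A'} {f : X ⟶ Y} {c : Y ⟶ Z}, IsCoker f c →
    IsCoker (T.map f) (T.map c))
  (h₁ : ∀ X ∈ S', AddClosure S (T.obj X))
  (h₂ : ∀ Y ∈ S, ∃ X, AddClosure S' X ∧ Nonempty (T.obj X ≅ Y))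
  (h₃ : ∀ X ∈ S', ∀ Y ∈ S', Function.Bijective (T.map : (X ⟶ Y) → (T.obj X ⟶ T.obj Y)))
  (h₄ : ∀ X ∈ S', RelProj S' X) (h₅ : ∀ Y ∈ S, RelProj S Y)

include h₃ in
omit [HasCokernels A] [HasCokernels A'] in
theorem bijective_of_addClosure {X Y : A'} (hX : AddClosure S' X) (hY : AddClosure S' Y) :
    Function.Bijective (T.map : (X ⟶ Y) → (T.obj X ⟶ T.obj Y)) :=
  bijective_of_addClosure_left T (fun X hX => bijective_of_addClosure_right T (h₃ X hX) hY) hX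

include hT h₁ h₃ h₄ h₅ in
omit [HasCokernels A] in
-- Comparison of projective presentations: morphisms of cokernels lift to the terms, where T is
-- bijective on morphisms, and relative projectivity on both sides also provides the needed
-- homotopies.
theorem bijective_of_presented {M M' : A'} (hM : presented S' M) (hM' : presented S' M') :
    Function.Bijective (T.map : (M ⟶ M') → (T.obj M ⟶ T.obj M')) := by
  obtain ⟨X₁, X₀, g, c, hX₁, hX₀, hc⟩ := presented_iff.mp hM
  obtain ⟨Y₁, Y₀, g', c', hY₁, hY₀, hc'⟩ := presented_iff.mp hM'
  have hp := RelProj.of_addClosure h₄ hX₀ g' c' hY₁ hY₀ hc'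
  have hTp : ∀ {X : A'}, AddClosure S' X → _ := fun {X} hX =>
    RelProj.of_addClosure h₅ (AddClosure.map T h₁ hX) (T.map g') (T.map c')
      (AddClosure.map T h₁ hY₁) (AddClosure.map T h₁ hY₀) (hT hc')
  have := hc.epi
  have := (hT hc).epi
  constructor
  · suffices key : ∀ f : M ⟶ M', T.map f = 0 → f = 0 by
      intro f f' hf
      rw [← sub_eq_zero]
      exact key _ (by rw [T.map_sub, hf, sub_self])
    intro f hf
    obtain ⟨a, ha⟩ := hp.1 (c ≫ f)
    obtain ⟨b, hb⟩ := (hTp hX₀).2 (T.map a) (by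
      rw [← T.map_comp, ha, T.map_comp, hf, comp_zero])
    obtain ⟨b, rfl⟩ := (bijective_of_addClosure T h₃ hX₀ hY₁).2 b
    rw [← T.map_comp] at hb
    rw [← cancel_epi c, ← ha, ← (bijective_of_addClosure T h₃ hX₀ hY₀).1 hb, Category.assoc, hc'.w,
      comp_zero, comp_zero]
  · intro h
    obtain ⟨a, ha⟩ := (hTp hX₀).1 (T.map c ≫ h)
    obtain ⟨a, rfl⟩ := (bijective_of_addClosure T h₃ hX₀ hY₀).2 a
    obtain ⟨b, hb⟩ := (hTp hX₁).2 (T.map (g ≫ a)) (by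
      rw [T.map_comp, Category.assoc, ha, ← Category.assoc, (hT hc).w, zero_comp])
    obtain ⟨b, rfl⟩ := (bijective_of_addClosure T h₃ hX₁ hY₁).2 b
    rw [← T.map_comp] at hb
    have hb := (bijective_of_addClosure T h₃ hX₁ hY₀).1 hb
    obtain ⟨f, hf⟩ := hc.exists_desc (a ≫ c') (by
      rw [← Category.assoc, ← hb, Category.assoc, hc'.w, comp_zero])
    exact ⟨f, by rw [← cancel_epi (T.map c), ← T.map_comp, hf, T.map_comp, ha]⟩

include h₂ h₃ in
omit [HasCokernels A] [HasCokernels A'] in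
theorem exists_obj_iso_of_addClosure [IsIdempotentComplete A'] [HasZeroObject A']
    [HasBinaryBiproducts A'] {Y : A} (hY : AddClosure S Y) :
    ∃ X, AddClosure S' X ∧ Nonempty (T.obj X ≅ Y) := by
  induction hY with
  | of hY => exact h₂ _ hY
  | zero hY =>
    obtain ⟨Z, hZ⟩ := HasZeroObject.zero (C := A')
    exact ⟨Z, AddClosure.zero hZ, ⟨(T.map_isZero hZ).iso hY⟩⟩
  | sum b hb _ _ h h' =>
    obtain ⟨X, hX, ⟨e⟩⟩ := h
    obtain ⟨X', hX', ⟨e'⟩⟩ := h'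
    refine ⟨X ⊞ X', AddClosure.sum (BinaryBiproduct.bicone X X') (BinaryBiproduct.isBilimit X X')
      hX hX', ⟨⟨T.map biprod.fst ≫ e.hom ≫ b.inl + T.map biprod.snd ≫ e'.hom ≫ b.inr,
      b.fst ≫ e.inv ≫ T.map biprod.inl + b.snd ≫ e'.inv ≫ T.map biprod.inr, ?_, ?_⟩⟩⟩
    · have h0 : T.map biprod.fst ≫ T.map biprod.inl + T.map biprod.snd ≫ T.map biprod.inr =
          𝟙 (T.obj (X ⊞ X')) := by
        rw [← T.map_comp, ← T.map_comp, ← T.map_add, biprod.total, CategoryTheory.Functor.map_id]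
      simpa [add_comp, comp_add] using h0
    · have h1 : T.map (biprod.inl : X ⟶ X ⊞ X') ≫ T.map biprod.fst = 𝟙 _ := by
        rw [← T.map_comp, biprod.inl_fst, CategoryTheory.Functor.map_id]
      have h2 : T.map (biprod.inl : X ⟶ X ⊞ X') ≫ T.map biprod.snd = 0 := by
        rw [← T.map_comp, biprod.inl_snd, Functor.map_zero]
      have h3 : T.map (biprod.inr : X' ⟶ X ⊞ X') ≫ T.map biprod.fst = 0 := by
        rw [← T.map_comp, biprod.inr_fst, Functor.map_zero]
      have h4 : T.map (biprod.inr : X' ⟶ X ⊞ X') ≫ T.map biprod.snd = 𝟙 _ := by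
        rw [← T.map_comp, biprod.inr_snd, CategoryTheory.Functor.map_id]
      simp only [add_comp, comp_add, Category.assoc, reassoc_of% h1, reassoc_of% h2,
        reassoc_of% h3, reassoc_of% h4, zero_comp, comp_zero, add_zero, zero_add,
        Iso.inv_hom_id_assoc]
      exact IsBilimit.binary_total hb
  | retract r _ h =>
    obtain ⟨X, hX, ⟨e⟩⟩ := h
    -- The projector onto the summand lifts to an idempotent a because T is bijective on these
    -- endomorphisms; splitting a gives the preimage of the summand.
    obtain ⟨a, ha⟩ := (bijective_of_addClosure T h₃ hX hX).2 (e.hom ≫ r.r ≫ r.i ≫ e.inv)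
    have hid : a ≫ a = a := (bijective_of_addClosure T h₃ hX hX).1 (by
      rw [T.map_comp, ha]
      simp)
    obtain ⟨X', i, p, h1, h2⟩ := IsIdempotentComplete.idempotents_split X a hid
    refine ⟨X', AddClosure.retract ⟨i, p, h1⟩ hX,
      ⟨⟨T.map i ≫ e.hom ≫ r.r, r.i ≫ e.inv ≫ T.map p, ?_, ?_⟩⟩⟩
    · have h3 : T.map i ≫ T.map a ≫ T.map p = 𝟙 _ := by
        rw [← h2, ← T.map_comp, ← T.map_comp, Category.assoc, h1, Category.comp_id, h1,
          CategoryTheory.Functor.map_id]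
      rw [ha] at h3
      simpa using h3
    · have h4 : T.map p ≫ T.map i = e.hom ≫ r.r ≫ r.i ≫ e.inv := by rw [← T.map_comp, h2, ha]
      simp [reassoc_of% h4]

include hT h₁ h₂ h₃ h₄ h₅ in
theorem isEquivalence_of_presented [IsIdempotentComplete A'] [HasZeroObject A']
    [HasBinaryBiproducts A'] (h : ∀ M : (presented S').FullSubcategory, presented S (T.obj M.obj)) :
    ((presented S).lift ((presented S').ι ⋙ T) h).IsEquivalence where
  faithful := ⟨fun {X Y} f g hfg => ObjectProperty.hom_ext _
    ((bijective_of_presented T hT h₁ h₃ h₄ h₅ X.property Y.property).1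
      (congrArg (fun f => f.hom) hfg))⟩
  full := ⟨fun {X Y} f => by
    obtain ⟨g, hg⟩ := (bijective_of_presented T hT h₁ h₃ h₄ h₅ X.property Y.property).2 f.hom
    exact ⟨ObjectProperty.homMk g, ObjectProperty.hom_ext _ hg⟩⟩
  essSurj := ⟨fun N => by
    obtain ⟨Y₁, Y₀, f, c, hY₁, hY₀, hc⟩ := presented_iff.mp N.property
    obtain ⟨X₁, hX₁, ⟨e₁⟩⟩ := exists_obj_iso_of_addClosure T h₂ h₃ hY₁
    obtain ⟨X₀, hX₀, ⟨e₀⟩⟩ := exists_obj_iso_of_addClosure T h₂ h₃ hY₀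
    obtain ⟨g, hg⟩ := (bijective_of_addClosure T h₃ hX₁ hX₀).2 (e₁.hom ≫ f ≫ e₀.inv)
    have h6 := hc.iso_comp e₁ e₀ (T.map g) (by rw [hg]; simp)
    obtain ⟨e, -⟩ := (hT (isCoker_cokernel g)).exists_iso h6
    exact ⟨⟨cokernel g, X₁, X₀, g, hX₁, hX₀, ⟨Iso.refl _⟩⟩, ⟨(presented S).isoMk e⟩⟩⟩

end

end Presented

end FiatCells

namespace FiatCells
open Preadditive

/-! ### Relative projectivity of the objects F L, and evaluation at L on C_Q. -/

section Lifting

theorem exists_lift_of_isCoker {A : Type*} [Category A] [Abelian A] {P X Y Z : A} [Projective P]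
    {g : X ⟶ Y} {c : Y ⟶ Z} (h : IsCoker g c) (x : P ⟶ Y) (hx : x ≫ c = 0) :
    ∃ y : P ⟶ X, y ≫ g = x := by
  have hx' : x ≫ cokernel.π g = 0 := by
    obtain ⟨t, ht⟩ := h.exists_desc (cokernel.π g) (cokernel.condition g)
    rw [← ht, ← Category.assoc, hx, zero_comp]
  refine ⟨Projective.factorThru (kernel.lift (cokernel.π g) x hx') (Abelian.factorThruImage g), ?_⟩
  have h1 : g = Abelian.factorThruImage g ≫ kernel.ι (cokernel.π g) := (Abelian.image.fac g).symm
  refine (congrArg (_ ≫ ·) h1).trans ?_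
  rw [Projective.factorThru_comp_assoc, kernel.lift_ι]

theorem exists_isCoker_map {V : Type*} [Category V] [Preadditive V] [HasZeroObject V]
    [HasBinaryBiproducts V] [HasWeakKernels V] {F : V} {Z : RightFreyd V}
    (q : (RightFreyd.functor V).obj F ⟶ Z) [Epi q] :
    ∃ (X : V) (α : X ⟶ F), IsCoker ((RightFreyd.functor V).map α) q := by
  obtain ⟨X, p, hp⟩ := freyd_exists_cover (kernel q)
  obtain ⟨α, hα⟩ := (RightFreyd.functor V).map_surjective (p ≫ kernel.ι q)
  refine ⟨X, α, ?_, inferInstance, fun z hz => ?_⟩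
  · rw [hα, Category.assoc, kernel.condition, comp_zero]
  · have hz' : kernel.ι q ≫ z = 0 := by
      rw [← cancel_epi p, comp_zero, ← Category.assoc, ← hα, hz]
    exact ⟨Abelian.epiDesc q z hz', Abelian.comp_epiDesc q z hz'⟩

end Lifting

section CellTop

variable {k : Type t} [Field k] {B : Type u} [Bicategory.{w, v} B] [PreadditiveBicategory B]
  [LinearBicategory k B] [AdditiveBicategory B] [hw : ∀ i j : B, HasWeakKernels (i ⟶ j)]

/-- The objects `F L` for `F ∈ R`. -/
def cellGenerators (i : B) (R : Set (OneMor B)) (L : RightFreyd (i ⟶ i)) (j : B) :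
    Set (RightFreyd (i ⟶ j)) :=
  {X | ∃ F : i ⟶ j, (⟨i, j, F⟩ : OneMor B) ∈ R ∧ X = (act i F).obj L}

namespace CellTop

variable {i : B} {R : Set (OneMor B)} {L : RightFreyd (i ⟶ i)} (T : CellTop i R L)

omit [LinearBicategory k B] in
theorem exists_factor_addClosure {j : B} {F : i ⟶ j} (hF : (⟨i, j, F⟩ : OneMor B) ∈ R)
    {Y : RightFreyd (i ⟶ j)} (hY : AddClosure (cellGenerators i R L j) Y)
    (f : (RightFreyd.functor (i ⟶ j)).obj F ⟶ Y) :
    ∃ g : (act i F).obj L ⟶ Y, T.π F hF ≫ g = f := by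
  induction hY with
  | of hY =>
    obtain ⟨F', hF', rfl⟩ := hY
    exact T.exists_factor hF hF' f
  | zero hY => exact ⟨0, hY.eq_of_tgt _ _⟩
  | sum b hb _ _ h1 h2 =>
    obtain ⟨g₁, e₁⟩ := h1 (f ≫ b.fst)
    obtain ⟨g₂, e₂⟩ := h2 (f ≫ b.snd)
    refine ⟨g₁ ≫ b.inl + g₂ ≫ b.inr, ?_⟩
    rw [comp_add, reassoc_of% e₁, reassoc_of% e₂, ← comp_add, IsBilimit.binary_total hb,
      Category.comp_id]
  | retract r _ h =>
    obtain ⟨g, e⟩ := h (f ≫ r.i)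
    exact ⟨g ≫ r.r, by rw [reassoc_of% e, r.retract, Category.comp_id]⟩

include T in
omit [LinearBicategory k B] in
-- Lift from P_F, which is projective in the whole abelianization, and factor the lift through the
-- epimorphism P_F ⟶ F L; this is possible because its target lies in the additive closure of the F'
-- L.
theorem relProj {j : B} {X : RightFreyd (i ⟶ j)} (hX : X ∈ cellGenerators i R L j) :
    RelProj (cellGenerators i R L j) X := by
  obtain ⟨F, hF, rfl⟩ := hX
  intro Y₁ Y₀ Z g c hY₁ hY₀ hc
  have := T.π_epi F hF
  have := hc.epi
  have : Projective ((RightFreyd.functor (i ⟶ j)).obj F) := freyd_projective F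
  constructor
  · intro x
    let y' := Projective.factorThru (P := (RightFreyd.functor (i ⟶ j)).obj F) (T.π F hF ≫ x) c
    have hy' : y' ≫ c = T.π F hF ≫ x :=
      Projective.factorThru_comp (P := (RightFreyd.functor (i ⟶ j)).obj F) (T.π F hF ≫ x) c
    obtain ⟨y, hy⟩ := T.exists_factor_addClosure hF hY₀ y'
    exact ⟨y, by rw [← cancel_epi (T.π F hF), reassoc_of% hy, hy']⟩
  · intro x hx
    obtain ⟨y', hy'⟩ := exists_lift_of_isCoker (P := (RightFreyd.functor (i ⟶ j)).obj F)
      hc (T.π F hF ≫ x) (by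
      rw [Category.assoc, hx, comp_zero])
    obtain ⟨y, hy⟩ := T.exists_factor_addClosure hF hY₁ y'
    exact ⟨y, by rw [← cancel_epi (T.π F hF), reassoc_of% hy, hy']⟩

end CellTop

end CellTop

section EvalGen

variable {k : Type t} [Field k] {B : Type u} [Bicategory.{w, v} B] [PreadditiveBicategory B]
  [LinearBicategory k B] [AdditiveBicategory B] {Q : Set (OneMor B)} {i : B}
  {L : RightFreyd (i ⟶ i)}
  (hann : ∀ {j : B} {F G : i ⟶ j} {α : F ⟶ G}, α ∈ (cellIdeal k Q).carrier F G →
    (actHom i α).app L = 0)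

/-- Evaluation at `L`, as a functor on a hom-category of the 2-category associated with `Q`. -/
def evalGen (j : CellTwoCat k Q) : (cellObj k Q i ⟶ j) ⥤ RightFreyd (i ⟶ j.as.as) :=
  ((generated ((cellIdeal k Q).toQuot '' Q)).prop ⟨i⟩ j.as).ι ⋙
    CategoryTheory.Quotient.lift ((cellIdeal k Q).rel i j.as.as) (evalAt L j.as.as)
      (fun F G α β h => by
        rw [← sub_eq_zero, ← Functor.map_sub]
        exact hann h)

instance evalGen_additive (j : CellTwoCat k Q) : (evalGen hann j).Additive where
  map_add {X Y f g} := by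
    obtain ⟨⟨j⟩⟩ := j
    obtain ⟨F, hF, rfl⟩ := exists_genObj X
    obtain ⟨G, hG, rfl⟩ := exists_genObj Y
    obtain ⟨f, rfl⟩ := genHom_surjective hF hG f
    obtain ⟨g, rfl⟩ := genHom_surjective hF hG g
    exact (evalAt L j).map_add

instance evalGen_cellObj_additive (j : B) : (evalGen hann (cellObj k Q j)).Additive :=
  evalGen_additive hann (cellObj k Q j)

instance evalGen_linear (j : CellTwoCat k Q) : (evalGen hann j).Linear k where
  map_smul {X Y} f c := by
    obtain ⟨⟨j⟩⟩ := j
    obtain ⟨F, hF, rfl⟩ := exists_genObj X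
    obtain ⟨G, hG, rfl⟩ := exists_genObj Y
    obtain ⟨f, rfl⟩ := genHom_surjective hF hG f
    exact CategoryTheory.Functor.map_smul (evalAt L j) c f

end EvalGen

end FiatCells

namespace FiatCells
open Preadditive

/-! ### The comparison functor sends F L' to F L and is an equivalence on the cell categories. -/

section Compare

variable {k : Type t} [Field k] {B : Type u} [Bicategory.{w, v} B] [PreadditiveBicategory B]
  [LinearBicategory k B] [AdditiveBicategory B] {Q : Set (OneMor B)} {i : B}
  {L : RightFreyd (i ⟶ i)}
  (hann : ∀ {j : B} {F G : i ⟶ j} {α : F ⟶ G}, α ∈ (cellIdeal k Q).carrier F G →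
    (actHom i α).app L = 0)

/-- The right exact functor which sends `P_X` to `X L`. -/
abbrev compareFunctor (j : CellTwoCat k Q) :
    RightFreyd (cellObj k Q i ⟶ j) ⥤ RightFreyd (i ⟶ j.as.as) := freydLift (evalGen hann j)

variable {R : Set (OneMor B)} (hRQ : R ⊆ Q)
  {L' : RightFreyd (cellObj k Q i ⟶ cellObj k Q i)}
  (T' : CellTop (cellObj k Q i) (imageCell k Q R) L')

theorem isGen_of_mem {R : Set (OneMor B)} (hRQ : R ⊆ Q) {j : B} {F : i ⟶ j}
    (hF : (⟨i, j, F⟩ : OneMor B) ∈ R) : IsGen k Q F := IsGen.of_mem (hRQ hF)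

/-- The image of an element of `R` in the 2-category associated with `Q`. -/
abbrev cellGenObj {j : B} (F : i ⟶ j) (hF : (⟨i, j, F⟩ : OneMor B) ∈ R) :
    cellObj k Q i ⟶ cellObj k Q j := genObj F (isGen_of_mem hRQ hF)

theorem genMor_mem_imageCell {j : B} {F : i ⟶ j} (hF : (⟨i, j, F⟩ : OneMor B) ∈ R) :
    (⟨cellObj k Q i, cellObj k Q j, cellGenObj hRQ F hF⟩ : OneMor (CellTwoCat k Q)) ∈
      imageCell k Q R := (mem_imageCell_iff hRQ).mpr ⟨i, j, F, hF, ⟨Iso.refl _⟩⟩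

variable [hw' : ∀ i j : CellTwoCat k Q, HasWeakKernels (i ⟶ j)]

/-- The comparison morphism from `F L` to the value of `compareFunctor` at `F L'`. -/
def compareHom {j : B} (F : i ⟶ j) (hF : (⟨i, j, F⟩ : OneMor B) ∈ R) :
    (evalGen hann (cellObj k Q j)).obj (cellGenObj hRQ F hF) ⟶
      (compareFunctor hann (cellObj k Q j)).obj
        ((act (cellObj k Q i) (cellGenObj hRQ F hF)).obj L') :=
  liftP (evalGen hann (cellObj k Q j)) (cellGenObj hRQ F hF) ≫
    (compareFunctor hann (cellObj k Q j)).map (T'.π _ (genMor_mem_imageCell hRQ hF))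

omit hw' in
theorem compareHom_naturality {j : B} {F G : i ⟶ j} (hF : (⟨i, j, F⟩ : OneMor B) ∈ R)
    (hG : (⟨i, j, G⟩ : OneMor B) ∈ R) (α : cellGenObj (k := k) hRQ F hF ⟶ cellGenObj hRQ G hG) :
    (evalGen hann (cellObj k Q j)).map α ≫ compareHom hann hRQ T' G hG =
      compareHom hann hRQ T' F hF ≫
        (compareFunctor hann (cellObj k Q j)).map ((actHom (cellObj k Q i) α).app L') := by
  unfold compareHom
  rw [← Category.assoc, liftP_naturality, Category.assoc, Category.assoc, ← Functor.map_comp,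
    ← Functor.map_comp, T'.π_naturality (genMor_mem_imageCell hRQ hF) (genMor_mem_imageCell hRQ hG)]

variable (hkey : ∀ {j : B} {A F : i ⟶ j} (hA : IsGen k Q A) (hF : (⟨i, j, F⟩ : OneMor B) ∈ R) (α : A ⟶ F),
    (actHom (cellObj k Q i) (genHom hA (isGen_of_mem hRQ hF) α)).app L' = 0 ↔
      (actHom i α).app L = 0)

include hkey in
-- Present F L' by P_A ⟶ P_F with 2-morphism α. Then α kills L', so by `hkey` it kills L, and the
-- comparison functor sends this relation to zero. Its right exactness makes F L the value at F L'.
theorem isIso_compareHom {j : B} {F : i ⟶ j} (hF : (⟨i, j, F⟩ : OneMor B) ∈ R) :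
    IsIso (compareHom hann hRQ T' F hF) := by
  have hπ := T'.π_epi _ (genMor_mem_imageCell hRQ hF)
  obtain ⟨X, α, h⟩ := exists_isCoker_map (T'.π _ (genMor_mem_imageCell hRQ hF))
  obtain ⟨A, hA, rfl⟩ := exists_genObj X
  obtain ⟨α, rfl⟩ := genHom_surjective hA (isGen_of_mem hRQ hF) α
  have h0 := T'.actHom_eq_zero (genMor_mem_imageCell hRQ hF) _ h.w
  rw [hkey hA hF] at h0
  have h1 := freydLift_isCoker (evalGen hann (cellObj k Q j)) h
  have h2 : (compareFunctor hann (cellObj k Q j)).map ((RightFreyd.functor _).map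
      (genHom hA (isGen_of_mem hRQ hF) α)) = 0 := by
    have h3 : (evalGen hann (cellObj k Q j)).map (genHom hA (isGen_of_mem hRQ hF) α) = 0 := h0
    rw [← cancel_epi (liftP (evalGen hann (cellObj k Q j)) (genObj A hA)), ← liftP_naturality, h3,
      zero_comp, comp_zero]
  have h1' : IsCoker ((compareFunctor hann (cellObj k Q j)).map ((RightFreyd.functor _).map
      (genHom hA (isGen_of_mem hRQ hF) α))) _ := h1
  rw [h2] at h1'
  have := isCoker_of_zero_left h1'
  unfold compareHom
  infer_instance

variable [hw : ∀ i j : B, HasWeakKernels (i ⟶ j)] (T : CellTop i R L)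

include hkey T T' in
-- On both sides every morphism between generators is the action of a 2-morphism, and by `hkey` the
-- same 2-morphisms act by zero.
theorem compareFunctor_bijective {j : B} {F G : i ⟶ j} (hF : (⟨i, j, F⟩ : OneMor B) ∈ R)
    (hG : (⟨i, j, G⟩ : OneMor B) ∈ R) :
    Function.Bijective ((compareFunctor hann (cellObj k Q j)).map :
      ((act (cellObj k Q i) (cellGenObj hRQ F hF)).obj L' ⟶
        (act (cellObj k Q i) (cellGenObj hRQ G hG)).obj L') → _) := by
  have hisoF := isIso_compareHom hann hRQ T' hkey hF
  have hisoG := isIso_compareHom hann hRQ T' hkey hG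
  constructor
  · suffices key : ∀ f : (act (cellObj k Q i) (cellGenObj hRQ F hF)).obj L' ⟶
        (act (cellObj k Q i) (cellGenObj hRQ G hG)).obj L',
        (compareFunctor hann (cellObj k Q j)).map f = 0 → f = 0 by
      intro f g hfg
      rw [← sub_eq_zero]
      exact key _ (by rw [Functor.map_sub, hfg, sub_self])
    intro f hf
    obtain ⟨α, rfl⟩ := T'.exists_actHom (genMor_mem_imageCell hRQ hF) (genMor_mem_imageCell hRQ hG) f
    obtain ⟨α, rfl⟩ := genHom_surjective (isGen_of_mem hRQ hF) (isGen_of_mem hRQ hG) α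
    have h := compareHom_naturality hann hRQ T' hF hG
      (genHom (isGen_of_mem hRQ hF) (isGen_of_mem hRQ hG) α)
    rw [hf, comp_zero] at h
    refine (hkey _ hG α).mpr ?_
    change (evalGen hann (cellObj k Q j)).map
      (genHom (isGen_of_mem hRQ hF) (isGen_of_mem hRQ hG) α) = 0
    rw [← cancel_mono (compareHom hann hRQ T' G hG), h, zero_comp]
  · intro h
    let y := compareHom hann hRQ T' F hF ≫ h ≫ inv (compareHom hann hRQ T' G hG)
    obtain ⟨α, hα⟩ := T.exists_actHom hF hG y
    refine ⟨(actHom (cellObj k Q i) (genHom (isGen_of_mem hRQ hF) (isGen_of_mem hRQ hG) α)).app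
      L', ?_⟩
    have hα : (evalGen hann (cellObj k Q j)).map
      (genHom (isGen_of_mem hRQ hF) (isGen_of_mem hRQ hG) α) = y := hα
    rw [← cancel_epi (compareHom hann hRQ T' F hF), ← compareHom_naturality, hα]
    simp [y]

omit hw' hw in
theorem cellGenerators_imageCell_iso {j : B} {X : RightFreyd (cellObj k Q i ⟶ cellObj k Q j)}
    (hX : X ∈ cellGenerators (cellObj k Q i) (imageCell k Q R) L' (cellObj k Q j)) :
    ∃ (F : i ⟶ j) (hF : (⟨i, j, F⟩ : OneMor B) ∈ R),
      Nonempty ((act (cellObj k Q i) (cellGenObj hRQ F hF)).obj L' ≅ X) := by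
  obtain ⟨F', hF', rfl⟩ := hX
  obtain ⟨i', j', F, hF, e⟩ := (mem_imageCell_iff hRQ).mp hF'
  have e : Iso₁ (⟨⟨⟨i⟩⟩, ⟨⟨j⟩⟩, F'⟩ : OneMor (CellTwoCat k Q))
    ⟨⟨⟨i'⟩⟩, ⟨⟨j'⟩⟩, genObj F (isGen_of_mem hRQ hF)⟩ := e
  cases e with
  | mk e => exact ⟨F, hF, ⟨(evalAt L' (cellObj k Q j)).mapIso e.symm⟩⟩

include hkey T T' hRQ in
theorem compareFunctor_isEquivalence (j : CellTwoCat k Q)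
    (h : ∀ M : (cellProp (cellObj k Q i) (imageCell k Q R) L' j).FullSubcategory,
      cellProp i R L j.as.as ((compareFunctor hann j).obj M.obj)) :
    ((cellProp i R L j.as.as).lift
      ((cellProp (cellObj k Q i) (imageCell k Q R) L' j).ι ⋙ compareFunctor hann j)
        h).IsEquivalence := by
  obtain ⟨⟨j⟩⟩ := j
  have hF₀ : ∀ {F : i ⟶ j} (hF : (⟨i, j, F⟩ : OneMor B) ∈ R), ∃ e : (act i F).obj L ≅
      (compareFunctor hann (cellObj k Q j)).obj
        ((act (cellObj k Q i) (cellGenObj hRQ F hF)).obj L'), True := fun {F} hF => by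
    have := isIso_compareHom hann hRQ T' hkey hF
    let e := asIso (compareHom hann hRQ T' F hF)
    exact ⟨e, trivial⟩
  refine isEquivalence_of_presented (S := cellGenerators i R L j)
    (S' := cellGenerators (cellObj k Q i) (imageCell k Q R) L' (cellObj k Q j))
    (compareFunctor hann (cellObj k Q j)) (freydLift_isCoker _) ?_ ?_ ?_
    (fun X hX => T'.relProj hX) (fun X hX => T.relProj hX) h
  · intro X hX
    obtain ⟨F, hF, ⟨e⟩⟩ := cellGenerators_imageCell_iso hRQ hX
    obtain ⟨e', -⟩ := hF₀ hF
    exact AddClosure.of_iso (e' ≪≫ (compareFunctor hann (cellObj k Q j)).mapIso e)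
      (AddClosure.of ⟨F, hF, rfl⟩)
  · rintro Y ⟨F, hF, rfl⟩
    obtain ⟨e', -⟩ := hF₀ hF
    exact ⟨_, AddClosure.of ⟨_, genMor_mem_imageCell hRQ hF, rfl⟩, ⟨e'.symm⟩⟩
  -- The image cell is closed under isomorphism, so its elements need not be images on the nose. The
  -- smaller set of strict images generates the same additive closure.
  · let S'' : Set (RightFreyd (cellObj k Q i ⟶ cellObj k Q j)) :=
      {X | ∃ (F : i ⟶ j) (hF : (⟨i, j, F⟩ : OneMor B) ∈ R),
        X = (act (cellObj k Q i) (cellGenObj hRQ F hF)).obj L'}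
    have hS'' : ∀ X ∈ cellGenerators (cellObj k Q i) (imageCell k Q R) L' (cellObj k Q j),
        AddClosure S'' X := by
      intro X hX
      obtain ⟨F, hF, ⟨e⟩⟩ := cellGenerators_imageCell_iso hRQ hX
      exact AddClosure.of_iso e (AddClosure.of ⟨F, hF, rfl⟩)
    intro X hX Y hY
    refine bijective_of_addClosure (S' := S'') (compareFunctor hann (cellObj k Q j)) ?_
      (hS'' X hX) (hS'' Y hY)
    rintro _ ⟨F, hF, rfl⟩ _ ⟨G, hG, rfl⟩
    exact compareFunctor_bijective hann hRQ T' hkey T hF hG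

omit hw in
include hkey T' hRQ in
theorem compareFunctor_cellProp (j : CellTwoCat k Q)
    (M : (cellProp (cellObj k Q i) (imageCell k Q R) L' j).FullSubcategory) :
    cellProp i R L j.as.as ((compareFunctor hann j).obj M.obj) := by
  obtain ⟨⟨j⟩⟩ := j
  refine presented_map (S := cellGenerators i R L j)
    (S' := cellGenerators (cellObj k Q i) (imageCell k Q R) L' (cellObj k Q j))
    (compareFunctor hann (cellObj k Q j)) (freydLift_isCoker _) (fun X hX => ?_) M.property
  obtain ⟨F, hF, ⟨e⟩⟩ := cellGenerators_imageCell_iso hRQ hX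
  have := isIso_compareHom hann hRQ T' hkey hF
  exact AddClosure.of_iso (asIso (compareHom hann hRQ T' F hF) ≪≫
    (compareFunctor hann (cellObj k Q j)).mapIso e) (AddClosure.of ⟨F, hF, rfl⟩)

end Compare

end FiatCells

namespace FiatCells
open Preadditive

/-! ### Coherent compatibility of the comparison functors with the action. -/

section ActCoherence

variable {B : Type u} [Bicategory.{w, v} B] [PreadditiveBicategory B]

theorem actComp_associator (i : B) {j l m n : B} (F : j ⟶ l) (H : l ⟶ m) (K : m ⟶ n)
    (X : RightFreyd (i ⟶ j)) :
    (actHom i (α_ F H K).inv).app X ≫ (actComp i (F ≫ H) K).hom.app X ≫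
        (act i K).map ((actComp i F H).hom.app X) =
      (actComp i F (H ≫ K)).hom.app X ≫ (actComp i H K).hom.app ((act i F).obj X) := by
  obtain ⟨X, rfl⟩ := freyd_exists_rep X
  have e : ∀ Y : i ⟶ j, Y ◁ (α_ F H K).inv ≫ (α_ Y (F ≫ H) K).inv ≫ (α_ Y F H).inv ▷ K =
    (α_ Y F (H ≫ K)).inv ≫ (α_ (Y ≫ F) H K).inv := fun Y => by simp
  change (RightFreyd.quotient _).map _ ≫ (RightFreyd.quotient _).map _ ≫
    (RightFreyd.quotient _).map _ = (RightFreyd.quotient _).map _ ≫ (RightFreyd.quotient _).map _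
  rw [← Functor.map_comp, ← Functor.map_comp]
  refine Eq.trans ?_ ((RightFreyd.quotient _).map_comp _ _)
  exact quotient_map_congr (e _) (e _)

theorem actComp_rightUnitor (i : B) {j l : B} (F : j ⟶ l) (X : RightFreyd (i ⟶ j)) :
    (actComp i F (𝟙 l)).hom.app X ≫ (actId i l).hom.app ((act i F).obj X) =
      (actHom i (ρ_ F).hom).app X := by
  obtain ⟨X, rfl⟩ := freyd_exists_rep X
  have e : ∀ Y : i ⟶ j, (α_ Y F (𝟙 l)).inv ≫ (ρ_ (Y ≫ F)).hom = Y ◁ (ρ_ F).hom :=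
    fun Y => by simp
  refine Eq.trans ((RightFreyd.quotient _).map_comp _ _).symm ?_
  exact quotient_map_congr (e _) (e _)

end ActCoherence

/-- The diagram chase of `compareComp_comp`, with the functors abstracted away: `h₄` is the
associativity of evaluation at L, and the other faces are naturality or defining squares. -/
theorem comp_eq_comp_of_pentagon {C : Type*} [Category C] {P₀ P₁ M₀ M₁ M₂ N₀ N₁ R₀ R₁ R₂ : C}
    {x : P₀ ⟶ M₀} {a : M₀ ⟶ M₁} {e : M₁ ⟶ M₂} {f : M₂ ⟶ N₁} {c : M₀ ⟶ N₀} {d : N₀ ⟶ N₁}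
    {y : P₀ ⟶ P₁} {z : P₁ ⟶ M₁} {e₁ : P₁ ⟶ R₁} {g : R₁ ⟶ M₂} {e₂ : R₁ ⟶ R₂} {p₂ : R₂ ⟶ N₁}
    {e₃ : P₀ ⟶ R₀} {d' : R₀ ⟶ R₂} {p : R₀ ⟶ N₀} (h₁ : x ≫ a = y ≫ z) (h₂ : z ≫ e = e₁ ≫ g)
    (h₃ : g ≫ f = e₂ ≫ p₂) (h₄ : y ≫ e₁ ≫ e₂ = e₃ ≫ d') (h₅ : x ≫ c = e₃ ≫ p)
    (h₆ : p ≫ d = d' ≫ p₂) : x ≫ c ≫ d = x ≫ a ≫ e ≫ f := by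
  rw [reassoc_of% h₅, h₆, reassoc_of% h₁, reassoc_of% h₂, h₃, ← Category.assoc e₃, ← h₄]
  simp only [Category.assoc]

section CompareComp

variable {k : Type t} [Field k] {B : Type u} [Bicategory.{w, v} B] [PreadditiveBicategory B]
  [LinearBicategory k B] [AdditiveBicategory B] {Q : Set (OneMor B)} {i : B}
  {L : RightFreyd (i ⟶ i)}
  (hann : ∀ {j : B} {F G : i ⟶ j} {α : F ⟶ G}, α ∈ (cellIdeal k Q).carrier F G →
    (actHom i α).app L = 0)

/-- The action of a 1-morphism of the 2-category associated with `Q` by a representative. -/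
abbrev repAct (i : B) {j l : CellTwoCat k Q} (H : j ⟶ l) :
    RightFreyd (i ⟶ j.as.as) ⥤ RightFreyd (i ⟶ l.as.as) := act i H.obj.as

/-- Evaluation at `L` is compatible with composition. -/
def evalGenComp {j l : CellTwoCat k Q} (X : cellObj k Q i ⟶ j) (H : j ⟶ l) :
    (evalGen hann l).obj (X ≫ H) ≅ (repAct i H).obj ((evalGen hann j).obj X) :=
  (actComp i X.obj.as H.obj.as).app L

theorem evalGenComp_naturality {j l : CellTwoCat k Q} {X Y : cellObj k Q i ⟶ j} (f : X ⟶ Y)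
    (H : j ⟶ l) :
    (evalGen hann l).map (f ▷ H) ≫ (evalGenComp hann Y H).hom =
      (evalGenComp hann X H).hom ≫ (repAct i H).map ((evalGen hann j).map f) := by
  obtain ⟨⟨j⟩⟩ := j
  obtain ⟨⟨l⟩⟩ := l
  obtain ⟨X, hX, rfl⟩ := exists_genObj X
  obtain ⟨Y, hY, rfl⟩ := exists_genObj Y
  obtain ⟨H, hH, rfl⟩ := exists_genObj H
  obtain ⟨f, rfl⟩ := genHom_surjective hX hY f
  change (actHom i (f ▷ H)).app L ≫ (actComp i Y H).hom.app L =
    (actComp i X H).hom.app L ≫ (act i H).map ((actHom i f).app L)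
  rw [actHom_whiskerRight, Category.assoc, Category.assoc, Iso.inv_hom_id_app]
  exact congrArg (_ ≫ ·) (Category.comp_id _)

theorem evalGen_whiskerLeft {j l : CellTwoCat k Q} (X : cellObj k Q i ⟶ j) {H H' : j ⟶ l}
    {α' : H.obj.as ⟶ H'.obj.as} {α : H ⟶ H'} (hα : α.hom = ((cellIdeal k Q).proj _ _).map α') :
    (evalGen hann l).map (X ◁ α) ≫ (evalGenComp hann X H').hom =
      (evalGenComp hann X H).hom ≫ (actHom i α').app ((evalGen hann j).obj X) := by
  obtain ⟨⟨j⟩⟩ := j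
  obtain ⟨⟨l⟩⟩ := l
  obtain ⟨X, hX, rfl⟩ := exists_genObj X
  obtain ⟨H, hH, rfl⟩ := exists_genObj H
  obtain ⟨H', hH', rfl⟩ := exists_genObj H'
  obtain rfl : α = genHom hH hH' α' := ObjectProperty.hom_ext _ hα
  have key : ∀ α' : H ⟶ H', (actHom i (X ◁ α')).app L ≫ (actComp i X H').hom.app L =
      (actComp i X H).hom.app L ≫ (actHom i α').app ((act i X).obj L) := fun α' => by
    rw [actHom_whiskerLeft, Category.assoc, Category.assoc, Iso.inv_hom_id_app]
    exact congrArg (_ ≫ ·) (Category.comp_id _)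
  exact key α'

theorem evalGen_rightUnitor {j : CellTwoCat k Q} (X : cellObj k Q i ⟶ j) :
    (evalGen hann j).map (ρ_ X).hom =
      (evalGenComp hann X (𝟙 j)).hom ≫ (actId i j.as.as).hom.app ((evalGen hann j).obj X) :=
  (actComp_rightUnitor i X.obj.as L).symm

theorem evalGen_associator {j l m : CellTwoCat k Q} (X : cellObj k Q i ⟶ j) (H : j ⟶ l)
    (K : l ⟶ m) :
    (evalGen hann m).map (α_ X H K).inv ≫ (evalGenComp hann (X ≫ H) K).hom ≫
        (repAct i K).map (evalGenComp hann X H).hom =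
      (evalGenComp hann X (H ≫ K)).hom ≫
        (actComp i H.obj.as K.obj.as).hom.app ((evalGen hann j).obj X) :=
  actComp_associator i X.obj.as H.obj.as K.obj.as L

/-- The projection onto the value of a comparison functor at an object of the form `H M`. -/
def liftπAct {j l : CellTwoCat k Q} (H : j ⟶ l) (A : Arrow (cellObj k Q i ⟶ j)) :
    (evalGen hann l).obj (A.right ≫ H) ⟶
      (compareFunctor hann l).obj ((act (cellObj k Q i) H).obj ((RightFreyd.quotient _).obj A)) :=
  liftπ (evalGen hann l) ((postcomp (cellObj k Q i) H).mapArrow.obj A)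

variable {hann} in
theorem liftπAct_hom_ext {j l : CellTwoCat k Q} {H : j ⟶ l} {A : Arrow (cellObj k Q i ⟶ j)}
    {Z : RightFreyd (i ⟶ l.as.as)}
    {f g : (compareFunctor hann l).obj
      ((act (cellObj k Q i) H).obj ((RightFreyd.quotient _).obj A)) ⟶ Z}
    (h : liftπAct hann H A ≫ f = liftπAct hann H A ≫ g) : f = g :=
  freydLift_hom_ext (X := (postcomp (cellObj k Q i) H).mapArrow.obj A) h

theorem liftπAct_naturality {j l : CellTwoCat k Q} (H : j ⟶ l)
    {A A' : Arrow (cellObj k Q i ⟶ j)} (f : A ⟶ A') :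
    liftπAct hann H A ≫ (compareFunctor hann l).map
        ((act (cellObj k Q i) H).map ((RightFreyd.quotient _).map f)) =
      (evalGen hann l).map (f.right ▷ H) ≫ liftπAct hann H A' :=
  liftπ_naturality (evalGen hann l) ((postcomp (cellObj k Q i) H).mapArrow.map f)

theorem liftπAct_actHom {j l : CellTwoCat k Q} {H H' : j ⟶ l} (α : H ⟶ H')
    (A : Arrow (cellObj k Q i ⟶ j)) :
    liftπAct hann H A ≫ (compareFunctor hann l).map
        ((actHom (cellObj k Q i) α).app ((RightFreyd.quotient _).obj A)) =
      (evalGen hann l).map (A.right ◁ α) ≫ liftπAct hann H' A :=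
  liftπ_naturality (evalGen hann l) (X := (postcomp (cellObj k Q i) H).mapArrow.obj A)
    (Y := (postcomp (cellObj k Q i) H').mapArrow.obj A) _

theorem liftπAct_actId {j : CellTwoCat k Q} (A : Arrow (cellObj k Q i ⟶ j)) :
    liftπAct hann (𝟙 j) A ≫ (compareFunctor hann j).map
        ((actId (cellObj k Q i) j).hom.app ((RightFreyd.quotient _).obj A)) =
      (evalGen hann j).map (ρ_ A.right).hom ≫ liftπ (evalGen hann j) A :=
  liftπ_naturality (evalGen hann j) (X := (postcomp (cellObj k Q i) (𝟙 j)).mapArrow.obj A) _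

theorem liftπAct_actComp {j l m : CellTwoCat k Q} (H : j ⟶ l) (K : l ⟶ m)
    (A : Arrow (cellObj k Q i ⟶ j)) :
    liftπAct hann (H ≫ K) A ≫ (compareFunctor hann m).map
        ((actComp (cellObj k Q i) H K).hom.app ((RightFreyd.quotient _).obj A)) =
      (evalGen hann m).map (α_ A.right H K).inv ≫
        liftπAct hann K ((postcomp (cellObj k Q i) H).mapArrow.obj A) :=
  liftπ_naturality (evalGen hann m) (X := (postcomp (cellObj k Q i) (H ≫ K)).mapArrow.obj A)
    (Y := (postcomp (cellObj k Q i) K).mapArrow.obj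
      ((postcomp (cellObj k Q i) H).mapArrow.obj A)) _

/-- The comparison functors are compatible with the action, on objects. -/
theorem exists_compareComp {j l : CellTwoCat k Q} (H : j ⟶ l) (A : Arrow (cellObj k Q i ⟶ j)) :
    ∃ e : (compareFunctor hann l).obj
        ((act (cellObj k Q i) H).obj ((RightFreyd.quotient _).obj A)) ≅
      (repAct i H).obj ((compareFunctor hann j).obj ((RightFreyd.quotient _).obj A)),
      liftπAct hann H A ≫ e.hom =
        (evalGenComp hann A.right H).hom ≫ (repAct i H).map (liftπ (evalGen hann j) A) := by
  refine (isCoker_liftπ (evalGen hann l)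
    ((postcomp (cellObj k Q i) H).mapArrow.obj A)).exists_iso ?_
  exact ((isCoker_liftπ (evalGen hann j) A).map_of_preserves (repAct i H)).iso_comp
    (evalGenComp hann A.left H) (evalGenComp hann A.right H) _
    (evalGenComp_naturality hann A.hom H)

/-- The comparison functors are compatible with the action, on objects. -/
def compareCompApp {j l : CellTwoCat k Q} (H : j ⟶ l) (A : Arrow (cellObj k Q i ⟶ j)) :
    (compareFunctor hann l).obj
        ((act (cellObj k Q i) H).obj ((RightFreyd.quotient _).obj A)) ≅
      (repAct i H).obj ((compareFunctor hann j).obj ((RightFreyd.quotient _).obj A)) :=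
  (exists_compareComp hann H A).choose

theorem liftπAct_compareCompApp {j l : CellTwoCat k Q} (H : j ⟶ l)
    (A : Arrow (cellObj k Q i ⟶ j)) :
    liftπAct hann H A ≫ (compareCompApp hann H A).hom =
      (evalGenComp hann A.right H).hom ≫ (repAct i H).map (liftπ (evalGen hann j) A) :=
  (exists_compareComp hann H A).choose_spec

theorem compareCompApp_naturality {j l : CellTwoCat k Q} (H : j ⟶ l)
    {X Y : Arrow (cellObj k Q i ⟶ j)} (f : X ⟶ Y) :
    (compareFunctor hann l).map ((act (cellObj k Q i) H).map ((RightFreyd.quotient _).map f)) ≫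
        (compareCompApp hann H Y).hom =
      (compareCompApp hann H X).hom ≫
        (repAct i H).map ((compareFunctor hann j).map ((RightFreyd.quotient _).map f)) := by
  refine liftπAct_hom_ext ?_
  rw [← Category.assoc, ← Category.assoc, liftπAct_naturality, liftπAct_compareCompApp,
    Category.assoc, Category.assoc, liftπAct_compareCompApp, ← Functor.map_comp, liftπ_naturality,
    Functor.map_comp, ← Category.assoc, ← Category.assoc, evalGenComp_naturality]

/-- The comparison functors are compatible with the action. -/
def compareComp {j l : CellTwoCat k Q} (H : j ⟶ l) :
    act (cellObj k Q i) H ⋙ compareFunctor hann l ≅ compareFunctor hann j ⋙ repAct i H :=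
  NatIso.ofComponents (fun X => compareCompApp hann H X.as) (by
    rintro ⟨X⟩ ⟨Y⟩ ⟨f⟩
    exact compareCompApp_naturality hann H f)

theorem liftπAct_compareComp {j l : CellTwoCat k Q} (H : j ⟶ l)
    (A : Arrow (cellObj k Q i ⟶ j)) :
    liftπAct hann H A ≫ (compareComp hann H).hom.app ((RightFreyd.quotient _).obj A) =
      (evalGenComp hann A.right H).hom ≫ (repAct i H).map (liftπ (evalGen hann j) A) :=
  liftπAct_compareCompApp hann H A

theorem compareComp_naturality {j l : CellTwoCat k Q} {H H' : j ⟶ l}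
    {α' : H.obj.as ⟶ H'.obj.as} {α : H ⟶ H'} (hα : α.hom = ((cellIdeal k Q).proj _ _).map α')
    (X : RightFreyd (cellObj k Q i ⟶ j)) :
    (compareFunctor hann l).map ((actHom (cellObj k Q i) α).app X) ≫
        (compareComp hann H').hom.app X =
      (compareComp hann H).hom.app X ≫ (actHom i α').app ((compareFunctor hann j).obj X) := by
  obtain ⟨A, rfl⟩ := freyd_exists_rep X
  refine liftπAct_hom_ext (A := A) ?_
  have h := (actHom i α').naturality (liftπ (evalGen hann j) A)
  rw [← Category.assoc, ← Category.assoc, liftπAct_actHom, liftπAct_compareComp, Category.assoc,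
    Category.assoc, liftπAct_compareComp, h, ← Category.assoc, ← Category.assoc,
    evalGen_whiskerLeft hann _ hα]

theorem compareComp_id (j : CellTwoCat k Q) (X : RightFreyd (cellObj k Q i ⟶ j)) :
    (compareComp hann (𝟙 j)).hom.app X ≫
        (actId i j.as.as).hom.app ((compareFunctor hann j).obj X) =
      (compareFunctor hann j).map ((actId (cellObj k Q i) j).hom.app X) := by
  obtain ⟨A, rfl⟩ := freyd_exists_rep X
  refine liftπAct_hom_ext (A := A) ?_
  have h := (actId i j.as.as).hom.naturality (liftπ (evalGen hann j) A)
  rw [← Category.assoc, liftπAct_compareComp, liftπAct_actId, evalGen_rightUnitor, Category.assoc,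
    Category.assoc]
  exact congrArg (_ ≫ ·) h

/-- As with every coherence law here, it is enough to check after the epimorphism from the
evaluation at the right object of A, where the law becomes the one for composition of 1-morphisms
acting on L. -/
theorem compareComp_comp {j l m : CellTwoCat k Q} (H : j ⟶ l) (K : l ⟶ m)
    (X : RightFreyd (cellObj k Q i ⟶ j)) :
    (compareComp hann (H ≫ K)).hom.app X ≫
        (actComp i H.obj.as K.obj.as).hom.app ((compareFunctor hann j).obj X) =
      (compareFunctor hann m).map ((actComp (cellObj k Q i) H K).hom.app X) ≫
        (compareComp hann K).hom.app ((act (cellObj k Q i) H).obj X) ≫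
          (repAct i K).map ((compareComp hann H).hom.app X) := by
  obtain ⟨A, rfl⟩ := freyd_exists_rep X
  refine liftπAct_hom_ext (A := A) ?_
  have h := (actComp i H.obj.as K.obj.as).hom.naturality (liftπ (evalGen hann j) A)
  have h1 : liftπAct hann K ((postcomp (cellObj k Q i) H).mapArrow.obj A) ≫
      (compareComp hann K).hom.app ((act (cellObj k Q i) H).obj ((RightFreyd.quotient _).obj A)) =
      (evalGenComp hann (A.right ≫ H) K).hom ≫ (repAct i K).map (liftπAct hann H A) :=
    liftπAct_compareComp hann K ((postcomp (cellObj k Q i) H).mapArrow.obj A)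
  have h2 := congrArg (repAct i K).map (liftπAct_compareComp hann H A)
  rw [Functor.map_comp, Functor.map_comp] at h2
  exact comp_eq_comp_of_pentagon (liftπAct_actComp hann H K A) h1 h2
    (evalGen_associator hann A.right H K) (liftπAct_compareComp hann (H ≫ K) A) h

end CompareComp

end FiatCells

namespace FiatCells
open Preadditive

/-! ### Assembling the pseudonatural transformation. -/

section CompareTrans

variable {k : Type t} [Field k] {B : Type u} [Bicategory.{w, v} B] [PreadditiveBicategory B]
  [LinearBicategory k B] [AdditiveBicategory B] {Q : Set (OneMor B)} {i : B}
  {L : RightFreyd (i ⟶ i)}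
  (hann : ∀ {j : B} {F G : i ⟶ j} {α : F ⟶ G}, α ∈ (cellIdeal k Q).carrier F G →
    (actHom i α).app L = 0)

omit [AdditiveBicategory B] in
theorem actHom_id_comp (i : B) {j l : B} (F : j ⟶ l) {X : RightFreyd (i ⟶ j)}
    {Y : RightFreyd (i ⟶ l)} (f : (act i F).obj X ⟶ Y) : (actHom i (𝟙 F)).app X ≫ f = f := by
  rw [actHom_id, Category.id_comp]

variable {R : Set (OneMor B)} {L' : RightFreyd (cellObj k Q i ⟶ cellObj k Q i)}
  (hs : CellStable i R L) (hs' : CellStable (cellObj k Q i) (imageCell k Q R) L')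
  (ha : CellAnnihilated k Q i R L hs)
  (hprop : ∀ (j : CellTwoCat k Q)
    (M : (cellProp (cellObj k Q i) (imageCell k Q R) L' j).FullSubcategory),
    cellProp i R L j.as.as ((compareFunctor hann j).obj M.obj))

/-- The comparison functor on the cell 2-representations. -/
def cellCompare (j : CellTwoCat k Q) :
    (cellProp (cellObj k Q i) (imageCell k Q R) L' j).FullSubcategory ⥤
      (cellProp i R L j.as.as).FullSubcategory :=
  (cellProp i R L j.as.as).lift
    ((cellProp (cellObj k Q i) (imageCell k Q R) L' j).ι ⋙ compareFunctor hann j) (hprop j)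

/-- The comparison functors form a pseudonatural transformation. -/
def compareTrans : Pseudofunctor.StrongTrans
    (cellRep (cellObj k Q i) (imageCell k Q R) L' hs') (restrictedCellRep k Q i R L hs ha) where
  app j := (cellCompare hann hprop j).toCatHom
  naturality {j l} H := Cat.Hom.isoMk (NatIso.ofComponents
    (fun X => (cellProp i R L l.as.as).isoMk ((compareComp hann H).app X.obj))
    (fun f => ObjectProperty.hom_ext _ ((compareComp hann H).hom.naturality f.hom)))
  naturality_naturality {j l H H'} := by
    rintro ⟨⟨α⟩⟩
    apply Cat.Hom₂.ext; apply NatTrans.ext; funext X; apply ObjectProperty.hom_ext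
    exact compareComp_naturality hann rfl X.obj
  naturality_id j := by
    apply Cat.Hom₂.ext; apply NatTrans.ext; funext X; apply ObjectProperty.hom_ext
    -- The unit constraint of the restricted pseudofunctor carries the action of an identity
    -- 2-morphism, coming from the inclusion of C_Q; it is removed first.
    refine Eq.trans (congrArg ((compareComp hann (𝟙 j)).hom.app X.obj ≫ ·)
      (actHom_id_comp i (𝟙 j.as.as) ((actId i j.as.as).hom.app _))) ?_
    refine (compareComp_id hann j X.obj).trans ?_
    exact ((congrArg (_ ≫ ·) (Category.comp_id _)).trans (Category.comp_id _)).symm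
  naturality_comp {j l m} H K := by
    apply Cat.Hom₂.ext; apply NatTrans.ext; funext X; apply ObjectProperty.hom_ext
    refine Eq.trans (congrArg ((compareComp hann (H ≫ K)).hom.app X.obj ≫ ·)
      (actHom_id_comp i (H.obj.as ≫ K.obj.as) ((actComp i H.obj.as K.obj.as).hom.app _))) ?_
    refine (compareComp_comp hann H K X.obj).trans ?_
    refine congrArg (_ ≫ ·) ?_
    refine Eq.trans ?_ (Category.id_comp _).symm
    refine congrArg (_ ≫ ·) ?_
    refine Eq.trans ?_ (Category.id_comp _).symm
    exact (Category.comp_id _).symm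

end CompareTrans

/-! ### Matching the Duflo 1-morphisms over C and C_Q, and the main theorem. -/

section Main

variable {k : Type t} [Field k] {B : Type u} [Bicategory.{w, v} B]
    [PreadditiveBicategory B] [LinearBicategory k B] [AdditiveBicategory B]
    [hw : ∀ i j : B, HasWeakKernels (i ⟶ j)] [hidem : ∀ i j : B, IsIdempotentComplete (i ⟶ j)]
    (hB : ∀ i j : B, IsKrullSchmidt k (i ⟶ j)) (S : Involution B)
    (hS : ∀ {i j : B} (F : i ⟶ j), Nonempty (F ⊣ S.star F))
    {Q : Set (OneMor B)} (hQ : IsTwoSidedCell Q) (hreg : IsStronglyRegular Q)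
    {R : Set (OneMor B)} (hR : IsRightCell R) (hRQ : R ⊆ Q) {i : B} (hi : ∀ F ∈ R, F.dom = i)
    {L : RightFreyd (i ⟶ i)} (T : CellTop i R L)
    {L' : RightFreyd (cellObj k Q i ⟶ cellObj k Q i)}

include hB S hS hQ hR hRQ hi T in
theorem actHom_app_eq_zero_of_mem {j : B} {F G : i ⟶ j} {α : F ⟶ G}
    (hα : α ∈ (cellIdeal k Q).carrier F G) : (actHom i α).app L = 0 := by
  -- Take H = 𝟙 in the annihilator; the unit isomorphism then identifies 𝟙 L with L.
  have h := mem_annIdeal hB S hS hQ hR hRQ hi T hα (𝟙 i)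
  have h1 := (actHom i α).naturality ((actId i i).hom.app L)
  rw [h, zero_comp] at h1
  exact (cancel_epi ((act i F).map ((actId i i).hom.app L))).mp (h1.trans comp_zero.symm)

include hB S hS hQ hreg hR hi in
-- Let G in R represent `T'.G`. Over C_Q the Duflo property makes it a summand of `G ≫ G*`, and this
-- retract lifts to C. Over C the same property makes `T.G` a summand of `G ≫ G*`. By
-- `iso₁_of_retract` they are isomorphic.
theorem exists_isoCellTop (T' : CellTop (cellObj k Q i) (imageCell k Q R) L') :
    ∃ hT : (⟨i, i, T.G⟩ : OneMor B) ∈ R,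
      Nonempty (T'.G ≅ genObj T.G (isGen_of_mem (k := k) hRQ hT)) := by
  have hB' : ∀ i j : CellTwoCat k Q, IsKrullSchmidt k (i ⟶ j) := cellTwoCat_isKrullSchmidt hB
  have hw' : ∀ i j : CellTwoCat k Q, HasWeakKernels (i ⟶ j) := fun i j => (hB' i j).hasWeakKernels
  have hT := T.mem hB hR hi (S.hasLeftAdjoints hS i R)
  have hT' := T'.mem hB' (imageCell_isRightCell hB S hS hQ hR hRQ) (imageCell_dom hRQ hi)
    (hasLeftAdjoints_imageCell hB S hS hQ hRQ i)
  obtain ⟨i', j', G, hG, e⟩ := (mem_imageCell_iff hRQ).mp hT'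
  have e : Iso₁ (⟨⟨⟨i⟩⟩, ⟨⟨i⟩⟩, T'.G⟩ : OneMor (CellTwoCat k Q))
    ⟨⟨⟨i'⟩⟩, ⟨⟨j'⟩⟩, genObj G (isGen_of_mem hRQ hG)⟩ := e
  cases e with
  | mk e =>
    refine ⟨hT, ?_⟩
    have hG' := isGen_of_mem (k := k) hRQ hG
    have hsG : IsGen k Q (S.star G) := IsGen.of_mem (starMor_mem hB S hS hQ (hRQ hG))
    obtain ⟨adj⟩ := S.star_adj hS G
    obtain ⟨r⟩ := T.nonempty_retract_comp_adjoint hB hG adj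
    obtain ⟨r'⟩ := T'.nonempty_retract_comp_adjoint hB' (genMor_mem_imageCell hRQ hG)
      (genAdjunction hsG hG' adj)
    obtain ⟨r''⟩ := nonempty_retract_of_gen hB hG' (hG'.comp hsG) (hQ.indec (hRQ hG))
      (id_notMem_cellIdeal hB S hS hQ (hRQ hG)) ((Retract.ofIso e.symm).trans r')
    have h := iso₁_of_retract hB S hS hQ hreg (hRQ hT) (hRQ hG) (hR.leR hT hG) r r''
    cases h with
    | mk e' => exact ⟨e ≪≫ (genIso (isGen_of_mem hRQ hT) hG' e').symm⟩

include hB S hS hQ hreg hR hi T in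
-- Once the two Duflo 1-morphisms are identified, the splitting criterion for mates reads the same
-- over C and C_Q. This supplies `hkey`.
theorem actHom_genHom_app_eq_zero_iff (T' : CellTop (cellObj k Q i) (imageCell k Q R) L') {j : B}
    {A F : i ⟶ j} (hA : IsGen k Q A) (hF : (⟨i, j, F⟩ : OneMor B) ∈ R) (α : A ⟶ F) :
    (actHom (cellObj k Q i) (genHom hA (isGen_of_mem hRQ hF) α)).app L' = 0 ↔
      (actHom i α).app L = 0 := by
  obtain ⟨hT, ⟨e⟩⟩ := exists_isoCellTop hB S hS hQ hreg hR hRQ hi T T'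
  obtain ⟨adj⟩ := S.star_adj hS F
  have := T.simple
  have := T'.simple
  refine actHom_genHom_eq_zero_iff hB T.indec (isGen_of_mem hRQ hT)
    (id_notMem_cellIdeal hB S hS hQ (hRQ hT)) T.p T.p_ne
    ((RightFreyd.functor _).map e.inv ≫ T'.p) (fun h => T'.p_ne ?_) hA _
    (IsGen.of_mem (starMor_mem hB S hS hQ (hRQ hF))) adj α
  rwa [← cancel_epi ((RightFreyd.functor _).map e.inv), comp_zero]

include hB S hS hQ hreg hR hRQ hi T in
theorem linEquiv_cellRep (T' : CellTop (cellObj k Q i) (imageCell k Q R) L')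
    (hs : CellStable i R L) (hs' : CellStable (cellObj k Q i) (imageCell k Q R) L')
    (ha : CellAnnihilated k Q i R L hs) :
    LinEquiv k (cellRep (cellObj k Q i) (imageCell k Q R) L' hs')
      (restrictedCellRep k Q i R L hs ha) := by
  have hB' : ∀ i j : CellTwoCat k Q, IsKrullSchmidt k (i ⟶ j) := cellTwoCat_isKrullSchmidt hB
  have hw' : ∀ i j : CellTwoCat k Q, HasWeakKernels (i ⟶ j) := fun i j => (hB' i j).hasWeakKernels
  have hann : ∀ {j : B} {F G : i ⟶ j} {α : F ⟶ G}, α ∈ (cellIdeal k Q).carrier F G →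
    (actHom i α).app L = 0 := fun hα => actHom_app_eq_zero_of_mem hB S hS hQ hR hRQ hi T hα
  have hkey : ∀ {j : B} {A F : i ⟶ j} (hA : IsGen k Q A) (hF : (⟨i, j, F⟩ : OneMor B) ∈ R)
      (α : A ⟶ F), (actHom (cellObj k Q i) (genHom hA (isGen_of_mem hRQ hF) α)).app L' = 0 ↔
      (actHom i α).app L = 0 := fun hA hF α =>
    actHom_genHom_app_eq_zero_iff hB S hS hQ hreg hR hRQ hi T T' hA hF α
  have hprop := compareFunctor_cellProp hann hRQ T' hkey
  refine ⟨compareTrans hann hs hs' ha hprop, fun j => ⟨?_, ?_, ?_⟩⟩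
  · exact compareFunctor_isEquivalence hann hRQ T' hkey T j (hprop j)
  · exact ⟨fun {X Y f g} =>
      ObjectProperty.hom_ext _ ((freydLift_additive (evalGen hann j)).map_add)⟩
  · exact ⟨fun {X Y} f c =>
      ObjectProperty.hom_ext _ ((freydLift_linear (evalGen hann j)).map_smul f.hom c)⟩

end Main

end FiatCells

end

theorem proposition5 {k : Type t} [Field k] [IsAlgClosed k] {C : Type u} [Bicategory.{w, v} C]
    [PreadditiveBicategory C] [LinearBicategory k C] [AdditiveBicategory C] (hC : IsFiat k C)
    (Q : Set (OneMor C)) (hQ : IsTwoSidedCell Q) (hreg : IsStronglyRegular Q) :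
    IsTwoSidedCell (imageCell k Q Q) ∧
    (∀ F ∈ Q, ∀ G ∈ Q, Iso₁ ((cellIdeal k Q).toQuot F) ((cellIdeal k Q).toQuot G) → Iso₁ F G) ∧
    ∀ (R : Set (OneMor C)), IsRightCell R → R ⊆ Q → ∀ i : C, (∀ F ∈ R, F.dom = i) →
      IsRightCell (imageCell k Q R) ∧
      (∃ L : RightFreyd (i ⟶ i), IsCellSimple i R L) ∧
      (∃ L' : RightFreyd (cellObj k Q i ⟶ cellObj k Q i),
        IsCellSimple (cellObj k Q i) (imageCell k Q R) L') ∧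
      ∀ (L : RightFreyd (i ⟶ i)) (L' : RightFreyd (cellObj k Q i ⟶ cellObj k Q i)),
        IsCellSimple i R L → IsCellSimple (cellObj k Q i) (imageCell k Q R) L' →
        ∃ (h : CellStable i R L) (h' : CellStable (cellObj k Q i) (imageCell k Q R) L')
          (ha : CellAnnihilated k Q i R L h),
          LinEquiv k (cellRep (cellObj k Q i) (imageCell k Q R) L' h') (restrictedCellRep k Q i R L h ha) := by
  obtain ⟨hfin, S, hS⟩ := hC
  have hidem := hfin.idempotentComplete
  have hB : ∀ i j : C, IsKrullSchmidt k (i ⟶ j) := fun i j =>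
    IsKrullSchmidt.of_idempotentComplete hfin.finiteDimensional (hfin.finite_indec i j)
  have hw : ∀ i j : C, HasWeakKernels (i ⟶ j) := fun i j => (hB i j).hasWeakKernels
  -- Over C_Q the Krull–Schmidt property, together with left adjoints for the image of R, is enough
  -- to rerun the construction of L_R and of its Duflo 1-morphism; that C_Q is fiat is not required.
  have hB' : ∀ i j : CellTwoCat k Q, IsKrullSchmidt k (i ⟶ j) := cellTwoCat_isKrullSchmidt hB
  have hw' : ∀ i j : CellTwoCat k Q, HasWeakKernels (i ⟶ j) := fun i j => (hB' i j).hasWeakKernels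
  refine ⟨imageCell_isTwoSidedCell hB S hS hQ hreg,
    fun F hF G hG h => iso₁_of_toQuot hB S hS hQ hF hG h, fun R hR hRQ i hi => ?_⟩
  have hR' := imageCell_isRightCell hB S hS hQ hR hRQ
  have hi' : ∀ X ∈ imageCell k Q R, X.dom = cellObj k Q i := imageCell_dom hRQ hi
  have hadj' : HasLeftAdjoints (cellObj k Q i) (imageCell k Q R) :=
    hasLeftAdjoints_imageCell hB S hS hQ hRQ i
  refine ⟨hR', exists_isCellSimple hB hR hi (S.hasLeftAdjoints hS i R),
    exists_isCellSimple hB' hR' hi' hadj', fun L L' hL hL' => ?_⟩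
  obtain ⟨T⟩ := hL.nonempty_cellTop hB (S.hasLeftAdjoints hS i R)
  obtain ⟨T'⟩ := hL'.nonempty_cellTop hB' hadj'
  have hs : CellStable i R L := cellStable hB S hS hQ hR hRQ hi T hreg.1
  have hs' : CellStable (cellObj k Q i) (imageCell k Q R) L' :=
    cellStable_imageCell hB hQ hreg.1 hR hRQ i L'
  have ha : CellAnnihilated k Q i R L hs := cellAnnihilated hB S hS hQ hR hRQ hi T hs
  exact ⟨hs, hs', ha, linEquiv_cellRep hB S hS hQ hreg hR hRQ hi T T' hs hs' ha⟩
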